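/- Let $k$ be a field, let $X=S^1$, let $Z=\{p,q\}\subset X$ consist of two distinct points, with inclusion $i:Z\hookrightarrow X$, and let $j:U=X\setminus Z\hookrightarrow X$ be the inclusion of the complement, which has exactly two connected components $U_1,U_2$. Work in the bounded derived categories $D^b_c(-;k)$ of constructible sheaves of $k$-vector spaces, put $H^d(X;A)=\mathrm{Hom}(k_X,A[d])$ and $H^d_Z(X;A)=\mathrm{Hom}(k_X,i_*i^!A[d])$, let $\mathrm{forg}:H^d_Z(X;A)\to H^d(X;A)$ be the map induced by the counit $i_*i^!A\to A$, and let $\delta:H^0(U;k_U)\to H^1_Z(X;k_X)$ be the connecting map of the localization triangle $i_*i^!k_X\to k_X\to j_*j^*k_X\to i_*i^!k_X[1]$, whose third arrow is uniquely determined by the counit and the unit. For $c\in H^1(X;k_X)$ let $\mathrm{Lift}^1_Z(c)=\{\tilde c\in H^1_Z(X;k_X)\mid \mathrm{forg}(\tilde c)=c\}$, and let $\mathrm{Loc}^{\mathrm{tor}}_Z(c)\subset\mathrm{Hom}(k_Z,i^!k_X[1])$ be its image under the adjunction isomorphism $\mathrm{adj}:H^1_Z(X;k_X)\cong\mathrm{Hom}(k_Z,i^!k_X[1])$.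 Let $\mathbf 1_{U_a}\in H^0(U;k_U)$ be the section equal to $1$ on $U_a$ and to $0$ on the other component. The complexes $k_X$, $j_*j^*k_X$, $i_*i^!k_X$ on $X$, $k_U$ and $j^*k_X$ on $U$, and $k_Z$ and $i^!k_X$ on $Z$ lie in $D^b_c$, and $H^1(X;k_X)\cong k$. The map $(a,b)\mapsto\delta(a\mathbf 1_{U_1}+b\mathbf 1_{U_2})$ induces an isomorphism $(k\oplus k)/\Delta(k)\cong\mathrm{im}\,\delta$, where $\Delta$ is the diagonal, and $\mathrm{im}\,\delta\cong k$. For every nonzero $c\in H^1(X;k_X)$: (1) $j^*c=0$; (2) $\mathrm{Lift}^1_Z(c)$ is a (nonempty) torsor under $\mathrm{im}\,\delta$ and is not a singleton; (3) for every $\tilde c_0\in\mathrm{Lift}^1_Z(c)$, the supported refinements of $c$ are exactly the classes $\tilde c_0+t\,\delta(\mathbf 1_{U_1})$ with $t\in k$, and each of them is of this form for a unique $t$; if $\mathrm{char}\,k\neq2$, they are likewise exactly the classes $\tilde c_0+t\,\delta(\mathbf 1_{U_1}-\mathbf 1_{U_2})$ with $t\in k$, again for a unique $t$; (4) $\mathrm{Loc}^{\mathrm{tor}}_Z(c)$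 is a torsor under $\mathrm{adj}(\mathrm{im}\,\delta)\cong k$, i.e. an affine line over $k$; in particular it is not a singleton. -/

import Mathlib

open CategoryTheory Limits TopologicalSpace Opposite

universe u
noncomputable section

namespace SheafLoc

section Abstract

universe v₁ v₂ u₁ u₂ w₁ w₂
variable {A : Type u₁} [Category.{v₁} A] [Abelian A] {B : Type u₂} [Category.{v₂} B] [Abelian B]

/-- The adjunction on cochain complexes induced by an adjunction of additive functors. -/
def complexAdj {L : A ⥤ B} {R : B ⥤ A} [L.Additive] [R.Additive] (adj : L ⊣ R) :
    L.mapHomologicalComplex (ComplexShape.up ℤ) ⊣ R.mapHomologicalComplex (ComplexShape.up ℤ) :=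
  Adjunction.mkOfUnitCounit
    { unit :=
        { app := fun K =>
            { f := fun n => adj.unit.app (K.X n)
              comm' := fun i j _ => (adj.unit.naturality (K.d i j)).symm }
          naturality := fun K M f => by ext n; exact adj.unit.naturality (f.f n) }
      counit :=
        { app := fun K =>
            { f := fun n => adj.counit.app (K.X n)
              comm' := fun i j _ => (adj.counit.naturality (K.d i j)).symm }
          naturality := fun K M f => by ext n; exact adj.counit.naturality (f.f n) }
      left_triangle := by
        ext K n
        have := adj.left_triangle_components (K.X n)
        simp
        exact this
      right_triangle := by
        ext K n
        have := adj.right_triangle_components (K.X n)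
        simp
        exact this }

variable [HasDerivedCategory.{w₁} A] [HasDerivedCategory.{w₂} B]

/-- The functor between bounded below derived categories induced by an exact functor. -/
def mapDPlus (F : A ⥤ B) [F.Additive] [PreservesFiniteLimits F] [PreservesFiniteColimits F] :
    DerivedCategory.Plus A ⥤ DerivedCategory.Plus B :=
  DerivedCategory.TStructure.t.plus.lift (DerivedCategory.Plus.ι ⋙ F.mapDerivedCategory) (by
    rintro ⟨X, n, K, e, hK⟩
    refine ⟨n, (F.mapHomologicalComplex _).obj K,
      F.mapDerivedCategory.mapIso e ≪≫ F.mapDerivedCategoryFactors.app K, ?_⟩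
    infer_instance)

section
variable (F : A ⥤ B) [F.Additive] [PreservesFiniteLimits F] [PreservesFiniteColimits F]

instance : (mapDPlus F).CommShift ℤ := by
  dsimp only [mapDPlus]; infer_instance

instance (k : Type*) [Ring k] [Linear k A] [Linear k B] [F.Linear k] :
    (mapDPlus F).Linear k where
  map_smul f r := by
    apply DerivedCategory.Plus.ι.map_injective
    exact F.mapDerivedCategory.map_smul r f.hom

instance : (mapDPlus F).Additive where
  map_add {_ _ f g} := by
    apply DerivedCategory.Plus.ι.map_injective
    exact F.mapDerivedCategory.map_add (f := f.hom) (g := g.hom)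
end

variable {L : A ⥤ B} {R : B ⥤ A} [L.Additive] [R.Additive]
  [PreservesFiniteLimits L] [PreservesFiniteColimits L]

/-- Two exact adjoint functors induce adjoint functors on bounded below derived categories. -/
def mapDPlusAdj [PreservesFiniteLimits R] [PreservesFiniteColimits R] (adj : L ⊣ R) :
    mapDPlus L ⊣ mapDPlus R :=
  letI : CatCommSq (L.mapHomologicalComplex (ComplexShape.up ℤ)) DerivedCategory.Q
    DerivedCategory.Q L.mapDerivedCategory := ⟨L.mapDerivedCategoryFactors.symm⟩
  letI : CatCommSq (R.mapHomologicalComplex (ComplexShape.up ℤ)) DerivedCategory.Q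
    DerivedCategory.Q R.mapDerivedCategory := ⟨R.mapDerivedCategoryFactors.symm⟩
  Adjunction.restrictFullyFaithful (hiC := DerivedCategory.TStructure.t.plus.fullyFaithfulι)
    (hiD := DerivedCategory.TStructure.t.plus.fullyFaithfulι)
    (adj := (complexAdj adj).localization DerivedCategory.Q
      (HomologicalComplex.quasiIso A (ComplexShape.up ℤ)) DerivedCategory.Q
      (HomologicalComplex.quasiIso B (ComplexShape.up ℤ))
      L.mapDerivedCategory R.mapDerivedCategory)
    (comm1 := Iso.refl _) (comm2 := Iso.refl _)

open DerivedCategory in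
lemma exists_Q_map_eq (K J : CochainComplex A ℤ) [J.IsKInjective] (g : Q.obj K ⟶ Q.obj J) :
    ∃ g₀ : K ⟶ J, Q.map g₀ = g := by
  obtain ⟨g₁, hg₁⟩ := (CochainComplex.IsKInjective.Qh_map_bijective
    ((HomotopyCategory.quotient _ _).obj K) J).2
      ((quotientCompQhIso A).hom.app K ≫ g ≫ (quotientCompQhIso A).inv.app J)
  obtain ⟨g₀, rfl⟩ := (HomotopyCategory.quotient _ _).map_surjective g₁
  refine ⟨g₀, ?_⟩
  have h := quotientCompQhIso_hom_naturality g₀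
  rw [hg₁] at h
  rw [← cancel_epi ((quotientCompQhIso A).hom.app K), ← h]
  simp

open DerivedCategory in
lemma homotopy_of_Q_map_eq {K J : CochainComplex A ℤ} [J.IsKInjective] {g g' : K ⟶ J}
    (h : Q.map g = Q.map g') : Nonempty (Homotopy g g') := by
  refine ⟨HomotopyCategory.homotopyOfEq _ _
    ((CochainComplex.IsKInjective.Qh_map_bijective _ J).1 ?_)⟩
  rw [← cancel_mono ((quotientCompQhIso A).hom.app J), quotientCompQhIso_hom_naturality,
    quotientCompQhIso_hom_naturality, h]

open DerivedCategory in
lemma Q_map_eq_of_homotopy' {K J : CochainComplex A ℤ} {g g' : K ⟶ J}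
    (h : Homotopy g g') : Q.map g = Q.map g' := by
  rw [← cancel_epi ((quotientCompQhIso A).hom.app K), ← quotientCompQhIso_hom_naturality,
    ← quotientCompQhIso_hom_naturality, HomotopyCategory.eq_of_homotopy _ _ h]

open DerivedCategory in
lemma bijective_map_comp_counit (adj : L ⊣ R) (J : CochainComplex B ℤ) [J.IsKInjective]
    [CochainComplex.IsKInjective ((R.mapHomologicalComplex (ComplexShape.up ℤ)).obj J)]
    (X : DerivedCategory A) :
    Function.Bijective
      (fun f : X ⟶ Q.obj ((R.mapHomologicalComplex (ComplexShape.up ℤ)).obj J) =>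
        (L.mapDerivedCategory.map f ≫ L.mapDerivedCategoryFactors.hom.app _ ≫
          Q.map ((complexAdj adj).counit.app J) : L.mapDerivedCategory.obj X ⟶ Q.obj J)) := by
  let K := Q.objPreimage X
  let e : Q.obj K ≅ X := Q.objObjPreimageIso X
  have key : ∀ f₀ : K ⟶ (R.mapHomologicalComplex (ComplexShape.up ℤ)).obj J,
      L.mapDerivedCategory.map (Q.map f₀) ≫ L.mapDerivedCategoryFactors.hom.app _ ≫
        Q.map ((complexAdj adj).counit.app J) =
      L.mapDerivedCategoryFactors.hom.app K ≫
        Q.map (((complexAdj adj).homEquiv K J).symm f₀) := by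
    intro f₀
    have h := L.mapDerivedCategoryFactors.hom.naturality f₀
    dsimp only [Functor.comp_obj, Functor.comp_map] at h
    rw [reassoc_of% h, Adjunction.homEquiv_counit, ← Q.map_comp]
  constructor
  · intro f f' h
    dsimp only at h
    obtain ⟨f₀, hf₀⟩ := exists_Q_map_eq _ _ (e.hom ≫ f)
    obtain ⟨f₁, hf₁⟩ := exists_Q_map_eq _ _ (e.hom ≫ f')
    rw [← cancel_epi e.hom, ← hf₀, ← hf₁]
    have h' := congrArg (fun t => L.mapDerivedCategory.map e.hom ≫ t) h
    rw [← Functor.map_comp_assoc, ← Functor.map_comp_assoc, ← hf₀, ← hf₁, key, key,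
      cancel_epi] at h'
    obtain ⟨H⟩ := homotopy_of_Q_map_eq h'
    apply Q_map_eq_of_homotopy'
    have H' := (R.mapHomotopy H).compLeft ((complexAdj adj).unit.app K)
    have hu : ∀ t : K ⟶ (R.mapHomologicalComplex (ComplexShape.up ℤ)).obj J,
        (complexAdj adj).unit.app K ≫ (R.mapHomologicalComplex (ComplexShape.up ℤ)).map
          (((complexAdj adj).homEquiv K J).symm t) = t := by
      intro t
      exact ((complexAdj adj).homEquiv_unit K J _).symm.trans (Equiv.apply_symm_apply _ _)
    rwa [hu, hu] at H'
  · intro g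
    obtain ⟨g₀, hg₀⟩ := exists_Q_map_eq _ _
      (L.mapDerivedCategoryFactors.inv.app K ≫ L.mapDerivedCategory.map e.hom ≫ g)
    refine ⟨e.inv ≫ Q.map ((complexAdj adj).homEquiv K J g₀), ?_⟩
    dsimp only
    rw [Functor.map_comp_assoc, key, Equiv.symm_apply_apply, hg₀]
    simp [← Functor.map_comp_assoc]

open DerivedCategory in
theorem isLeftAdjoint_mapDPlus [EnoughInjectives B] (adj : L ⊣ R) :
    (mapDPlus L).IsLeftAdjoint := by
  have : ∀ Y, HasTerminal (CostructuredArrow (mapDPlus L) Y) := by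
    intro Y
    obtain ⟨n, hn⟩ := Y.property
    have : Y.IsGE n := (Y.isGE_ι_obj_iff n).1 hn
    obtain ⟨I, hI, ⟨e⟩⟩ := DerivedCategory.Plus.exists_injective_nonempty_iso Y n
    let J : CochainComplex B ℤ := ((InjectiveObject.ι B).mapHomologicalComplex (.up ℤ)).obj I.obj
    have hJ : J.IsStrictlyGE n := inferInstanceAs
      (CochainComplex.IsStrictlyGE (((InjectiveObject.ι B).mapHomologicalComplex _).obj I.obj) n)
    let RJ : CochainComplex A ℤ := (R.mapHomologicalComplex (ComplexShape.up ℤ)).obj J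
    have hRJ : RJ.IsStrictlyGE n := inferInstanceAs
      (CochainComplex.IsStrictlyGE ((R.mapHomologicalComplex _).obj J) n)
    have : J.IsKInjective := inferInstanceAs (CochainComplex.IsKInjective
      (((InjectiveObject.ι B).mapHomologicalComplex (.up ℤ)).obj I.obj))
    have (m : ℤ) : Injective (RJ.X m) := by
      have : Injective (J.X m) := (I.obj.X m).property
      exact adj.map_injective _ this
    have : CochainComplex.IsKInjective ((R.mapHomologicalComplex (ComplexShape.up ℤ)).obj J) :=
      CochainComplex.isKInjective_of_injective RJ n
    let T : DerivedCategory.Plus A := ⟨Q.obj RJ, n, ⟨⟨RJ, Iso.refl _, hRJ⟩⟩⟩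
    let e' : Q.obj J ≅ Y.obj := Plus.ι.mapIso e
    let ε : (mapDPlus L).obj T ⟶ Y := ObjectProperty.homMk
      (L.mapDerivedCategoryFactors.hom.app _ ≫ Q.map ((complexAdj adj).counit.app J) ≫ e'.hom)
    have hb : ∀ X : DerivedCategory.Plus A, Function.Bijective
        (fun f : X ⟶ T => (mapDPlus L).map f ≫ ε) := by
      intro X
      have h₁ := bijective_map_comp_counit adj J X.obj
      constructor
      · intro f f' hff
        apply Plus.ι.map_injective
        apply h₁.1
        dsimp only
        rw [← cancel_mono e'.hom]
        rw [Category.assoc, Category.assoc, Category.assoc, Category.assoc]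
        exact (Plus.ι (C := B)).congr_map hff
      · intro g
        obtain ⟨f, hf⟩ := h₁.2 (g.hom ≫ e'.inv)
        refine ⟨ObjectProperty.homMk f, ?_⟩
        apply Plus.ι.map_injective
        dsimp only at hf
        change L.mapDerivedCategory.map f ≫ L.mapDerivedCategoryFactors.hom.app _ ≫
          Q.map ((complexAdj adj).counit.app J) ≫ e'.hom = g.hom
        rw [← Category.assoc, ← Category.assoc, Category.assoc (L.mapDerivedCategory.map f), hf]
        have : ∀ {Z : DerivedCategory B} (t : Z ⟶ Y.obj), (t ≫ e'.inv) ≫ e'.hom = t := by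
          intro Z t; simp
        exact this g.hom
    refine IsTerminal.hasTerminal (X := CostructuredArrow.mk ε) (IsTerminal.ofUniqueHom
      (fun W => CostructuredArrow.homMk ((hb W.left).2 W.hom).choose
        ((hb W.left).2 W.hom).choose_spec) ?_)
    intro W m
    ext1
    apply (hb W.left).1
    exact (CostructuredArrow.w m).trans ((hb W.left).2 W.hom).choose_spec.symm
  exact isLeftAdjoint_of_costructuredArrowTerminals _

end Abstract

section Sheaves

variable (k : Type u) [Field k]

/-- Sheaves of `k`-modules on a topological space. -/
abbrev Sh (X : TopCat.{u}) := TopCat.Sheaf (ModuleCat.{u} k) X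

instance (X : TopCat.{u}) : Linear k (Sh k X) :=
  inferInstanceAs (Linear k (CategoryTheory.Sheaf (Opens.grothendieckTopology X) (ModuleCat.{u} k)))

instance (X : TopCat.{u}) : HasDerivedCategory (Sh k X) := HasDerivedCategory.standard _

lemma linear_of_leftAdjoint {C D : Type*} [Category* C] [Category* D] [Preadditive C]
    [Preadditive D] [Linear k C] [Linear k D] {F : C ⥤ D} {G : D ⥤ C} (adj : F ⊣ G)
    [G.Additive] [G.Linear k] : F.Linear k where
  map_smul f r := by
    apply (adj.homEquiv _ _).injective
    simp [Adjunction.homEquiv_unit, G.map_smul]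

lemma linear_of_rightAdjoint {C D : Type*} [Category* C] [Category* D] [Preadditive C]
    [Preadditive D] [Linear k C] [Linear k D] {F : C ⥤ D} {G : D ⥤ C} (adj : F ⊣ G)
    [F.Additive] [F.Linear k] : G.Linear k where
  map_smul f r := by
    apply (adj.homEquiv _ _).symm.injective
    simp [Adjunction.homEquiv_counit, F.map_smul]

variable {X Y : TopCat.{u}} (f : X ⟶ Y)

instance : (TopCat.Sheaf.pushforward (ModuleCat.{u} k) f).Additive where
  map_add := rfl
instance : (TopCat.Sheaf.pushforward (ModuleCat.{u} k) f).Linear k where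
  map_smul _ _ := rfl
instance : (TopCat.Sheaf.pullback (ModuleCat.{u} k) f).Additive :=
  (TopCat.Sheaf.pullbackPushforwardAdjunction (ModuleCat.{u} k) f).left_adjoint_additive
instance : (TopCat.Sheaf.pullback (ModuleCat.{u} k) f).Linear k :=
  linear_of_leftAdjoint k (TopCat.Sheaf.pullbackPushforwardAdjunction (ModuleCat.{u} k) f)
instance : PreservesFiniteLimits (TopCat.Sheaf.pullback (ModuleCat.{u} k) f) := by
  have : PreservesFiniteLimits ((Opens.map f).op.lan : _ ⥤ ((Opens X)ᵒᵖ ⥤ ModuleCat.{u} k)) :=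
    lan_preservesFiniteLimits_of_flat _ _
  have h : PreservesFiniteLimits ((Opens.map f).sheafPullback (ModuleCat.{u} k)
      (Opens.grothendieckTopology Y) (Opens.grothendieckTopology X)) :=
    Functor.sheafPullbackConstruction.preservesFiniteLimits _ _ _ _
  exact h

/-- The stalk functor on sheaves of `k`-modules. -/
abbrev stalkF (x : X) : Sh k X ⥤ ModuleCat.{u} k :=
  TopCat.Sheaf.forget _ X ⋙ TopCat.Presheaf.stalkFunctor _ x

open TopCat Presheaf in
lemma isZero_stalk_pushforward (hf : Topology.IsClosedEmbedding f) (F : Sh k X) (y : Y)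
    (hy : y ∉ Set.range f) :
    IsZero ((TopCat.Sheaf.pushforward (ModuleCat.{u} k) f ⋙ stalkF k y).obj F) := by
  let V : Opens Y := ⟨(Set.range f)ᶜ, hf.isClosed_range.isOpen_compl⟩
  let G := (TopCat.Sheaf.pushforward (ModuleCat.{u} k) f).obj F
  have hz : Subsingleton (F.1.obj (op ⊥)) :=
    ModuleCat.subsingleton_of_isZero ((isZero_zero _).of_iso
      (F.isTerminalOfEmpty.uniqueUpToIso (isZero_zero _).isTerminal))
  suffices Subsingleton (G.presheaf.stalk y) from
    ModuleCat.isZero_of_subsingleton (G.presheaf.stalk y)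
  have h0 : ∀ s : G.presheaf.stalk y, s = 0 := by
    intro s
    obtain ⟨U, hU, t, rfl⟩ := G.presheaf.exists_germ_eq s
    have hyW : y ∈ U ⊓ V := ⟨hU, hy⟩
    have hbot : (Opens.map f).obj (U ⊓ V) = ⊥ := by
      ext x
      simp [V]
    have hz' : Subsingleton (G.presheaf.obj (op (U ⊓ V))) := by
      change Subsingleton (F.1.obj (op ((Opens.map f).obj (U ⊓ V))))
      rw [hbot]; exact hz
    rw [← TopCat.Presheaf.germ_res_apply G.presheaf (homOfLE inf_le_left : U ⊓ V ⟶ U) y hyW t,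
      Subsingleton.elim (G.presheaf.map (homOfLE inf_le_left : U ⊓ V ⟶ U).op t) 0, map_zero]
  exact ⟨fun a b => (h0 a).trans (h0 b).symm⟩

open TopCat Presheaf in
/-- The stalk of the direct image under an embedding at a point of the image. -/
def stalkPushforwardIso (hf : Topology.IsInducing f) (x : X) :
    TopCat.Sheaf.pushforward (ModuleCat.{u} k) f ⋙ stalkF k (f x) ≅ stalkF k x :=
  NatIso.ofComponents (fun F =>
      @asIso _ _ _ _ (TopCat.Presheaf.stalkPushforward (ModuleCat.{u} k) f F.1 x)
        (stalkPushforward.stalkPushforward_iso_of_isInducing (ModuleCat.{u} k) hf F.1 x)) (by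
    intro F G φ
    apply TopCat.Presheaf.stalk_hom_ext
    intro U hU
    have h₁ := TopCat.Presheaf.stalkFunctor_map_germ_assoc U (f x) hU
      ((TopCat.Sheaf.pushforward (ModuleCat.{u} k) f).map φ).hom
      (TopCat.Presheaf.stalkPushforward (ModuleCat.{u} k) f G.1 x)
    have h₂ := stalkPushforward_germ_assoc (ModuleCat.{u} k) f F.1 U x hU
      ((stalkFunctor (ModuleCat.{u} k) x).map φ.hom)
    refine h₁.trans (Eq.trans ?_ h₂.symm)
    refine Eq.trans ?_
      (TopCat.Presheaf.stalkFunctor_map_germ ((Opens.map f).obj U) x hU φ.hom).symm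
    exact congrArg (fun t => φ.hom.app (op ((Opens.map f).obj U)) ≫ t)
      (stalkPushforward_germ (ModuleCat.{u} k) f G.1 U x hU))

lemma pushforward_preservesColimits (hf : Topology.IsClosedEmbedding f) :
    PreservesColimits (TopCat.Sheaf.pushforward (ModuleCat.{u} k) f) := by
  have hF : JointlyReflectIsomorphisms (fun y : Y => stalkF k y) :=
    ⟨fun φ h => (TopCat.Presheaf.isIso_iff_stalkFunctor_map_iso φ).2 h⟩
  refine ⟨fun {J} _ => ⟨fun {K} => ⟨fun {c} hc => ⟨hF.jointlyReflectsColimit fun y =>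
    Nonempty.some ?_⟩⟩⟩⟩
  by_cases hy : y ∈ Set.range f
  · obtain ⟨x, rfl⟩ := hy
    have : PreservesColimits (TopCat.Sheaf.pushforward (ModuleCat.{u} k) f ⋙ stalkF k (f x)) :=
      preservesColimits_of_natIso (stalkPushforwardIso k f hf.isInducing x).symm
    exact ⟨isColimitOfPreserves
      (TopCat.Sheaf.pushforward (ModuleCat.{u} k) f ⋙ stalkF k (f x)) hc⟩
  · have hz := fun F => isZero_stalk_pushforward k f hf F y hy
    exact ⟨
      { desc := fun s => (hz _).to_ _
        fac := fun s j => (hz _).eq_of_src _ _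
        uniq := fun s m _ => (hz _).eq_of_src _ _ }⟩

lemma pushforward_isLeftAdjoint (hf : Topology.IsClosedEmbedding f) :
    (TopCat.Sheaf.pushforward (ModuleCat.{u} k) f).IsLeftAdjoint :=
  have := pushforward_preservesColimits k f hf
  isLeftAdjoint_of_preservesColimits_of_isSeparating (isSeparator_separator (Sh k X)) _

/-- The bounded below derived category of sheaves of `k`-modules on `X`. -/
abbrev D (X : TopCat.{u}) := DerivedCategory.Plus (Sh k X)

/-- The inverse image functor `f^*`. -/
abbrev pull : D k Y ⥤ D k X := mapDPlus (TopCat.Sheaf.pullback (ModuleCat.{u} k) f)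

instance : (pull k f).IsLeftAdjoint :=
  isLeftAdjoint_mapDPlus (TopCat.Sheaf.pullbackPushforwardAdjunction (ModuleCat.{u} k) f)

/-- The derived direct image functor `f_*`, the right adjoint of `f^*`. -/
def push : D k X ⥤ D k Y := (pull k f).rightAdjoint

/-- The adjunction `f^* ⊣ f_*`. -/
def pullPushAdj : pull k f ⊣ push k f := Adjunction.ofIsLeftAdjoint _

instance : (push k f).CommShift ℤ := (pullPushAdj k f).rightAdjointCommShift ℤ
instance : (push k f).Additive := (pullPushAdj k f).right_adjoint_additive
instance : (push k f).Linear k := linear_of_rightAdjoint k (pullPushAdj k f)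

lemma push_isLeftAdjoint (hf : Topology.IsClosedEmbedding f) : (push k f).IsLeftAdjoint := by
  have := pushforward_preservesColimits k f hf
  have := pushforward_isLeftAdjoint k f hf
  have := (Adjunction.ofIsLeftAdjoint
    (TopCat.Sheaf.pushforward (ModuleCat.{u} k) f)).right_adjoint_additive
  have : (mapDPlus (TopCat.Sheaf.pushforward (ModuleCat.{u} k) f)).IsLeftAdjoint :=
    isLeftAdjoint_mapDPlus (Adjunction.ofIsLeftAdjoint _)
  exact Functor.isLeftAdjoint_of_iso (((mapDPlusAdj
    (TopCat.Sheaf.pullbackPushforwardAdjunction (ModuleCat.{u} k) f)).rightAdjointUniq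
      (pullPushAdj k f)))

variable {f}
/-- The exceptional inverse image `i^!` of a closed embedding, the right adjoint of `i_*`. -/
def shriek (hf : Topology.IsClosedEmbedding f) : D k Y ⥤ D k X :=
  have := push_isLeftAdjoint k f hf
  (push k f).rightAdjoint

/-- The adjunction `i_* ⊣ i^!`. -/
def pushShriekAdj (hf : Topology.IsClosedEmbedding f) : push k f ⊣ shriek k hf :=
  have := push_isLeftAdjoint k f hf
  Adjunction.ofIsLeftAdjoint _


/-- The constant sheaf with value `M`. -/
abbrev constSh (X : TopCat.{u}) (M : ModuleCat.{u} k) : Sh k X :=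
  (constantSheaf (Opens.grothendieckTopology X) (ModuleCat.{u} k)).obj M

/-- The canonical isomorphism `f^* M_Y ≅ M_X` of constant sheaves. -/
def pullbackConstIso (f : X ⟶ Y) (M : ModuleCat.{u} k) :
    (TopCat.Sheaf.pullback (ModuleCat.{u} k) f).obj (constSh k Y M) ≅ constSh k X M :=
  (Adjunction.leftAdjointUniq
    (((constantSheafAdj (Opens.grothendieckTopology Y) (ModuleCat.{u} k)
      (isTerminalTop : IsTerminal (⊤ : Opens Y))).comp
        (TopCat.Sheaf.pullbackPushforwardAdjunction (ModuleCat.{u} k) f)))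
    (constantSheafAdj (Opens.grothendieckTopology X) (ModuleCat.{u} k)
      (isTerminalTop : IsTerminal (⊤ : Opens X)))).app M

/-- The unit object `k_X` of `D(X)`: the constant sheaf with value `k` in degree `0`. -/
def one (X : TopCat.{u}) : D k X :=
  (DerivedCategory.Plus.singleFunctor (Sh k X) 0).obj (constSh k X (ModuleCat.of k k))

/-- The canonical isomorphism `f^* k_Y ≅ k_X`. -/
def pullOneIso (f : X ⟶ Y) : (pull k f).obj (one k Y) ≅ one k X :=
  DerivedCategory.Plus.ι.preimageIso
    (((TopCat.Sheaf.pullback (ModuleCat.{u} k) f).mapDerivedCategorySingleFunctor 0).app _ ≪≫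
      (DerivedCategory.singleFunctor (Sh k X) 0).mapIso (pullbackConstIso k f _))

/-- The inclusion of a subset, with the subspace topology. -/
def incl {X : TopCat.{u}} (S : Set X) : TopCat.of S ⟶ X :=
  TopCat.ofHom ⟨Subtype.val, continuous_subtype_val⟩

lemma incl_isClosedEmbedding {X : TopCat.{u}} {S : Set X} (hS : IsClosed S) :
    Topology.IsClosedEmbedding (incl S) :=
  hS.isClosedEmbedding_subtypeVal

/-- Constructible sheaves on a space of dimension at most one (a disjoint union of points and
topological curves): the stalks are finite-dimensional, and the sheaf is locally constant away
from a closed discrete set of points. -/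
def IsConstructible (F : Sh k X) : Prop :=
  (∀ x : X, Module.Finite k ((stalkF k x).obj F)) ∧
  ∃ S : Set X, IsClosed S ∧ DiscreteTopology S ∧
    ∀ x ∉ S, ∃ V : Set X, IsOpen V ∧ x ∈ V ∧ ∃ M : ModuleCat.{u} k,
      Nonempty ((TopCat.Sheaf.pullback (ModuleCat.{u} k) (incl V)).obj F ≅
        constSh k (TopCat.of V) M)

/-- The objects of the full subcategory `D^b_c(X; k)`: complexes with bounded and constructible
cohomology sheaves. Morphisms of `D^b_c(X; k)` are morphisms of `D k X`. -/
def IsDbc : ObjectProperty (D k X) := fun K =>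
  (∃ n : ℤ, K.IsLE n) ∧
    ∀ n : ℤ, IsConstructible k ((DerivedCategory.Plus.homologyFunctor (Sh k X) n).obj K)

/-- `H^d(X; A) = Hom(k_X, A[d])`. -/
abbrev H (A : D k X) (d : ℤ) := one k X ⟶ A⟦d⟧

/-- The pull-back `H^d(Y; A) → H^d(X; f^* A)`. -/
def pullH (f : X ⟶ Y) (A : D k Y) (d : ℤ) : H k A d →ₗ[k] H k ((pull k f).obj A) d where
  toFun c := (pullOneIso k f).inv ≫ (pull k f).map c ≫ ((pull k f).commShiftIso d).hom.app A
  map_add' := by simp [Functor.map_add]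
  map_smul' := by simp [Functor.map_smul]

section Support

variable {Z : Set X} (hZ : IsClosed Z)

/-- The object `i_* i^! A` for the inclusion `i` of a closed subset `Z`. -/
abbrev supp (A : D k X) : D k X :=
  (push k (incl Z)).obj ((shriek k (incl_isClosedEmbedding hZ)).obj A)

/-- Cohomology with supports `H_Z^d(X; A) = Hom(k_X, i_* i^! A[d])`. -/
abbrev HZ (A : D k X) (d : ℤ) := one k X ⟶ (supp k hZ A)⟦d⟧

/-- The counit `i_* i^! A → A`. -/
abbrev suppCounit (A : D k X) : supp k hZ A ⟶ A :=
  (pushShriekAdj k (incl_isClosedEmbedding hZ)).counit.app A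

/-- The object `j_* j^* A` for the inclusion `j` of the complement of `Z`. -/
abbrev restr (Z : Set X) (A : D k X) : D k X :=
  (push k (incl Zᶜ)).obj ((pull k (incl Zᶜ)).obj A)

/-- The unit `A → j_* j^* A`. -/
abbrev restrUnit (Z : Set X) (A : D k X) : A ⟶ restr k Z A :=
  (pullPushAdj k (incl Zᶜ)).unit.app A

/-- The map `forg : H_Z^d(X; A) → H^d(X; A)` induced by the counit. -/
def forg (A : D k X) (d : ℤ) : HZ k hZ A d →ₗ[k] H k A d where
  toFun c := c ≫ (suppCounit k hZ A)⟦d⟧'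
  map_add' := by simp
  map_smul' := by simp

/-- `h` completes the counit and the unit to the localization triangle
`i_* i^! A → A → j_* j^* A → i_* i^! A[1]`. -/
def IsLocTriangle (A : D k X) (h : restr k Z A ⟶ (supp k hZ A)⟦(1 : ℤ)⟧) : Prop :=
  Pretriangulated.Triangle.mk (suppCounit k hZ A) (restrUnit k Z A) h ∈
    Pretriangulated.distinguishedTriangles

/-- The connecting map `δ : H^d(U; j^* A) → H_Z^{d+1}(X; A)` of the localization triangle with
third morphism `h`, where `H^d(U; j^* A)` is identified with `Hom(k_X, j_* j^* A[d])` by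
adjunction. -/
def conn {A : D k X} (h : restr k Z A ⟶ (supp k hZ A)⟦(1 : ℤ)⟧) (d e : ℤ) (hde : 1 + d = e) :
    H k ((pull k (incl Zᶜ)).obj A) d →ₗ[k] HZ k hZ A e where
  toFun b := (pullPushAdj k (incl Zᶜ)).homEquiv _ _ ((pullOneIso k (incl Zᶜ)).hom ≫ b) ≫
    ((push k (incl Zᶜ)).commShiftIso d).hom.app _ ≫ h⟦d⟧' ≫
      (shiftFunctorAdd' (D k X) 1 d e hde).inv.app _
  map_add' := by simp [Adjunction.homEquiv_unit, Functor.map_add]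
  map_smul' := by simp [Adjunction.homEquiv_unit, Functor.map_smul]

/-- The adjunction isomorphism `H_Z^d(X; A) ≅ Hom(k_Z, i^! A[d])`. -/
def adjZ (A : D k X) (d : ℤ) :
    HZ k hZ A d ≃ₗ[k] (one k (TopCat.of Z) ⟶
      ((shriek k (incl_isClosedEmbedding hZ)).obj A)⟦d⟧) where
  toFun c := (pullOneIso k (incl Z)).inv ≫ ((pullPushAdj k (incl Z)).homEquiv _ _).symm
    (c ≫ ((push k (incl Z)).commShiftIso d).inv.app _)
  invFun a := (pullPushAdj k (incl Z)).homEquiv _ _ ((pullOneIso k (incl Z)).hom ≫ a) ≫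
    ((push k (incl Z)).commShiftIso d).hom.app _
  map_add' := by simp [Adjunction.homEquiv_counit, Functor.map_add]
  map_smul' := by simp [Adjunction.homEquiv_counit, Functor.map_smul]
  left_inv c := by simp
  right_inv a := by simp

/-- The set `Lift_Z^d(c)` of supported refinements of `c`. -/
def Lift {A : D k X} {d : ℤ} (c : H k A d) : Set (HZ k hZ A d) :=
  {c' | forg k hZ A d c' = c}

/-- The localization torsor `Loc_Z^tor(c)`: the adjoints of the supported refinements of `c`. -/
def LocTor {A : D k X} {d : ℤ} (c : H k A d) :
    Set (one k (TopCat.of Z) ⟶ ((shriek k (incl_isClosedEmbedding hZ)).obj A)⟦d⟧) :=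
  adjZ k hZ A d '' Lift k hZ c

end Support

/-- `S` is a (nonempty) torsor under the subspace `G`, acting by translations. -/
def IsTorsorUnder {M : Type*} [AddCommGroup M] [Module k M] (S : Set M) (G : Submodule k M) :
    Prop :=
  S.Nonempty ∧ (∀ g ∈ G, ∀ s ∈ S, s + g ∈ S) ∧ ∀ s ∈ S, ∀ t ∈ S, ∃! g, g ∈ G ∧ t = s + g

/-- Global sections of the constant sheaf `k_X`. -/
abbrev ΓConst (X : TopCat.{u}) : ModuleCat.{u} k :=
  (constSh k X (ModuleCat.of k k)).presheaf.obj (op ⊤)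

/-- The adjunction between the constant sheaf functor and global sections. -/
abbrev constAdj (X : TopCat.{u}) := constantSheafAdj (Opens.grothendieckTopology X)
  (ModuleCat.{u} k) (isTerminalTop : IsTerminal (⊤ : Opens X))

/-- The constant section `1` of `k_X`. -/
def oneSec (X : TopCat.{u}) : ΓConst k X :=
  ((constAdj k X).unit.app (ModuleCat.of k k)).hom (1 : k)

/-- Restriction of a global section of `k_X` to an open subset. -/
abbrev resSec {X : TopCat.{u}} (V : Opens X) (s : ΓConst k X) :
    (constSh k X (ModuleCat.of k k)).presheaf.obj (op V) :=
  ((constSh k X (ModuleCat.of k k)).presheaf.map (homOfLE le_top : V ⟶ ⊤).op).hom s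

/-- `s` is the section of `k_X` equal to `1` on `V` and to `0` on every open set disjoint
from `V`. -/
def IsIndicator {X : TopCat.{u}} (V : Opens X) (s : ΓConst k X) : Prop :=
  resSec k V s = resSec k V (oneSec k X) ∧ ∀ W : Opens X, Disjoint V W → resSec k W s = 0

/-- The endomorphism of `k_X` given by a global section of `k_X`. -/
def secHom (X : TopCat.{u}) (s : ΓConst k X) :
    constSh k X (ModuleCat.of k k) ⟶ constSh k X (ModuleCat.of k k) :=
  ((constAdj k X).homEquiv _ _).symm (ModuleCat.ofHom (LinearMap.toSpanSingleton k _ s))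

/-- The class in `H^0(X; f^* k_Y) ≅ H^0(X; k_X)` of a global section of `k_X`. -/
def secClass (f : X ⟶ Y) (s : ΓConst k X) : H k ((pull k f).obj (one k Y)) 0 :=
  (DerivedCategory.Plus.singleFunctor (Sh k X) 0).map (secHom k X s) ≫ (pullOneIso k f).inv ≫
    (shiftFunctorZero (D k X) ℤ).inv.app _

end Sheaves

/-- `U₁` and `U₂` are the connected components of `Y`, which has exactly two of them. -/
structure IsTwoComponents {Y : TopCat.{u}} (U₁ U₂ : Opens Y) : Prop where
  connected₁ : IsConnected (U₁ : Set Y)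
  connected₂ : IsConnected (U₂ : Set Y)
  disjoint : Disjoint U₁ U₂
  sup_eq_top : U₁ ⊔ U₂ = ⊤

/-- The circle. -/
abbrev S1 : TopCat.{u} := TopCat.of (ULift.{u} Circle)

lemma isClosed_pair (p q : S1.{u}) : IsClosed ({p, q} : Set S1.{u}) :=
  (Set.toFinite _).isClosed

end SheafLoc

end

open SheafLoc

/-! Applying Hom(k_X, -) to the localization triangle gives the exact sequence H⁰(X) → H⁰(U) →
H¹_Z(X) → H¹(X) → H¹(U), whose second arrow is δ and whose third is forg. The complement U is a
union of two open arcs, so H¹(U) = 0. Hence every class restricts to zero on U and forg is onto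
(`forg_surjective`), and its fibres are the cosets of ker forg = im δ (`range_conn`). The two
indicators form a basis of H⁰(U), and H⁰(X) = k enters diagonally because the circle is connected
(`conn_combination_eq_zero_iff`). So im δ = (k ⊕ k)/Δ is a line spanned by δ(1_{U₁}), and δ(1_{U₂})
= -δ(1_{U₁}); the difference of the indicators therefore maps to 2δ(1_{U₁}), a generator exactly
when 2 ≠ 0. The adjunction is a linear isomorphism and carries the torsor to Hom(k_Z, i^! k_X[1]).

Cohomology is computed from one resolution: k_Y inside the sheaf of all functions, with quotient the
functions modulo locally constant ones. Over a field flabby sheaves are injective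
(`IsFlabby.injective`), so H¹ is the space of global sections of the quotient modulo those that lift
to functions. On a space with a chart to the line all sections lift (`toQuot_surjective_of_basis`),
which gives H¹(U) = 0; on the circle two charts give H¹ = k by a Mayer–Vietoris argument
(`nonempty_H_one_S1_equiv`).

For the triangle, derived right adjoints are computed termwise on injectives
(`exists_rightAdjoint_iso`). This gives full faithfulness of i_* and j_* and the vanishing of j^*
i_*, and a recollement argument yields existence and uniqueness (`existsUnique_isLocTriangle`).
Constructibility is checked on j_* k_U, which is a single sheaf because its resolution stays exact
under j_*. It passes to i_* i^! k_X through the triangle, and to i^! k_X through i^* i_* ≅ id. -/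

noncomputable section

namespace SheafLoc

/-! ### Sheaves handled through their sections -/

section Sections

variable {k : Type u} [Field k] {Y : TopCat.{u}}

/-- The module of sections of a sheaf over an open subset. -/
abbrev Sec (F : Sh k Y) (V : Opens Y) : Type u := F.obj.obj (op V)

/-- Restriction of sections. -/
def res (F : Sh k Y) {V W : Opens Y} (h : W ≤ V) : Sec F V →ₗ[k] Sec F W :=
  (F.obj.map (homOfLE h).op).hom

/-- The map on sections induced by a morphism of sheaves. -/
def onSec {F G : Sh k Y} (φ : F ⟶ G) (V : Opens Y) : Sec F V →ₗ[k] Sec G V :=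
  (φ.hom.app (op V)).hom

@[simp]
lemma res_res (F : Sh k Y) {V W T : Opens Y} (h : W ≤ V) (h' : T ≤ W) (s : Sec F V) :
    res F h' (res F h s) = res F (h'.trans h) s := by
  change (F.obj.map (homOfLE h).op ≫ F.obj.map (homOfLE h').op).hom s = _
  rw [← F.obj.map_comp]
  rfl

@[simp]
lemma res_self (F : Sh k Y) {V : Opens Y} (h : V ≤ V) (s : Sec F V) : res F h s = s := by
  change (F.obj.map (𝟙 (op V))).hom s = _
  rw [F.obj.map_id]
  rfl

lemma onSec_res {F G : Sh k Y} (φ : F ⟶ G) {V W : Opens Y} (h : W ≤ V) (s : Sec F V) :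
    onSec φ W (res F h s) = res G h (onSec φ V s) :=
  congrArg (fun t => t.hom s) (φ.hom.naturality (homOfLE h).op)

lemma onSec_comp {F G H : Sh k Y} (φ : F ⟶ G) (ψ : G ⟶ H) (V : Opens Y) (s : Sec F V) :
    onSec (φ ≫ ψ) V s = onSec ψ V (onSec φ V s) := rfl

lemma sheaf_hom_ext {F G : Sh k Y} {φ ψ : F ⟶ G} (h : ∀ V s, onSec φ V s = onSec ψ V s) :
    φ = ψ := by
  apply CategoryTheory.Sheaf.hom_ext
  ext V s
  exact h V.unop s

lemma sec_ext (F : Sh k Y) {V : Opens Y} {s t : Sec F V}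
    (h : ∀ x ∈ V, ∃ W, ∃ hW : W ≤ V, x ∈ W ∧ res F hW s = res F hW t) : s = t := by
  choose W hW hx hs using h
  refine TopCat.Sheaf.eq_of_locally_eq' F (fun x : V => W x.1 x.2) V
    (fun x => homOfLE (hW x.1 x.2)) (fun x hx' => ?_) s t fun x => hs x.1 x.2
  simp only [Opens.mem_iSup]
  exact ⟨⟨x, hx'⟩, hx x hx'⟩

lemma exists_glue (F : Sh k Y) {ι : Type*} (U : ι → Opens Y) (V : Opens Y) (hU : ∀ i, U i ≤ V)
    (hV : V ≤ iSup U) (s : ∀ i, Sec F (U i))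
    (hs : ∀ i j, res F (inf_le_left : U i ⊓ U j ≤ U i) (s i) = res F inf_le_right (s j)) :
    ∃ t : Sec F V, ∀ i, res F (hU i) t = s i := by
  obtain ⟨t, ht, _⟩ := TopCat.Sheaf.existsUnique_gluing' F U V (fun i => homOfLE (hU i)) hV s hs
  exact ⟨t, ht⟩

lemma exists_hom_of_sec (F G : Sh k Y) (f : ∀ V, Sec F V →ₗ[k] Sec G V)
    (hf : ∀ {V W : Opens Y} (h : W ≤ V) (s : Sec F V), f W (res F h s) = res G h (f V s)) :
    ∃ φ : F ⟶ G, ∀ V s, onSec φ V s = f V s := by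
  refine ⟨⟨{ app := fun V => ModuleCat.ofHom (f V.unop), naturality := ?_ }⟩, fun V s => rfl⟩
  intro V W h
  ext s
  exact hf h.unop.le s

/-- The functor of sections over an open subset. -/
abbrev secFunctor (k : Type u) [Field k] (V : Opens Y) :
    Sheaf (Opens.grothendieckTopology Y) (ModuleCat.{u} k) ⥤ ModuleCat.{u} k :=
  sheafToPresheaf _ _ ⋙ (evaluation _ _).obj (op V)

lemma onSec_injective {F G : Sh k Y} (φ : F ⟶ G) [Mono φ] (V : Opens Y) :
    Function.Injective (onSec φ V) := by
  have : Mono ((secFunctor k V).map φ) := by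
    have h : Mono φ := inferInstance
    exact @Functor.map_mono _ _ _ _ (secFunctor k V) _ _ _ φ h
  exact (ModuleCat.mono_iff_injective _).1 this

lemma mono_of_onSec_injective {F G : Sh k Y} (φ : F ⟶ G)
    (h : ∀ V, Function.Injective (onSec φ V)) : Mono φ := by
  refine ⟨fun {K} a b hab => sheaf_hom_ext fun V s => h V ?_⟩
  rw [← onSec_comp, ← onSec_comp, hab]

lemma exists_local_lift {F G : Sh k Y} (φ : F ⟶ G) [Epi φ] {V : Opens Y} (s : Sec G V) {x : Y}
    (hx : x ∈ V) : ∃ W, ∃ hW : W ≤ V, x ∈ W ∧ ∃ t, onSec φ W t = res G hW s := by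
  obtain ⟨W, hW, ⟨t, ht⟩, hx'⟩ := (TopCat.Presheaf.isLocallySurjective_iff _).1
    ((TopCat.Sheaf.isLocallySurjective_iff_epi φ).2 inferInstance) V s x hx
  exact ⟨W, hW, hx', t, ht⟩

/-- Taking sections over an open set is left exact. -/
lemma exists_lift_of_exact {S : ShortComplex (Sh k Y)} (hS : S.Exact) (hf : Mono S.f) {V : Opens Y}
    (s : Sec S.X₂ V) (hs : onSec S.g V s = 0) : ∃ t, onSec S.f V t = s := by
  have := ((Functor.preservesFiniteLimits_tfae (secFunctor k V)).out 1 3 rfl rfl).mpr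
    inferInstance S ⟨hS, hf⟩
  exact (ShortComplex.moduleCat_exact_iff _).1 this.1 s hs

lemma epi_of_local_lift {F G : Sh k Y} (φ : F ⟶ G)
    (h : ∀ V (s : Sec G V), ∀ x ∈ V, ∃ W, ∃ hW : W ≤ V, x ∈ W ∧ ∃ t, onSec φ W t = res G hW s) :
    Epi φ := by
  refine (TopCat.Sheaf.isLocallySurjective_iff_epi φ).1
    ((TopCat.Presheaf.isLocallySurjective_iff _).2 fun V s x hx => ?_)
  obtain ⟨W, hW, hx', t, ht⟩ := h V s x hx
  exact ⟨W, hW, ⟨t, ht⟩, hx'⟩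

end Sections

/-! ### The sheaf of all functions and the constant sheaf inside it -/

section Functions

variable (k : Type u) [Field k] (Y : TopCat.{u})

/-- The sheaf of all `k`-valued functions. -/
def fnSh : Sh k Y :=
  ⟨{ obj := fun V => ModuleCat.of k (V.unop → k)
     map := fun {V W} h => ModuleCat.ofHom
       (LinearMap.funLeft k k (fun x : W.unop => (⟨x.1, h.unop.le x.2⟩ : V.unop))) }, by
    refine (TopCat.Presheaf.isSheaf_iff_isSheaf_comp (forget (ModuleCat.{u} k)) _).2 ?_
    exact TopCat.Presheaf.toTypes_isSheaf Y fun _ => k⟩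

variable {k Y}

variable (k Y)

/-- The inclusion of the constant sheaf in the sheaf of functions. -/
def constToFn : constSh k Y (ModuleCat.of k k) ⟶ fnSh k Y :=
  ((constAdj k Y).homEquiv _ _).symm (ModuleCat.ofHom
    (LinearMap.pi fun _ => LinearMap.id : k →ₗ[k] ((⊤ : Opens Y) → k)))

lemma onSec_constToFn_oneSec : onSec (constToFn k Y) ⊤ (oneSec k Y) = (1 : (⊤ : Opens Y) → k) := by
  have := (constAdj k Y).homEquiv_unit (f := constToFn k Y)
  have h2 := ((constAdj k Y).homEquiv _ (fnSh k Y)).apply_symm_apply (ModuleCat.ofHom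
    (LinearMap.pi fun _ => LinearMap.id : k →ₗ[k] ((⊤ : Opens Y) → k)))
  replace this := h2.symm.trans this
  exact (congrArg (fun t => t.hom (1 : k)) this).symm

/-- The constant sheaf is the sheafification of the constant presheaf, and the map to a
sheafification is locally surjective. -/
lemma exists_local_const {V : Opens Y} (s : Sec (constSh k Y (ModuleCat.of k k)) V) {x : Y}
    (hx : x ∈ V) : ∃ W, ∃ hW : W ≤ V, x ∈ W ∧ ∃ c : k, res _ hW s = c • res _ le_top (oneSec k Y) := by
  let P : (Opens Y)ᵒᵖ ⥤ ModuleCat.{u} k := (Functor.const _).obj (ModuleCat.of k k)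
  have hloc : Presheaf.IsLocallySurjective (Opens.grothendieckTopology Y)
    (CategoryTheory.toSheafify (Opens.grothendieckTopology Y) P) := inferInstance
  obtain ⟨W, hW, ⟨t, ht⟩, hx'⟩ := (TopCat.Presheaf.isLocallySurjective_iff _).1 hloc V s x hx
  refine ⟨W, hW, hx', t, ht.symm.trans ?_⟩
  have h1 : oneSec k Y = ((CategoryTheory.toSheafify (Opens.grothendieckTopology Y) P).app (op ⊤)).hom (1 : k) := by
    simp [oneSec, constAdj, constantSheafAdj, constantPresheafAdj, Adjunction.comp_unit_app]
    rfl
  rw [h1]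
  have h2 := congrArg (fun f => f.hom (1 : k))
    ((CategoryTheory.toSheafify (Opens.grothendieckTopology Y) P).naturality (homOfLE (le_top : W ≤ ⊤)).op)
  refine Eq.trans ?_ (congrArg (fun z => t • z) h2)
  refine Eq.trans ?_ (((CategoryTheory.toSheafify (Opens.grothendieckTopology Y) P).app (op W)).hom.map_smul t (1 : k))
  congr 1
  exact (mul_one (M := k) t).symm

end Functions

/-! ### Locally constant functions on open subsets -/

section LocallyConstant

variable (k : Type*) {Y : TopCat.{u}}

lemma isLocallyConstant_of_local {V : Opens Y} {f : V → k}
    (h : ∀ x (_ : x ∈ V), ∃ W, ∃ hW : W ≤ V, x ∈ W ∧ ∃ c : k, ∀ y (hy : y ∈ W), f ⟨y, hW hy⟩ = c) :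
    IsLocallyConstant f := by
  rw [IsLocallyConstant.iff_exists_open]
  intro x
  obtain ⟨W, hW, hx, c, hc⟩ := h x.1 x.2
  exact ⟨Subtype.val ⁻¹' W, W.isOpen.preimage continuous_subtype_val, hx,
    fun y hy => (hc y.1 hy).trans (hc x.1 hx).symm⟩

lemma exists_const_of_isLocallyConstant {V : Opens Y} {f : V → k} (h : IsLocallyConstant f)
    {x : Y} (hx : x ∈ V) :
    ∃ W, ∃ hW : W ≤ V, x ∈ W ∧ ∀ y (hy : y ∈ W), f ⟨y, hW hy⟩ = f ⟨x, hx⟩ := by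
  obtain ⟨U, hU, hxU, hf⟩ := (IsLocallyConstant.iff_exists_open f).1 h ⟨x, hx⟩
  refine ⟨⟨Subtype.val '' U, V.isOpen.isOpenMap_subtype_val _ hU⟩, ?_, ⟨_, hxU, rfl⟩, ?_⟩
  · rintro _ ⟨y, _, rfl⟩
    exact y.2
  · rintro _ ⟨y, hy, rfl⟩
    exact hf y hy

lemma eq_of_isPreconnected {V : Opens Y} {f : V → k} (h : IsLocallyConstant f) {T : Set Y}
    (hT : IsPreconnected T) (hTV : ∀ x ∈ T, x ∈ V) {x y : Y} (hx : x ∈ T) (hy : y ∈ T) :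
    f ⟨x, hTV x hx⟩ = f ⟨y, hTV y hy⟩ := by
  have : IsPreconnected (Subtype.val ⁻¹' T : Set V) :=
    Topology.IsInducing.subtypeVal.isPreconnected_image.1 (by
      have : (Subtype.val '' (Subtype.val ⁻¹' T : Set V) : Set Y) = T := by
        ext x
        exact ⟨fun ⟨y, hy, h⟩ => h ▸ hy, fun hx => ⟨⟨x, hTV x hx⟩, hx, rfl⟩⟩
      exact (congrArg _root_.IsPreconnected this).mpr hT)
  exact h.apply_eq_of_isPreconnected this hx hy

end LocallyConstant

/-! ### Functions modulo locally constant functions -/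

section Functions

variable (k : Type u) [Field k] (Y : TopCat.{u})

/-- The restriction of the constant section `1` to an open subset. -/
abbrev unitSec (V : Opens Y) : Sec (constSh k Y (ModuleCat.of k k)) V :=
  res _ le_top (oneSec k Y)

variable {Y}

lemma onSec_constToFn_unitSec (V : Opens Y) (c : k) :
    onSec (constToFn k Y) V (c • unitSec k Y V) = fun _ => c := by
  rw [map_smul, unitSec, onSec_res, onSec_constToFn_oneSec]
  funext x
  exact mul_one c

/-- Near each point a section is c times the unit section, whose function has constant value c;
evaluating at the point recovers c. -/
lemma onSec_constToFn_injective (V : Opens Y) : Function.Injective (onSec (constToFn k Y) V) := by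
  rw [injective_iff_map_eq_zero]
  intro s hs
  refine sec_ext _ fun x hx => ?_
  obtain ⟨W, hW, hx', c, hc⟩ := exists_local_const k Y s hx
  refine ⟨W, hW, hx', ?_⟩
  have h1 := onSec_constToFn_unitSec k W c
  rw [← hc, onSec_res, hs, map_zero] at h1
  have : c = 0 := (congrFun h1 ⟨x, hx'⟩).symm
  rw [hc, this, zero_smul, map_zero]

instance : Mono (constToFn k Y) := mono_of_onSec_injective _ (onSec_constToFn_injective k)

lemma exists_onSec_constToFn_eq_iff {V : Opens Y} (f : V → k) :
    (∃ s, onSec (constToFn k Y) V s = f) ↔ IsLocallyConstant f := by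
  constructor
  · rintro ⟨s, rfl⟩
    refine isLocallyConstant_of_local k fun x hx => ?_
    obtain ⟨W, hW, hx', c, hc⟩ := exists_local_const k Y s hx
    refine ⟨W, hW, hx', c, fun y hy => ?_⟩
    have h1 := onSec_constToFn_unitSec k W c
    rw [← hc, onSec_res] at h1
    exact congrFun h1 ⟨y, hy⟩
  · intro h
    choose W hW hx hc using fun x : V => exists_const_of_isLocallyConstant k h x.2
    -- Gluing the local multiples of the unit section requires agreement on overlaps; by injectivity
    -- this may be checked on the associated functions, which are all restrictions of f.
    have key : ∀ (T : Opens Y) (x : V) (hT : T ≤ W x), onSec (constToFn k Y) T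
        (res _ hT (f x • unitSec k Y (W x))) = fun y : T => f ⟨y.1, hW x (hT y.2)⟩ := by
      intro T x hT
      rw [onSec_res, onSec_constToFn_unitSec]
      funext y
      exact (hc x y.1 (hT y.2)).symm
    obtain ⟨s, hs⟩ := exists_glue _ W V hW
      (fun x hx' => Opens.mem_iSup.2 ⟨⟨x, hx'⟩, hx ⟨x, hx'⟩⟩) (fun x => f x • unitSec k Y (W x))
      (fun x y => onSec_constToFn_injective k _ ((key _ x _).trans (key _ y _).symm))
    refine ⟨s, ?_⟩
    refine sec_ext (fnSh k Y) fun x hx' => ⟨W ⟨x, hx'⟩, hW _, hx _, ?_⟩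
    rw [← onSec_res, hs]
    have := key _ ⟨x, hx'⟩ le_rfl
    rwa [res_self] at this

variable (Y)

/-- The sheaf of functions modulo locally constant functions. -/
def quotSh : Sh k Y := cokernel (constToFn k Y)

/-- The projection to the sheaf of functions modulo locally constant functions. -/
def toQuot : fnSh k Y ⟶ quotSh k Y := cokernel.π (constToFn k Y)

instance : Epi (toQuot k Y) := inferInstanceAs (Epi (cokernel.π (constToFn k Y)))

/-- The resolution of the constant sheaf by the sheaf of functions and its quotient. -/
abbrev fnSeq : ShortComplex (Sh k Y) :=
  ShortComplex.mk (constToFn k Y) (toQuot k Y) (cokernel.condition _)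

lemma fnSeq_shortExact : (fnSeq k Y).ShortExact where
  exact := ShortComplex.exact_of_g_is_cokernel _ (cokernelIsCokernel _)
  mono_f := inferInstanceAs (Mono (constToFn k Y))
  epi_g := inferInstanceAs (Epi (toQuot k Y))

variable {Y}

/-- Left exactness of sections suffices here: the kernel over V consists of the sections of the
constant sheaf, that is, of the locally constant functions. -/
lemma onSec_toQuot_eq_zero_iff {V : Opens Y} (f : V → k) :
    onSec (toQuot k Y) V f = 0 ↔ IsLocallyConstant f := by
  rw [← exists_onSec_constToFn_eq_iff]
  constructor
  · intro h
    exact exists_lift_of_exact (fnSeq_shortExact k Y).exact (fnSeq_shortExact k Y).mono_f f h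
  · rintro ⟨s, rfl⟩
    rw [← onSec_comp]
    exact congrArg (fun φ => onSec φ V s) (cokernel.condition (constToFn k Y))

lemma onSec_toQuot_eq_iff {V : Opens Y} (f g : V → k) :
    onSec (toQuot k Y) V f = onSec (toQuot k Y) V g ↔ IsLocallyConstant (f - g) := by
  rw [← onSec_toQuot_eq_zero_iff, ← sub_eq_zero]
  exact Eq.congr_left (map_sub (onSec (toQuot k Y) V) f g).symm

lemma res_toQuot {V W : Opens Y} (h : W ≤ V) (f : V → k) :
    res (quotSh k Y) h (onSec (toQuot k Y) V f) =
      onSec (toQuot k Y) W (fun x : W => f ⟨x.1, h x.2⟩) :=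
  (onSec_res (toQuot k Y) h f).symm

/-- Sections of the quotient sheaf lift to functions over an open set with a suitable basis of
connected open sets. -/
lemma toQuot_surjective_of_basis {V : Opens Y} (B : Set (Opens Y))
    (hB : ∀ x ∈ V, ∀ W : Opens Y, x ∈ W → ∃ T ∈ B, x ∈ T ∧ T ≤ W)
    (hinter : ∀ S ∈ B, ∀ T ∈ B, IsPreconnected ((S : Set Y) ∩ T))
    (hunion : ∀ S ∈ B, ∀ T ∈ B, ((S : Set Y) ∩ T).Nonempty → S ⊔ T ∈ B) :
    Function.Surjective (onSec (toQuot k Y) V) := by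
  intro s
  -- Two points are related when a single basic set on which s lifts contains both. Local lifts are
  -- then normalised to vanish at a chosen representative of each class, which removes the ambiguity
  -- by a constant.
  let r : V → V → Prop := fun x y => ∃ T ∈ B, ∃ hT : T ≤ V, x.1 ∈ T ∧ y.1 ∈ T ∧
    ∃ f : T → k, onSec (toQuot k Y) T f = res _ hT s
  have hr1 : ∀ x, r x x := by
    intro x
    obtain ⟨W, hW, hx, f, hf⟩ := exists_local_lift (toQuot k Y) s x.2
    obtain ⟨T, hT, hxT, hTW⟩ := hB x.1 x.2 W hx
    refine ⟨T, hT, hTW.trans hW, hxT, hxT, fun y => f ⟨y.1, hTW y.2⟩, ?_⟩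
    rw [← res_toQuot k hTW f, ← res_res _ hW hTW, ← hf]
  have hr2 : ∀ {x y}, r x y → r y x := by
    rintro x y ⟨T, hT, hTV, hx, hy, h⟩
    exact ⟨T, hT, hTV, hy, hx, h⟩
  have hr3 : ∀ {x y z}, r x y → r y z → r x z := by
    rintro x y z ⟨S, hS, hSV, hxS, hyS, f, hf⟩ ⟨T, hT, hTV, hyT, hzT, g, hg⟩
    have hlc : IsLocallyConstant (fun w : (S ⊓ T : Opens Y) =>
        f ⟨w.1, w.2.1⟩ - g ⟨w.1, w.2.2⟩) := by
      refine (onSec_toQuot_eq_iff k (fun w : (S ⊓ T : Opens Y) => f ⟨w.1, w.2.1⟩)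
        (fun w : (S ⊓ T : Opens Y) => g ⟨w.1, w.2.2⟩)).1 ?_
      rw [← res_toQuot k inf_le_left f, ← res_toQuot k inf_le_right g, hf, hg, res_res, res_res]
    have hconst := fun (w : Y) (hw : w ∈ (S : Set Y) ∩ T) =>
      eq_of_isPreconnected k hlc (hinter S hS T hT) (fun _ h => h) hw ⟨hyS, hyT⟩
    classical
    -- Transitivity: on the connected overlap the lifts f and g differ by the constant c, so f on S
    -- and g + c on T patch to a function lifting s on S ⊔ T.
    let c := f ⟨y.1, hyS⟩ - g ⟨y.1, hyT⟩
    let F : (S ⊔ T : Opens Y) → k := fun w => if hw : w.1 ∈ S then f ⟨w.1, hw⟩ else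
      if hw : w.1 ∈ T then g ⟨w.1, hw⟩ + c else 0
    have hFS : ∀ w (hw : w ∈ S), F ⟨w, Or.inl hw⟩ = f ⟨w, hw⟩ := fun w hw => dif_pos hw
    have hFT : ∀ w (hw : w ∈ T), F ⟨w, Or.inr hw⟩ = g ⟨w, hw⟩ + c := by
      intro w hw
      by_cases hwS : w ∈ S
      · exact (hFS w hwS).trans (sub_eq_iff_eq_add'.1 (hconst w ⟨hwS, hw⟩))
      · simp [F, hwS, hw]
    have hle : S ⊔ T ≤ V := sup_le hSV hTV
    refine ⟨S ⊔ T, hunion S hS T hT ⟨y.1, hyS, hyT⟩, hle, Or.inl hxS, Or.inr hzT, F, ?_⟩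
    refine sec_ext _ fun w hw => ?_
    rcases hw with hw | hw
    · refine ⟨S, le_sup_left, hw, ?_⟩
      rw [res_toQuot, res_res, ← hf]
      exact congrArg _ (funext fun w => hFS w.1 w.2)
    · refine ⟨T, le_sup_right, hw, ?_⟩
      rw [res_toQuot, res_res, ← hg, onSec_toQuot_eq_iff]
      refine isLocallyConstant_of_local k fun z hz => ⟨T, le_rfl, hz, c, fun y hy => ?_⟩
      exact sub_eq_iff_eq_add'.2 (hFT y hy)
  let st : Setoid V := ⟨r, hr1, hr2, hr3⟩
  let rep : V → V := fun x => (Quotient.mk st x).out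
  have hrep : ∀ x, r x (rep x) := fun x => hr2 (Quotient.mk_out (s := st) x)
  have hrepeq : ∀ {x y}, r x y → rep x = rep y := fun h =>
    congrArg Quotient.out (Quotient.sound (s := st) h)
  choose T hTB hTV hxT hrT f hf using hrep
  -- The value at x does not depend on the basic set or the lift chosen: another choice changes the
  -- lift by a constant on a connected overlap containing both x and its representative, and this
  -- cancels in the difference.
  let g : V → k := fun x => f x ⟨x.1, hxT x⟩ - f x ⟨(rep x).1, hrT x⟩
  refine ⟨g, sec_ext _ fun x hx => ⟨T ⟨x, hx⟩, hTV _, hxT _, ?_⟩⟩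
  rw [res_toQuot, ← hf, onSec_toQuot_eq_iff]
  refine isLocallyConstant_of_local k fun y hy => ⟨T ⟨x, hx⟩, le_rfl, hy,
    - f ⟨x, hx⟩ ⟨(rep ⟨x, hx⟩).1, hrT _⟩, fun z hz => ?_⟩
  have hzV : z ∈ V := hTV _ hz
  have hrz : rep ⟨z, hzV⟩ = rep ⟨x, hx⟩ :=
    hrepeq ⟨T ⟨x, hx⟩, hTB _, hTV _, hz, hxT _, f ⟨x, hx⟩, hf _⟩
  -- The sets chosen for z and for x both contain z and the common representative, so the difference
  -- of the two lifts takes the same value at these two points.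
  have hlc : IsLocallyConstant (fun w : (T ⟨z, hzV⟩ ⊓ T ⟨x, hx⟩ : Opens Y) =>
      f ⟨z, hzV⟩ ⟨w.1, w.2.1⟩ - f ⟨x, hx⟩ ⟨w.1, w.2.2⟩) := by
    refine (onSec_toQuot_eq_iff k (fun w : (T ⟨z, hzV⟩ ⊓ T ⟨x, hx⟩ : Opens Y) =>
      f ⟨z, hzV⟩ ⟨w.1, w.2.1⟩) (fun w => f ⟨x, hx⟩ ⟨w.1, w.2.2⟩)).1 ?_
    rw [← res_toQuot k inf_le_left (f ⟨z, hzV⟩), ← res_toQuot k inf_le_right (f ⟨x, hx⟩), hf, hf,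
      res_res, res_res]
  have hr' : (rep ⟨x, hx⟩).1 ∈ T ⟨z, hzV⟩ := hrz ▸ hrT ⟨z, hzV⟩
  have := eq_of_isPreconnected k hlc (hinter _ (hTB ⟨z, hzV⟩) _ (hTB ⟨x, hx⟩)) (fun _ h => h)
    (x := z) (y := (rep ⟨x, hx⟩).1) ⟨hxT _, hz⟩ ⟨hr', hrT _⟩
  have h2 : f ⟨z, hzV⟩ ⟨(rep ⟨z, hzV⟩).1, hrT _⟩ = f ⟨z, hzV⟩ ⟨(rep ⟨x, hx⟩).1, hr'⟩ := by
    congr 2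
    rw [hrz]
  change f ⟨z, hzV⟩ ⟨z, hxT _⟩ - f ⟨z, hzV⟩ ⟨(rep ⟨z, hzV⟩).1, hrT _⟩ - f ⟨x, hx⟩ ⟨z, hz⟩ = _
  rw [h2]
  linear_combination this

end Functions

/-! ### Flabby sheaves of vector spaces are injective -/

section Baer

variable {k : Type u} [Field k] {Y : TopCat.{u}}

/-- Sections extend from any open subset to the whole space. -/
def IsFlabby (F : Sh k Y) : Prop := ∀ V : Opens Y, Function.Surjective (res F (le_top : V ≤ ⊤))

/-- A partially defined morphism of sheaves, given by its graph. -/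
structure PartialHom (B F : Sh k Y) where
  graph : ∀ V : Opens Y, Submodule k (Sec B V × Sec F V)
  res_mem : ∀ {V W : Opens Y} (h : W ≤ V) {b f}, (b, f) ∈ graph V → (res B h b, res F h f) ∈ graph W
  eq_zero : ∀ {V : Opens Y} {f}, ((0 : Sec B V), f) ∈ graph V → f = 0

namespace PartialHom

variable {B F : Sh k Y}

@[ext]
lemma ext {P Q : PartialHom B F} (h : P.graph = Q.graph) : P = Q := by
  cases P; cases Q; cases h; rfl

instance : PartialOrder (PartialHom B F) := PartialOrder.lift graph fun _ _ => ext

lemma unique (P : PartialHom B F) {V : Opens Y} {b f f'} (h : (b, f) ∈ P.graph V)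
    (h' : (b, f') ∈ P.graph V) : f = f' := by
  rw [← sub_eq_zero]
  apply P.eq_zero (V := V)
  have := (P.graph V).sub_mem h h'
  rwa [Prod.mk_sub_mk, sub_self] at this

/-- Along a chain the union of the graphs is again a graph, because each condition involves only one
member at a time. -/
lemma bddAbove_of_isChain (c : Set (PartialHom B F)) (hc : IsChain (· ≤ ·) c) (P₀ : PartialHom B F)
    (h₀ : P₀ ∈ c) : ∃ Q, ∀ P ∈ c, P ≤ Q := by
  have hdir : ∀ V, DirectedOn (· ≤ ·) ((fun P : PartialHom B F => P.graph V) '' c) := by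
    rintro V _ ⟨P, hP, rfl⟩ _ ⟨Q, hQ, rfl⟩
    rcases hc.total hP hQ with h | h
    · exact ⟨_, ⟨Q, hQ, rfl⟩, h V, le_rfl⟩
    · exact ⟨_, ⟨P, hP, rfl⟩, le_rfl, h V⟩
  have hmem : ∀ V x, x ∈ sSup ((fun P : PartialHom B F => P.graph V) '' c) ↔
      ∃ P ∈ c, x ∈ P.graph V := by
    intro V x
    rw [Submodule.mem_sSup_of_directed (Set.Nonempty.image _ ⟨P₀, h₀⟩) (hdir V)]
    simp
  refine ⟨⟨fun V => sSup ((fun P : PartialHom B F => P.graph V) '' c), ?_, ?_⟩, ?_⟩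
  · intro V W h b f hbf
    obtain ⟨P, hP, hb⟩ := (hmem V _).1 hbf
    exact (hmem W _).2 ⟨P, hP, P.res_mem h hb⟩
  · intro V f hf
    obtain ⟨P, hP, hb⟩ := (hmem V _).1 hf
    exact P.eq_zero hb
  · intro P hP V x hx
    exact (hmem V x).2 ⟨P, hP, hx⟩

/-- The values already assigned to restrictions of b glue over the union of the open sets concerned.
Flabbiness extends the result to a global section g, and b is sent to the restriction of g. -/
lemma exists_extension (P : PartialHom B F) (hF : IsFlabby F) {V : Opens Y} (b : Sec B V) :
    ∃ Q, P ≤ Q ∧ ∃ f, (b, f) ∈ Q.graph V := by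
  let ι := { W : Opens Y // ∃ h : W ≤ V, ∃ f, (res B h b, f) ∈ P.graph W }
  let V' : Opens Y := ⨆ i : ι, i.1
  choose hι f hf using fun i : ι => i.2
  obtain ⟨f', hf'⟩ := exists_glue F (fun i : ι => i.1) V' (fun i => le_iSup (fun i : ι => i.1) i)
    le_rfl f (fun i j => P.unique (V := i.1 ⊓ j.1) (by
      have := P.res_mem (inf_le_left : i.1 ⊓ j.1 ≤ i.1) (hf i)
      rwa [res_res] at this) (by
      have := P.res_mem (inf_le_right : i.1 ⊓ j.1 ≤ j.1) (hf j)
      rwa [res_res] at this))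
  obtain ⟨g, hg⟩ := hF V' f'
  have key : ∀ (W : Opens Y) (hW : W ≤ V) (t : Sec F W), (res B hW b, t) ∈ P.graph W →
      t = res F le_top g := by
    intro W hW t ht
    let i : ι := ⟨W, hW, t, ht⟩
    rw [P.unique ht (hf i), ← hf' i, ← hg, res_res]
  -- Over W ≤ V the line spanned by the restriction of (b, g) is added; over other open sets nothing
  -- changes.
  let Γ : ∀ W : Opens Y, Submodule k (Sec B W × Sec F W) := fun W =>
    { carrier := { x | x ∈ P.graph W ∨ ∃ h : W ≤ V, ∃ c : k,
        x - c • (res B h b, res F le_top g) ∈ P.graph W }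
      zero_mem' := Or.inl (P.graph W).zero_mem
      add_mem' := by
        rintro x y (hx | ⟨h, c, hx⟩) (hy | ⟨h', c', hy⟩)
        · exact Or.inl ((P.graph W).add_mem hx hy)
        · refine Or.inr ⟨h', c', ?_⟩
          rw [add_sub_assoc]
          exact (P.graph W).add_mem hx hy
        · refine Or.inr ⟨h, c, ?_⟩
          rw [add_sub_right_comm]
          exact (P.graph W).add_mem hx hy
        · refine Or.inr ⟨h, c + c', ?_⟩
          rw [add_smul, add_sub_add_comm]
          exact (P.graph W).add_mem hx hy
      smul_mem' := by
        rintro c x (hx | ⟨h, c', hx⟩)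
        · exact Or.inl ((P.graph W).smul_mem c hx)
        · refine Or.inr ⟨h, c * c', ?_⟩
          rw [mul_smul, ← smul_sub]
          exact (P.graph W).smul_mem c hx }
  refine ⟨⟨Γ, ?_, ?_⟩, fun W x hx => Or.inl hx, res F le_top g, Or.inr ⟨le_rfl, 1, ?_⟩⟩
  · rintro W T h b' f'' (hx | ⟨h', c, hx⟩)
    · exact Or.inl (P.res_mem h hx)
    · refine Or.inr ⟨h.trans h', c, ?_⟩
      have := P.res_mem h hx
      rwa [map_sub, map_sub, Prod.smul_fst, Prod.smul_snd, map_smul, map_smul, res_res,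
        res_res] at this
  · rintro W t (hx | ⟨h, c, hx⟩)
    · exact P.eq_zero hx
    · by_cases hc : c = 0
      · rw [hc, zero_smul, sub_zero] at hx
        exact P.eq_zero hx
      · have h2 := (P.graph W).smul_mem (-c⁻¹) hx
        have h3 : (-c⁻¹) • (((0 : Sec B W), t) - c • (res B h b, res F le_top g)) =
            (res B h b, res F le_top g - c⁻¹ • t) := by
          ext
          · simp [hc]
          · simp [hc, sub_eq_add_neg, add_comm]
        rw [h3] at h2
        have h4 := key W h _ h2
        rw [sub_eq_self] at h4
        exact (smul_eq_zero.1 h4).resolve_left (inv_ne_zero hc)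
  · rw [one_smul, res_self, sub_self]
    exact (P.graph V).zero_mem

end PartialHom

/-- Over a field, flabby sheaves are injective. -/
theorem IsFlabby.injective {F : Sh k Y} (hF : IsFlabby F) : Injective F where
  factors := by
    intro A B φ i _
    -- The initial partial morphism is φ composed with the inverse of i, defined on the image of i;
    -- injectivity of i on sections makes it single-valued.
    let P₀ : PartialHom B F :=
      { graph := fun V => LinearMap.range ((onSec i V).prod (onSec φ V))
        res_mem := by
          rintro V W h b f ⟨a, ha⟩
          obtain ⟨rfl, rfl⟩ := Prod.mk.inj ha
          exact ⟨res A h a, Prod.ext (onSec_res i h a) (onSec_res φ h a)⟩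
        eq_zero := by
          rintro V f ⟨a, ha⟩
          obtain ⟨h, rfl⟩ := Prod.mk.inj ha
          have : a = 0 := onSec_injective i V (h.trans (map_zero _).symm)
          rw [this]
          exact map_zero _ }
    obtain ⟨P, hP, hmax⟩ := zorn_le_nonempty₀ (Set.Ici P₀) (by
      intro c hcs hc P hPc
      obtain ⟨Q, hQ⟩ := PartialHom.bddAbove_of_isChain c hc P hPc
      exact ⟨Q, (hcs hPc).trans (hQ P hPc), hQ⟩) P₀ Set.self_mem_Ici
    -- A maximal partial morphism is defined everywhere, since otherwise it could be extended to one
    -- more section.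
    have htot : ∀ V (b : Sec B V), ∃ f, (b, f) ∈ P.graph V := by
      intro V b
      obtain ⟨Q, hPQ, f, hf⟩ := P.exists_extension hF b
      exact ⟨f, hmax.2 (hP.trans hPQ) hPQ V hf⟩
    choose f hf using htot
    obtain ⟨ψ, hψ⟩ := exists_hom_of_sec B F (fun V =>
      { toFun := f V
        map_add' := fun x y => P.unique (hf V _) ((P.graph V).add_mem (hf V x) (hf V y))
        map_smul' := fun c x => P.unique (hf V _) ((P.graph V).smul_mem c (hf V x)) })
      (fun h s => P.unique (hf _ _) (P.res_mem h (hf _ s)))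
    refine ⟨ψ, sheaf_hom_ext fun V s => ?_⟩
    rw [onSec_comp, hψ]
    exact P.unique (hf V _) (hP V ⟨s, rfl⟩)

variable (k Y)

lemma fnSh_isFlabby : IsFlabby (fnSh k Y) := by
  classical
  intro V f
  exact ⟨fun x => if h : x.1 ∈ V then f ⟨x.1, h⟩ else 0, funext fun x => dif_pos x.2⟩

instance : Injective (fnSh k Y) := (fnSh_isFlabby k Y).injective

variable {k Y}

lemma quotSh_isFlabby
    (h : ∀ V : Opens Y, V = ⊤ ∨ Function.Surjective (onSec (toQuot k Y) V)) :
    IsFlabby (quotSh k Y) := by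
  intro V s
  rcases h V with rfl | hV
  · exact ⟨s, res_self _ _ _⟩
  · obtain ⟨f, rfl⟩ := hV s
    obtain ⟨g, rfl⟩ := fnSh_isFlabby k Y V f
    exact ⟨onSec (toQuot k Y) ⊤ g, (onSec_res _ _ _).symm⟩

end Baer

/-! ### Arcs: open sets seen through a chart to the real line -/

section Charts

variable {Y : TopCat.{u}} {V : Opens Y} {φ : V → ℝ}

/-- The open subset of `Y` corresponding to an open subset of the line under a chart. -/
def arc (hφ : Topology.IsOpenEmbedding φ) (I : Opens ℝ) : Opens Y :=
  ⟨Subtype.val '' (φ ⁻¹' (I : Set ℝ)),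
    V.isOpen.isOpenMap_subtype_val _ (I.isOpen.preimage hφ.continuous)⟩

variable (hφ : Topology.IsOpenEmbedding φ)

lemma mem_arc {I : Opens ℝ} {x : Y} : x ∈ arc hφ I ↔ ∃ h : x ∈ V, φ ⟨x, h⟩ ∈ I :=
  ⟨fun ⟨y, hy, h⟩ => h ▸ ⟨y.2, hy⟩, fun ⟨h, hx⟩ => ⟨⟨x, h⟩, hx, rfl⟩⟩

lemma arc_inf (I J : Opens ℝ) : arc hφ (I ⊓ J) = arc hφ I ⊓ arc hφ J := by
  ext x
  simp only [SetLike.mem_coe, Opens.mem_inf, mem_arc]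
  grind

lemma arc_sup (I J : Opens ℝ) : arc hφ (I ⊔ J) = arc hφ I ⊔ arc hφ J := by
  ext x
  simp only [SetLike.mem_coe, Opens.mem_sup, mem_arc]
  grind

lemma isPreconnected_arc {I : Opens ℝ} (hI : (I : Set ℝ).OrdConnected)
    (hI' : (I : Set ℝ) ⊆ Set.range φ) : IsPreconnected (arc hφ I : Set Y) := by
  refine _root_.IsPreconnected.image ?_ _ continuous_subtype_val.continuousOn
  rw [← hφ.isInducing.isPreconnected_image, Set.image_preimage_eq_of_subset hI']
  exact hI.isPreconnected

lemma arc_range : arc hφ ⟨Set.range φ, hφ.isOpen_range⟩ = V := by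
  ext x
  simp [mem_arc]

lemma exists_arc_mem {x : Y} (hx : x ∈ V) {W : Opens Y} (hxW : x ∈ W) :
    ∃ I : Opens ℝ, (I : Set ℝ).OrdConnected ∧ (I : Set ℝ) ⊆ Set.range φ ∧ x ∈ arc hφ I ∧
      arc hφ I ≤ W := by
  have ho : IsOpen (φ '' (Subtype.val ⁻¹' (W : Set Y))) :=
    hφ.isOpenMap _ (W.isOpen.preimage continuous_subtype_val)
  obtain ⟨ε, hε, hb⟩ := Metric.isOpen_iff.1 ho (φ ⟨x, hx⟩) ⟨_, hxW, rfl⟩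
  refine ⟨⟨Metric.ball (φ ⟨x, hx⟩) ε, Metric.isOpen_ball⟩, ?_, ?_, ?_, ?_⟩
  · exact (convex_ball (φ ⟨x, hx⟩) ε).ordConnected
  · exact hb.trans (Set.image_subset_range _ _)
  · exact (mem_arc hφ).2 ⟨hx, Metric.mem_ball_self hε⟩
  · intro y hy
    obtain ⟨h, hy⟩ := (mem_arc hφ).1 hy
    obtain ⟨z, hz, hzy⟩ := hb hy
    rw [hφ.injective hzy] at hz
    exact hz

include hφ in
-- Arcs coming from intervals form a suitable basis: intersections of intervals are intervals, and
-- so are unions of intervals that meet.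
lemma toQuot_surjective_of_chart (k : Type u) [Field k] {V' : Opens Y} (hV' : V' ≤ V) :
    Function.Surjective (onSec (toQuot k Y) V') := by
  refine toQuot_surjective_of_basis k { T | ∃ I : Opens ℝ, (I : Set ℝ).OrdConnected ∧
    (I : Set ℝ) ⊆ Set.range φ ∧ T = arc hφ I } ?_ ?_ ?_
  · intro x hx W hxW
    obtain ⟨I, h1, h2, h3, h4⟩ := exists_arc_mem hφ (hV' hx) hxW
    exact ⟨_, ⟨I, h1, h2, rfl⟩, h3, h4⟩
  · rintro _ ⟨I, h1, h2, rfl⟩ _ ⟨J, h1', h2', rfl⟩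
    have := isPreconnected_arc hφ (I := I ⊓ J) (h1.inter h1') (Set.inter_subset_left.trans h2)
    rwa [arc_inf] at this
  · rintro _ ⟨I, h1, h2, rfl⟩ _ ⟨J, h1', h2', rfl⟩ ⟨x, hx, hx'⟩
    refine ⟨I ⊔ J, ?_, Set.union_subset h2 h2', (arc_sup hφ I J).symm⟩
    obtain ⟨h, hI⟩ := (mem_arc hφ).1 hx
    obtain ⟨_, hJ⟩ := (mem_arc hφ).1 hx'
    exact (h1.isPreconnected.union' ⟨_, hI, hJ⟩ h1'.isPreconnected).ordConnected

end Charts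

/-! ### The circle minus one point and minus two points -/

section Circle

/-- The complement of a point of the circle. -/
def compl (p : S1.{u}) : Opens S1.{u} := ⟨{p}ᶜ, isOpen_compl_singleton⟩

/-- Through ℝ/ℤ, the complement of the class of a becomes the open interval from a to a + 1. -/
lemma exists_chart (p : S1.{u}) : ∃ φ : compl p → ℝ, Topology.IsOpenEmbedding φ ∧
    (Set.range φ).OrdConnected := by
  let e : S1.{u} ≃ₜ AddCircle (1 : ℝ) :=
    Homeomorph.ulift.trans (AddCircle.homeomorphCircle one_ne_zero).symm
  obtain ⟨a, ha⟩ := QuotientAddGroup.mk_surjective (e p)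
  have : Fact ((0 : ℝ) < 1) := ⟨one_pos⟩
  let E := e.toOpenPartialHomeomorph.trans (AddCircle.openPartialHomeomorphCoe (1 : ℝ) a).symm
  have hs : E.source = (compl p : Set S1.{u}) := by
    ext x
    simp only [E, OpenPartialHomeomorph.trans_source, compl]
    simp
    rw [← e.injective.eq_iff, ← ha]
  let h := (Homeomorph.setCongr hs.symm)
  have hE := E.isOpenEmbedding_restrict.comp h.isOpenEmbedding
  refine ⟨_, hE, ?_⟩
  have : Set.range (E.source.domRestrict E ∘ h) = Set.Ioo a (a + 1) := by
    rw [Set.range_comp, h.range_coe, Set.image_univ, Set.range_domRestrict,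
      E.image_source_eq_target]
    ext x
    simp [E]
  rw [this]
  exact Set.ordConnected_Ioo

lemma isPreconnected_compl (p : S1.{u}) : IsPreconnected (compl p : Set S1.{u}) := by
  obtain ⟨φ, hφ, h⟩ := exists_chart p
  have := isPreconnected_arc hφ (I := ⟨_, hφ.isOpen_range⟩) h subset_rfl
  rwa [arc_range] at this

instance : PreconnectedSpace S1.{u} :=
  Homeomorph.ulift.symm.surjective.denseRange.preconnectedSpace Homeomorph.ulift.symm.continuous

/-- The complement of p is an interval, and the image of q cuts it into two. The last clause, that
small arcs around any point other than p meet each half in a preconnected set, serves to bound the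
stalks of j_* k_U. -/
lemma exists_two_arcs {p q : S1.{u}} (hpq : p ≠ q) : ∃ V₁ V₂ : Opens S1.{u},
    V₁ ⊔ V₂ = compl p ⊓ compl q ∧ Disjoint V₁ V₂ ∧ IsConnected (V₁ : Set S1.{u}) ∧
      IsConnected (V₂ : Set S1.{u}) ∧ ∀ x ≠ p, ∀ W : Opens S1.{u}, x ∈ W → ∃ T : Opens S1.{u},
        x ∈ T ∧ T ≤ W ∧ IsPreconnected ((T : Set S1.{u}) ∩ V₁) ∧
          IsPreconnected ((T : Set S1.{u}) ∩ V₂) := by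
  obtain ⟨φ, hφ, h⟩ := exists_chart p
  have hq : q ∈ compl p := hpq.symm
  let R : Opens ℝ := ⟨_, hφ.isOpen_range⟩
  let r := φ ⟨q, hq⟩
  have hne : ∀ J : Opens ℝ, (J ⊓ R : Opens ℝ) ≠ ⊥ → (arc hφ (J ⊓ R) : Set S1.{u}).Nonempty := by
    intro J hJ
    obtain ⟨t, ht, x, rfl⟩ := (Opens.ne_bot_iff_nonempty _).1 hJ
    exact ⟨x.1, (mem_arc hφ).2 ⟨x.2, ht, x, rfl⟩⟩
  obtain ⟨ε, hε, hb⟩ := Metric.isOpen_iff.1 hφ.isOpen_range r ⟨_, rfl⟩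
  rw [Real.ball_eq_Ioo] at hb
  let I₁ : Opens ℝ := ⟨Set.Iio r, isOpen_Iio⟩
  let I₂ : Opens ℝ := ⟨Set.Ioi r, isOpen_Ioi⟩
  refine ⟨arc hφ (I₁ ⊓ R), arc hφ (I₂ ⊓ R), ?_, ?_, ⟨hne _ ?_, ?_⟩, ⟨hne _ ?_, ?_⟩, ?_⟩
  · rw [← arc_sup]
    refine Opens.ext (Set.ext fun x => ?_)
    change x ∈ arc _ _ ↔ x ∈ compl p ∧ x ∈ compl q
    rw [mem_arc]
    constructor
    · rintro ⟨hx, h⟩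
      refine ⟨hx, fun hxq => ?_⟩
      have : φ ⟨x, hx⟩ = r := congrArg φ (Subtype.ext hxq)
      rw [this] at h
      rcases h with h | h
      · exact lt_irrefl r h.1
      · exact lt_irrefl r h.1
    · rintro ⟨hx, hxq⟩
      refine ⟨hx, ?_⟩
      have : φ ⟨x, hx⟩ ≠ r := fun h => hxq (congrArg Subtype.val (hφ.injective h))
      rcases lt_or_gt_of_ne this with h | h
      · exact Or.inl ⟨h, _, rfl⟩
      · exact Or.inr ⟨h, _, rfl⟩
  · rw [disjoint_iff, ← arc_inf]
    refine Opens.ext (Set.ext fun x => ?_)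
    change x ∈ arc _ _ ↔ _
    rw [mem_arc]
    constructor
    · rintro ⟨hx, h, h'⟩
      exact lt_asymm (a := φ ⟨x, hx⟩) (b := r) h.1 h'.1
    · intro h
      exact h.elim
  · exact (Opens.ne_bot_iff_nonempty _).2 ⟨r - ε / 2, by
      change r - ε / 2 < r; linarith, hb ⟨by linarith, by linarith⟩⟩
  · exact isPreconnected_arc hφ (Set.ordConnected_Iio.inter h) Set.inter_subset_right
  · exact (Opens.ne_bot_iff_nonempty _).2 ⟨r + ε / 2, by
      change r < r + ε / 2; linarith, hb ⟨by linarith, by linarith⟩⟩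
  · exact isPreconnected_arc hφ (Set.ordConnected_Ioi.inter h) Set.inter_subset_right
  · intro x hx W hxW
    obtain ⟨J, h1, h2, h3, h4⟩ := exists_arc_mem hφ (show x ∈ compl p from hx) hxW
    refine ⟨_, h3, h4, ?_, ?_⟩
    · have := isPreconnected_arc hφ (I := J ⊓ (I₁ ⊓ R))
        (h1.inter (Set.ordConnected_Iio.inter h)) (Set.inter_subset_left.trans h2)
      rwa [arc_inf] at this
    · have := isPreconnected_arc hφ (I := J ⊓ (I₂ ⊓ R))
        (h1.inter (Set.ordConnected_Ioi.inter h)) (Set.inter_subset_left.trans h2)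
      rwa [arc_inf] at this

lemma toQuot_surjective_of_notMem (k : Type u) [Field k] {V : Opens S1.{u}} {p : S1.{u}}
    (hp : p ∉ V) : Function.Surjective (onSec (toQuot k S1.{u}) V) := by
  obtain ⟨φ, hφ, -⟩ := exists_chart p
  exact toQuot_surjective_of_chart hφ k fun x hx => fun h : x = p => hp (h ▸ hx)

lemma toQuot_surjective_of_notMem_range (k : Type u) [Field k] {S : Set S1.{u}} (hS : IsOpen S)
    {p : S1.{u}} (hp : p ∉ S) (V : Opens (TopCat.of S)) :
    Function.Surjective (onSec (toQuot k (TopCat.of S)) V) := by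
  obtain ⟨φ, hφ, -⟩ := exists_chart p
  have hS' : ∀ x ∈ S, x ∈ compl p := fun x hx h => hp (h ▸ hx)
  have h1 : Topology.IsOpenEmbedding (Set.inclusion hS' : S → (compl p : Set S1.{u})) :=
    .of_comp _ (compl p).isOpen.isOpenEmbedding_subtypeVal (by
      exact hS.isOpenEmbedding_subtypeVal)
  have h2 : Topology.IsOpenEmbedding (fun x : (⊤ : Opens (TopCat.of S)) =>
      φ (Set.inclusion hS' x.1)) :=
    hφ.comp (h1.comp (Opens.isOpenEmbedding' ⊤))
  exact toQuot_surjective_of_chart h2 k le_top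

end Circle

/-! ### Stalks and adjunctions for sheaves on a subspace -/

section SheafFunctors

variable (k : Type u) [Field k] {X Y : TopCat.{u}} (f : X ⟶ Y)

open Classical in
/-- The stalk of the inverse image. -/
def stalkPullbackIso (x : X) :
    TopCat.Sheaf.pullback (ModuleCat.{u} k) f ⋙ stalkF k x ≅ stalkF k (f x) :=
  -- Stalks are left adjoint to skyscraper sheaves and skyscrapers push forward to skyscrapers, so
  -- both sides are left adjoints of the same functor.
  have e : skyscraperSheafFunctor x ⋙ TopCat.Sheaf.pushforward (ModuleCat.{u} k) f ≅
      skyscraperSheafFunctor (f x) := NatIso.ofComponents (fun M => Iso.refl _) (by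
        intro M N φ
        refine (Category.comp_id _).trans (Eq.trans ?_ (Category.id_comp _).symm)
        rfl)
  Adjunction.leftAdjointUniq
    (((TopCat.Sheaf.pullbackPushforwardAdjunction (ModuleCat.{u} k) f).comp
      (stalkSkyscraperSheafAdjunction x)).ofNatIsoRight e) (stalkSkyscraperSheafAdjunction (f x))

variable {f}

/-- Every open set of X is a preimage from Y, so the direct image is fully faithful. -/
lemma isIso_counit_of_isInducing (hf : Topology.IsInducing f) (F : Sh k X) :
    IsIso ((TopCat.Sheaf.pullbackPushforwardAdjunction (ModuleCat.{u} k) f).counit.app F) := by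
  have : (TopCat.Sheaf.pushforward (ModuleCat.{u} k) f).Faithful := by
    refine ⟨fun {F G φ ψ} h => sheaf_hom_ext fun V s => ?_⟩
    obtain ⟨W, hW, hV⟩ := hf.isOpen_iff.1 V.isOpen
    obtain rfl : V = (Opens.map f).obj ⟨W, hW⟩ := Opens.ext hV.symm
    exact congrArg (fun t => onSec t ⟨W, hW⟩ s) h
  have : (TopCat.Sheaf.pushforward (ModuleCat.{u} k) f).Full := by
    refine ⟨fun {F G} φ => ?_⟩
    have hex : ∀ V : Opens X, ∃ W : Opens Y, (Opens.map f).obj W = V := fun V => by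
      obtain ⟨W, hW, hV⟩ := hf.isOpen_iff.1 V.isOpen
      exact ⟨⟨W, hW⟩, Opens.ext hV⟩
    choose W hW using hex
    let φ' : ∀ W : Opens Y, Sec F ((Opens.map f).obj W) →ₗ[k] Sec G ((Opens.map f).obj W) :=
      fun W => onSec φ W
    have hφ' : ∀ {W W' : Opens Y} (h : W' ≤ W) (s), φ' W' (res F ((Opens.map f).monotone h) s) =
      res G ((Opens.map f).monotone h) (φ' W s) := fun h s => onSec_res φ h s
    -- Naturality is given only for inclusions in Y, but is needed for inclusions of preimages.
    -- Passing through W ⊓ W', which has the same preimage as W', bridges the gap.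
    have key : ∀ {W W' : Opens Y} (h : (Opens.map f).obj W' ≤ (Opens.map f).obj W) (s),
        φ' W' (res F h s) = res G h (φ' W s) := by
      intro W W' h s
      have h1 : (Opens.map f).obj W' ≤ (Opens.map f).obj (W ⊓ W') := fun x hx => ⟨h hx, hx⟩
      have h2 := hφ' (inf_le_left : W ⊓ W' ≤ W) s
      have h3 := hφ' (inf_le_right : W ⊓ W' ≤ W') (res F h s)
      rw [res_res] at h3
      have h4 := congrArg (res G h1) (h3.symm.trans h2)
      rwa [res_res, res_res, res_self] at h4
    obtain ⟨ψ, hψ⟩ := exists_hom_of_sec F G (fun V =>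
      (res G (hW V).ge).comp ((φ' (W V)).comp (res F (hW V).le))) (by
        intro V V' h s
        have h1 : (Opens.map f).obj (W V') ≤ (Opens.map f).obj (W V) :=
          (hW V').le.trans (h.trans (hW V).ge)
        have h2 := congrArg (res G (hW V').ge) (key h1 (res F (hW V).le s))
        rw [res_res, res_res] at h2
        change res G (hW V').ge (φ' (W V') (res F (hW V').le (res F h s))) =
          res G h (res G (hW V).ge (φ' (W V) (res F (hW V).le s)))
        rw [res_res, res_res]
        exact h2)
    refine ⟨ψ, sheaf_hom_ext fun V s => ?_⟩
    exact (hψ _ s).trans ((congrArg (res G _) (key (hW _).le s)).trans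
      ((res_res G _ _ _).trans (res_self G _ _)))
  infer_instance

variable {Z : TopCat.{u}} {i : Z ⟶ Y}

lemma isZero_pullback_pushforward (hi : Topology.IsClosedEmbedding i)
    (h : ∀ x, f x ∉ Set.range i) (F : Sh k Z) :
    IsZero ((TopCat.Sheaf.pullback (ModuleCat.{u} k) f).obj
      ((TopCat.Sheaf.pushforward (ModuleCat.{u} k) i).obj F)) := by
  rw [TopCat.Sheaf.isZero_iff_stalkFunctor_obj_isZero]
  intro x
  exact (isZero_stalk_pushforward k i hi F (f x) (h x)).of_iso ((stalkPullbackIso k f x).app _)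

variable {k}

lemma isZero_of_pullback (F : Sh k Y)
    (h : ∀ y, (∃ x, f x = y) ∨ ∃ z, i z = y)
    (hf : IsZero ((TopCat.Sheaf.pullback (ModuleCat.{u} k) f).obj F))
    (hi : IsZero ((TopCat.Sheaf.pullback (ModuleCat.{u} k) i).obj F)) : IsZero F := by
  rw [TopCat.Sheaf.isZero_iff_stalkFunctor_obj_isZero] at hf hi ⊢
  intro y
  rcases h y with ⟨x, rfl⟩ | ⟨z, rfl⟩
  · exact (hf x).of_iso ((stalkPullbackIso k f x).symm.app F)
  · exact (hi z).of_iso ((stalkPullbackIso k i z).symm.app F)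

end SheafFunctors

/-! ### Derived right adjoints computed on complexes of injectives -/

section Abstract

open ZeroObject

universe v₁ v₂ u₁ u₂ w₁ w₂ v₃ u₃ w₃
variable {A : Type u₁} [Category.{v₁} A] [Abelian A] {B : Type u₂} [Category.{v₂} B] [Abelian B]
  {C : Type u₃} [Category.{v₃} C] [Abelian C]
lemma isStrictlyGE_map {R : B ⥤ A} [R.Additive] (J : CochainComplex B ℤ) (n : ℤ)
    (hJ : J.IsStrictlyGE n) : CochainComplex.IsStrictlyGE
      ((R.mapHomologicalComplex (ComplexShape.up ℤ)).obj J) n :=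
  inferInstance

variable [HasDerivedCategory.{w₁} A] [HasDerivedCategory.{w₂} B] [HasDerivedCategory.{w₃} C]

instance (F : A ⥤ B) [F.Additive] [PreservesFiniteLimits F] [PreservesFiniteColimits F] :
    (mapDPlus F).IsTriangulated := by
  dsimp only [mapDPlus]; infer_instance

/-- An exact functor commutes with the homology of bounded below complexes. -/
lemma nonempty_homology_mapDPlus_iso (F : A ⥤ B) [F.Additive] [PreservesFiniteLimits F]
    [PreservesFiniteColimits F] (K : DerivedCategory.Plus A) (n : ℤ) :
    Nonempty ((DerivedCategory.Plus.homologyFunctor B n).obj ((mapDPlus F).obj K) ≅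
      F.obj ((DerivedCategory.Plus.homologyFunctor A n).obj K)) := by
  let K₀ := DerivedCategory.Q.objPreimage K.obj
  let e : DerivedCategory.Q.obj K₀ ≅ K.obj := DerivedCategory.Q.objObjPreimageIso K.obj
  have e1 : (DerivedCategory.homologyFunctor B n).obj (F.mapDerivedCategory.obj K.obj) ≅
      ((F.mapHomologicalComplex (ComplexShape.up ℤ)).obj K₀).homology n :=
    (DerivedCategory.homologyFunctor B n).mapIso
      (F.mapDerivedCategory.mapIso e.symm ≪≫ F.mapDerivedCategoryFactors.app K₀) ≪≫
      (DerivedCategory.homologyFunctorFactors B n).app _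
  have e2 : ((F.mapHomologicalComplex (ComplexShape.up ℤ)).obj K₀).homology n ≅
      F.obj (K₀.homology n) := (K₀.sc n).mapHomologyIso F
  have e3 : F.obj (K₀.homology n) ≅
      F.obj ((DerivedCategory.homologyFunctor A n).obj K.obj) :=
    F.mapIso (((DerivedCategory.homologyFunctorFactors A n).app K₀).symm ≪≫
      (DerivedCategory.homologyFunctor A n).mapIso e)
  exact ⟨e1 ≪≫ e2 ≪≫ e3⟩

lemma isZero_of_isZero_homology (K : DerivedCategory.Plus A)
    (h : ∀ n, IsZero ((DerivedCategory.Plus.homologyFunctor A n).obj K)) : IsZero K := by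
  have : IsIso (0 : K ⟶ 0) := by
    rw [DerivedCategory.Plus.isIso_iff]
    intro n
    exact isIso_of_source_target_iso_zero _ (h n).isoZero
      ((DerivedCategory.Plus.homologyFunctor A n).map_isZero (isZero_zero _)).isoZero
  exact (isZero_zero _).of_iso (asIso (0 : K ⟶ 0))

variable {L : A ⥤ B} {R : B ⥤ A} [L.Additive] [R.Additive]
  [PreservesFiniteLimits L] [PreservesFiniteColimits L]

/-- The bounded below object defined by a strictly bounded below complex. -/
abbrev plusOf (J : CochainComplex B ℤ) (n : ℤ) (hJ : J.IsStrictlyGE n) : DerivedCategory.Plus B :=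
  ⟨DerivedCategory.Q.obj J, n, ⟨⟨J, Iso.refl _, hJ⟩⟩⟩

lemma exists_injective_model [EnoughInjectives B] (Y : DerivedCategory.Plus B) :
    ∃ (J : CochainComplex B ℤ) (n : ℤ) (hJ : J.IsStrictlyGE n),
      (∀ m, Injective (J.X m)) ∧ Nonempty (plusOf J n hJ ≅ Y) := by
  obtain ⟨n, hn⟩ := Y.property
  have : Y.IsGE n := (Y.isGE_ι_obj_iff n).1 hn
  obtain ⟨I, hI, ⟨e⟩⟩ := DerivedCategory.Plus.exists_injective_nonempty_iso Y n
  let J : CochainComplex B ℤ := ((InjectiveObject.ι B).mapHomologicalComplex (.up ℤ)).obj I.obj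
  have hJ : J.IsStrictlyGE n := inferInstanceAs
    (CochainComplex.IsStrictlyGE (((InjectiveObject.ι B).mapHomologicalComplex _).obj I.obj) n)
  refine ⟨J, n, hJ, fun m => (I.obj.X m).property, ⟨?_⟩⟩
  exact DerivedCategory.Plus.ι.preimageIso (DerivedCategory.Plus.ι.mapIso e)

/-- The counit of the derived adjunction at a complex of injectives. -/
def injCounit (adj : L ⊣ R) (J : CochainComplex B ℤ) (n : ℤ) (hJ : J.IsStrictlyGE n) :
    (mapDPlus L).obj (plusOf _ n (isStrictlyGE_map (R := R) J n hJ)) ⟶ plusOf J n hJ :=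
  ObjectProperty.homMk (L.mapDerivedCategoryFactors.hom.app _ ≫
    DerivedCategory.Q.map ((complexAdj adj).counit.app J))

lemma bijective_map_comp_injCounit (adj : L ⊣ R) (J : CochainComplex B ℤ) (n : ℤ)
    (hJ : J.IsStrictlyGE n) (hinj : ∀ m, Injective (J.X m)) (X : DerivedCategory.Plus A) :
    Function.Bijective (fun f : X ⟶ plusOf _ n (isStrictlyGE_map (R := R) J n hJ) =>
      (mapDPlus L).map f ≫ injCounit adj J n hJ) := by
  have : J.IsKInjective := CochainComplex.isKInjective_of_injective J n
  have hRJ := isStrictlyGE_map (R := R) J n hJ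
  have (m : ℤ) : Injective (((R.mapHomologicalComplex (ComplexShape.up ℤ)).obj J).X m) :=
    have := hinj m
    adj.map_injective _ this
  have : CochainComplex.IsKInjective ((R.mapHomologicalComplex (ComplexShape.up ℤ)).obj J) :=
    CochainComplex.isKInjective_of_injective _ n
  have h := bijective_map_comp_counit adj J X.obj
  constructor
  · intro f f' hff
    apply DerivedCategory.Plus.ι.map_injective
    exact h.1 ((DerivedCategory.Plus.ι (C := B)).congr_map hff)
  · intro g
    obtain ⟨f, hf⟩ := h.2 g.hom
    exact ⟨ObjectProperty.homMk f, DerivedCategory.Plus.ι.map_injective hf⟩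

variable {G : DerivedCategory.Plus B ⥤ DerivedCategory.Plus A}

/-- A right adjoint of a derived exact functor is computed termwise on complexes of injectives. -/
lemma exists_rightAdjoint_iso (adj' : mapDPlus L ⊣ G) (adj : L ⊣ R) (J : CochainComplex B ℤ) (n : ℤ)
    (hJ : J.IsStrictlyGE n) (hinj : ∀ m, Injective (J.X m)) :
    ∃ θ : G.obj (plusOf J n hJ) ≅ plusOf _ n (isStrictlyGE_map (R := R) J n hJ),
      (mapDPlus L).map θ.hom ≫ injCounit adj J n hJ = adj'.counit.app _ := by
  have hb := bijective_map_comp_injCounit adj J n hJ hinj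
  -- Both objects represent the functor sending X to the morphisms from `(mapDPlus L).obj X` to J,
  -- so the two universal morphisms induce mutually inverse maps.
  obtain ⟨θ, hθ⟩ := (hb _).2 (adj'.counit.app (plusOf J n hJ))
  dsimp only at hθ
  let θ' := adj'.homEquiv _ _ (injCounit adj J n hJ)
  have hθ' : (mapDPlus L).map θ' ≫ adj'.counit.app (plusOf J n hJ) = injCounit adj J n hJ :=
    (adj'.homEquiv_counit _ _ _).symm.trans (Equiv.symm_apply_apply _ _)
  refine ⟨⟨θ, θ', ?_, ?_⟩, hθ⟩
  · apply (adj'.homEquiv _ _).symm.injective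
    rw [adj'.homEquiv_counit, adj'.homEquiv_counit, Functor.map_comp, Category.assoc, hθ', hθ]
    simp
  · apply (hb _).1
    dsimp only
    rw [Functor.map_comp, Category.assoc, hθ, hθ']
    simp

/-- On a complex of injectives the derived counit is, up to isomorphism, the termwise counit. -/
lemma isIso_counit_of_isIso_counit [EnoughInjectives B] (adj' : mapDPlus L ⊣ G) (adj : L ⊣ R)
    (h : ∀ F, IsIso (adj.counit.app F)) (Y : DerivedCategory.Plus B) :
    IsIso (adj'.counit.app Y) := by
  obtain ⟨J, n, hJ, hinj, ⟨e⟩⟩ := exists_injective_model Y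
  rw [← NatTrans.isIso_app_iff_of_iso _ e]
  obtain ⟨θ, hθ⟩ := exists_rightAdjoint_iso adj' adj J n hJ hinj
  have h1 : IsIso ((complexAdj adj).counit.app J) := by
    have : ∀ m, IsIso (((complexAdj adj).counit.app J).f m) := fun m => h (J.X m)
    exact HomologicalComplex.Hom.isIso_of_components _
  have : IsIso (injCounit adj J n hJ) := by
    have : IsIso (DerivedCategory.Plus.ι.map (injCounit adj J n hJ)) := by
      change IsIso (L.mapDerivedCategoryFactors.hom.app _ ≫
        DerivedCategory.Q.map ((complexAdj adj).counit.app J))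
      infer_instance
    exact isIso_of_reflects_iso _ DerivedCategory.Plus.ι
  rw [← hθ]
  infer_instance

/-- After replacing Y by a complex of injectives, the composite is computed by a complex all of
whose terms vanish. -/
lemma isZero_mapDPlus_rightAdjoint [EnoughInjectives B] (adj' : mapDPlus L ⊣ G) (adj : L ⊣ R)
    (M : A ⥤ C) [M.Additive]
    [PreservesFiniteLimits M] [PreservesFiniteColimits M] (h : ∀ F, IsZero (M.obj (R.obj F)))
    (Y : DerivedCategory.Plus B) : IsZero ((mapDPlus M).obj (G.obj Y)) := by
  obtain ⟨J, n, hJ, hinj, ⟨e⟩⟩ := exists_injective_model Y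
  obtain ⟨θ, -⟩ := exists_rightAdjoint_iso adj' adj J n hJ hinj
  refine IsZero.of_iso ?_ ((mapDPlus M).mapIso (G.mapIso e.symm ≪≫ θ))
  apply isZero_of_isZero_homology
  intro m
  obtain ⟨e1⟩ := nonempty_homology_mapDPlus_iso M
    (plusOf _ n (isStrictlyGE_map (R := R) J n hJ)) m
  refine IsZero.of_iso ?_ (e1 ≪≫ M.mapIso ((DerivedCategory.homologyFunctorFactors A m).app _))
  refine IsZero.of_iso ?_ ((((R.mapHomologicalComplex (ComplexShape.up ℤ)).obj J).sc m).mapHomologyIso M).symm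
  exact (ShortComplex.exact_iff_isZero_homology _).1 (ShortComplex.exact_of_isZero_X₂ _ (h _))

end Abstract

/-! ### Changing the third vertex or the third arrow of a triangle -/

section Triangles

open Pretriangulated

variable {C : Type*} [Category* C] [HasZeroObject C] [HasShift C ℤ] [Preadditive C]
  [∀ n : ℤ, (shiftFunctor C n).Additive] [Pretriangulated C] {X Y Z Z' : C}

lemma distinguished_of_iso₃ {f : X ⟶ Y} {g : Y ⟶ Z} {h : Z ⟶ X⟦(1 : ℤ)⟧}
    (hT : Triangle.mk f g h ∈ distinguishedTriangles) (e : Z ≅ Z') {g' : Y ⟶ Z'}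
    (he : g ≫ e.hom = g') : Triangle.mk f g' (e.inv ≫ h) ∈ distinguishedTriangles :=
  isomorphic_distinguished _ hT _ (Triangle.isoMk _ _ (Iso.refl X) (Iso.refl Y) e.symm
    ((Category.comp_id f).trans (Category.id_comp f).symm)
    ((e.comp_inv_eq.2 he.symm).trans (Category.id_comp g).symm)
    ((congrArg (fun t => (e.inv ≫ h) ≫ t) ((shiftFunctor C (1 : ℤ)).map_id X)).trans (Category.comp_id _)))

lemma exists_comp_of_distinguished {f : X ⟶ Y} {g : Y ⟶ Z} {h h' : Z ⟶ X⟦(1 : ℤ)⟧}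
    (hT : Triangle.mk f g h ∈ distinguishedTriangles)
    (hT' : Triangle.mk f g h' ∈ distinguishedTriangles) :
    ∃ c : Z ⟶ Z, g ≫ c = g ∧ h = c ≫ h' := by
  obtain ⟨c, hc1, hc2⟩ := complete_distinguished_triangle_morphism _ _ hT hT' (𝟙 X) (𝟙 Y)
    ((Category.comp_id f).trans (Category.id_comp f).symm)
  exact ⟨c, hc1.trans (Category.id_comp g), ((Category.comp_id h).symm.trans
    (congrArg (fun t => h ≫ t) ((shiftFunctor C (1 : ℤ)).map_id X)).symm).trans hc2⟩

end Triangles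

/-! ### Recollement and the localization triangle -/

section Recollement

open Pretriangulated

variable (k : Type u) [Field k] {X Y : TopCat.{u}}

lemma isIso_counit_pullPush {f : X ⟶ Y} (hf : Topology.IsInducing f) (K : D k X) :
    IsIso ((pullPushAdj k f).counit.app K) :=
  isIso_counit_of_isIso_counit (pullPushAdj k f)
    (TopCat.Sheaf.pullbackPushforwardAdjunction (ModuleCat.{u} k) f)
    (isIso_counit_of_isInducing k hf) K

lemma isIso_pull_unit {f : X ⟶ Y} (hf : Topology.IsInducing f) (K : D k Y) :
    IsIso ((pull k f).map ((pullPushAdj k f).unit.app K)) := by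
  have := isIso_counit_pullPush k hf ((pull k f).obj K)
  have h := (pullPushAdj k f).left_triangle_components K
  have : IsIso ((pull k f).map ((pullPushAdj k f).unit.app K) ≫
      (pullPushAdj k f).counit.app ((pull k f).obj K)) := by
    rw [h]
    exact inferInstanceAs (IsIso (𝟙 _))
  exact IsIso.of_isIso_comp_right _ ((pullPushAdj k f).counit.app ((pull k f).obj K))

instance (f : X ⟶ Y) : (pullPushAdj k f).CommShift ℤ :=
  (pullPushAdj k f).commShift_of_leftAdjoint ℤ

instance (f : X ⟶ Y) : (push k f).IsTriangulated :=
  (pullPushAdj k f).isTriangulated_rightAdjoint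

variable {f : X ⟶ Y} (hf : Topology.IsClosedEmbedding f)

instance : (shriek k hf).CommShift ℤ := (pushShriekAdj k hf).rightAdjointCommShift ℤ

instance : (pushShriekAdj k hf).CommShift ℤ := (pushShriekAdj k hf).commShift_of_leftAdjoint ℤ

instance : (shriek k hf).IsTriangulated := (pushShriekAdj k hf).isTriangulated_rightAdjoint

include hf in
-- Since i_* is fully faithful, the unit of i_* ⊣ i^! is invertible, and the triangle identity then
-- inverts i^! of the counit.
lemma isIso_shriek_counit (K : D k Y) :
    IsIso ((shriek k hf).map ((pushShriekAdj k hf).counit.app K)) := by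
  have : IsIso (pullPushAdj k f).counit :=
    (NatTrans.isIso_iff_isIso_app _).2 (isIso_counit_pullPush k hf.isInducing)
  have : (push k f).Full := (pullPushAdj k f).fullyFaithfulROfIsIsoCounit.full
  have : (push k f).Faithful := (pullPushAdj k f).fullyFaithfulROfIsIsoCounit.faithful
  have h := (pushShriekAdj k hf).right_triangle_components K
  have : IsIso ((pushShriekAdj k hf).unit.app ((shriek k hf).obj K) ≫
      (shriek k hf).map ((pushShriekAdj k hf).counit.app K)) := by
    rw [h]
    exact inferInstanceAs (IsIso (𝟙 _))
  exact IsIso.of_isIso_comp_left ((pushShriekAdj k hf).unit.app ((shriek k hf).obj K)) _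

variable {Z : Set X} (hZ : IsClosed Z)

include hZ in
lemma isZero_pull_push (K : D k (TopCat.of Z)) :
    IsZero ((pull k (incl Zᶜ)).obj ((push k (incl Z)).obj K)) := by
  refine isZero_mapDPlus_rightAdjoint (pullPushAdj k (incl Z))
    (TopCat.Sheaf.pullbackPushforwardAdjunction (ModuleCat.{u} k) (incl Z)) _
    (isZero_pullback_pushforward k (incl_isClosedEmbedding hZ) ?_) K
  rintro ⟨x, hx⟩ ⟨y, hy⟩
  exact hx (show x ∈ Z from (show (y : X) = x from hy) ▸ y.2)

/-- An object whose restrictions to a subset and to its complement vanish is zero. -/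
lemma isZero_of_pull (Z : Set X) (K : D k X) (h₁ : IsZero ((pull k (incl Z)).obj K))
    (h₂ : IsZero ((pull k (incl Zᶜ)).obj K)) : IsZero K := by
  refine isZero_of_isZero_homology K fun n => ?_
  obtain ⟨e₁⟩ := nonempty_homology_mapDPlus_iso
    (TopCat.Sheaf.pullback (ModuleCat.{u} k) (incl Z)) K n
  obtain ⟨e₂⟩ := nonempty_homology_mapDPlus_iso
    (TopCat.Sheaf.pullback (ModuleCat.{u} k) (incl Zᶜ)) K n
  refine isZero_of_pullback (f := incl Z) (i := incl Zᶜ) _ (fun y => ?_)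
    (IsZero.of_iso (Functor.map_isZero _ h₁) e₁.symm)
    (IsZero.of_iso (Functor.map_isZero _ h₂) e₂.symm)
  by_cases hy : y ∈ Z
  · exact Or.inl ⟨⟨y, hy⟩, rfl⟩
  · exact Or.inr ⟨⟨y, hy⟩, rfl⟩

include hZ in
-- The cone of the unit is killed by both i^* and j^*, hence vanishes on stalks.
lemma isIso_unit_of_isZero_pull (K : D k X) (hK : IsZero ((pull k (incl Zᶜ)).obj K)) :
    IsIso ((pullPushAdj k (incl Z)).unit.app K) := by
  obtain ⟨C, g, h, hT⟩ := distinguished_cocone_triangle ((pullPushAdj k (incl Z)).unit.app K)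
  have hC : IsZero C := by
    apply isZero_of_pull k Z
    · exact (Triangle.isZero₃_iff_isIso₁ _ ((pull k (incl Z)).map_distinguished _ hT)).2
        (isIso_pull_unit k (incl_isClosedEmbedding hZ).isInducing K)
    · exact Triangle.isZero₃_of_isZero₁₂ _ ((pull k (incl Zᶜ)).map_distinguished _ hT) hK
        (isZero_pull_push k hZ _)
  exact (Triangle.isZero₃_iff_isIso₁ _ hT).1 hC

/-- By the two adjunctions, Hom(L, i^! j_* K) = Hom(j^* i_* L, K) = 0. -/
lemma isZero_shriek_push (K : D k (TopCat.of (Zᶜ : Set X))) :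
    IsZero ((shriek k (incl_isClosedEmbedding hZ)).obj ((push k (incl Zᶜ)).obj K)) := by
  rw [IsZero.iff_id_eq_zero]
  apply ((pushShriekAdj k (incl_isClosedEmbedding hZ)).homEquiv _ _).symm.injective
  apply ((pullPushAdj k (incl Zᶜ)).homEquiv _ _).symm.injective
  exact (isZero_pull_push k hZ _).eq_of_src _ _

/-- If j^* K = 0 then K ≅ i_* i^* K, so the identity of K lives in Hom(i^* K, i^! K), which is zero.
-/
lemma isZero_of_isZero_pull_shriek (K : D k X) (h₁ : IsZero ((pull k (incl Zᶜ)).obj K))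
    (h₂ : IsZero ((shriek k (incl_isClosedEmbedding hZ)).obj K)) : IsZero K := by
  have := isIso_unit_of_isZero_pull k hZ K h₁
  rw [IsZero.iff_id_eq_zero, ← cancel_epi (inv ((pullPushAdj k (incl Z)).unit.app K))]
  apply ((pushShriekAdj k (incl_isClosedEmbedding hZ)).homEquiv _ _).injective
  exact h₂.eq_of_tgt _ _

/-- The cone of the unit is killed by j^* and, since i^! j_* = 0, also by i^!. -/
lemma isIso_restrUnit (K : D k X)
    (hK : IsZero ((shriek k (incl_isClosedEmbedding hZ)).obj K)) :
    IsIso (restrUnit k Z K) := by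
  obtain ⟨C, g, h, hT⟩ := distinguished_cocone_triangle (restrUnit k Z K)
  refine (Triangle.isZero₃_iff_isIso₁ _ hT).1 (isZero_of_isZero_pull_shriek k hZ C ?_ ?_)
  · exact (Triangle.isZero₃_iff_isIso₁ _ ((pull k (incl Zᶜ)).map_distinguished _ hT)).2
      (isIso_pull_unit k Topology.IsInducing.subtypeVal K)
  · exact Triangle.isZero₃_of_isZero₁₂ _ ((shriek k (incl_isClosedEmbedding hZ)).map_distinguished
      _ hT) hK (isZero_shriek_push k hZ _)

/-- The localization triangle exists and its third morphism is unique. -/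
theorem existsUnique_isLocTriangle (A : D k X) : ∃! h, IsLocTriangle k hZ A h := by
  obtain ⟨C, g, h, hT⟩ := distinguished_cocone_triangle (suppCounit k hZ A)
  have h1 : IsZero ((shriek k (incl_isClosedEmbedding hZ)).obj C) :=
    (Triangle.isZero₃_iff_isIso₁ _ ((shriek k (incl_isClosedEmbedding hZ)).map_distinguished
      _ hT)).2 (isIso_shriek_counit k (incl_isClosedEmbedding hZ) A)
  have h2 : IsIso ((pull k (incl Zᶜ)).map g) :=
    (Triangle.isZero₁_iff_isIso₂ _ ((pull k (incl Zᶜ)).map_distinguished _ hT)).1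
      (isZero_pull_push k hZ _)
  have h3 := isIso_restrUnit k hZ C h1
  -- The cone C of the counit has i^! C = 0, so C ≅ j_* j^* C, and j^* A ≅ j^* C because j^* i_* =
  -- 0.
  let e : C ≅ restr k Z A := asIso (restrUnit k Z C) ≪≫
    (asIso ((push k (incl Zᶜ)).map ((pull k (incl Zᶜ)).map g))).symm
  have he : g ≫ e.hom = restrUnit k Z A := by
    have := (pullPushAdj k (incl Zᶜ)).unit.naturality g
    dsimp at this
    simp only [e, Iso.trans_hom, asIso_hom, Iso.symm_hom, asIso_inv, ← Category.assoc,
      IsIso.comp_inv_eq]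
    exact this
  have hex : IsLocTriangle k hZ A (e.inv ≫ h) := distinguished_of_iso₃ hT e he
  refine ⟨_, hex, fun h' hh' => ?_⟩
  obtain ⟨c, hc1, hc2⟩ := exists_comp_of_distinguished hh' hex
  -- An endomorphism of j_* j^* A that fixes the unit is the identity: by adjunction it is
  -- determined by its composite with the unit, as j^* of the unit is invertible.
  have hc : c = 𝟙 _ := by
    apply ((pullPushAdj k (incl Zᶜ)).homEquiv _ _).symm.injective
    have := isIso_pull_unit k (f := incl Zᶜ) Topology.IsInducing.subtypeVal A
    refine ((pullPushAdj k (incl Zᶜ)).homEquiv_counit _ _ _).trans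
      (Eq.trans ?_ ((pullPushAdj k (incl Zᶜ)).homEquiv_counit _ _ _).symm)
    rw [← cancel_epi ((pull k (incl Zᶜ)).map ((pullPushAdj k (incl Zᶜ)).unit.app A)),
      ← Functor.map_comp_assoc, ← Functor.map_comp_assoc, hc1]
    exact congrArg (fun t => (pull k (incl Zᶜ)).map t ≫ _) (Category.comp_id _).symm
  rw [hc2, hc, Category.id_comp]

end Recollement

/-! ### Sheaves as complexes in degree zero -/

section SingleFunctor

open Pretriangulated

universe v₁ u₁ w₁

variable {A : Type u₁} [Category.{v₁} A] [Abelian A] [HasDerivedCategory.{w₁} A]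

/-- The embedding of an abelian category as the complexes concentrated in degree zero. -/
abbrev sgl (A : Type u₁) [Category.{v₁} A] [Abelian A] [HasDerivedCategory.{w₁} A] :
    A ⥤ DerivedCategory.Plus A :=
  DerivedCategory.Plus.singleFunctor A 0

instance : (sgl A).Faithful where
  map_injective h := (DerivedCategory.singleFunctor A 0).map_injective
    (congrArg (fun t => DerivedCategory.Plus.ι.map t) h)

instance : (sgl A).Full where
  map_surjective f := by
    obtain ⟨g, hg⟩ := (DerivedCategory.singleFunctor A 0).map_surjective f.hom
    exact ⟨g, DerivedCategory.Plus.ι.map_injective hg⟩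

instance (k : Type*) [Ring k] [Linear k A] : (sgl A).Linear k where
  map_smul f r := by
    apply DerivedCategory.Plus.ι.map_injective
    exact (DerivedCategory.singleFunctor A 0).map_smul r f

/-- The triangle exists in the unbounded derived category; full faithfulness of `ι` brings its third
morphism back. -/
lemma exists_distinguished_of_shortExact {S : ShortComplex A} (hS : S.ShortExact) :
    ∃ h, Triangle.mk ((sgl A).map S.f) ((sgl A).map S.g) h ∈ distinguishedTriangles := by
  have hι : ∃ h : (sgl A).obj S.X₃ ⟶ ((sgl A).obj S.X₁)⟦(1 : ℤ)⟧,
      DerivedCategory.Plus.ι.map h ≫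
        (DerivedCategory.Plus.ι.commShiftIso (1 : ℤ)).hom.app ((sgl A).obj S.X₁) =
      hS.singleTriangle.mor₃ :=
    ⟨DerivedCategory.Plus.ι.preimage (X := (sgl A).obj S.X₃) (hS.singleTriangle.mor₃ ≫
      (DerivedCategory.Plus.ι.commShiftIso (1 : ℤ)).inv.app ((sgl A).obj S.X₁)),
      (Iso.eq_comp_inv ((DerivedCategory.Plus.ι.commShiftIso (1 : ℤ)).app ((sgl A).obj S.X₁))).1
        (DerivedCategory.Plus.ι.map_preimage _)⟩
  obtain ⟨h, hh⟩ := hι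
  exact ⟨h, isomorphic_distinguished _ hS.singleTriangle_distinguished _
    (Triangle.isoMk _ _ (Iso.refl _) (Iso.refl _) (Iso.refl _)
      ((Category.comp_id _).trans (Category.id_comp _).symm)
      ((Category.comp_id _).trans (Category.id_comp _).symm)
      ((congrArg (fun t => _ ≫ t) ((shiftFunctor (DerivedCategory A) (1 : ℤ)).map_id _)).trans
        ((Category.comp_id _).trans (hh.trans (Category.id_comp _).symm))))⟩

lemma single_shift_hom_eq_zero {F I : A} [Injective I] (f : (sgl A).obj F ⟶ ((sgl A).obj I)⟦(1 : ℤ)⟧) :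
    f = 0 := by
  have := hasExt_of_hasDerivedCategory A
  apply DerivedCategory.Plus.ι.map_injective
  have h : ∀ g : ShiftedHom ((DerivedCategory.singleFunctor A 0).obj F)
      ((DerivedCategory.singleFunctor A 0).obj I) ((1 : ℕ) : ℤ), g = 0 := by
    intro g
    obtain ⟨e, rfl⟩ := Abelian.Ext.homEquiv.surjective g
    rw [Abelian.Ext.eq_zero_of_injective e]
    exact Abelian.Ext.zero_hom ..
  have h₁ := h (DerivedCategory.Plus.ι.map f ≫
    (DerivedCategory.Plus.ι.commShiftIso (1 : ℤ)).hom.app ((sgl A).obj I))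
  let e := (DerivedCategory.Plus.ι.commShiftIso (1 : ℤ)).app ((sgl A).obj I)
  exact ((Iso.eq_comp_inv e).2 h₁).trans zero_comp

lemma nonempty_homology_single_iso (F : A) :
    Nonempty ((DerivedCategory.Plus.homologyFunctor A 0).obj ((sgl A).obj F) ≅ F) :=
  ⟨(DerivedCategory.singleFunctorCompHomologyFunctorIso A 0).app F⟩

lemma isZero_homology_single (F : A) (n : ℤ) (hn : n ≠ 0) :
    IsZero ((DerivedCategory.Plus.homologyFunctor A n).obj ((sgl A).obj F)) := by
  rcases hn.lt_or_gt with h | h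
  · exact DerivedCategory.Plus.isZero_homology_of_isGE _ 0 n h
  · exact DerivedCategory.Plus.isZero_homology_of_isLE _ 0 n h

lemma isLE_of_isZero_homology (K : DerivedCategory.Plus A) (n : ℤ)
    (h : ∀ m, n < m → IsZero ((DerivedCategory.Plus.homologyFunctor A m).obj K)) : K.IsLE n := by
  rw [← DerivedCategory.Plus.isLE_ι_obj_iff, DerivedCategory.isLE_iff]
  exact h

end SingleFunctor

/-! ### Derived right adjoints of a single object -/

section RightAdjoint

open Pretriangulated

universe v₁ v₂ u₁ u₂ w₁ w₂

variable {A : Type u₁} [Category.{v₁} A] [Abelian A] {B : Type u₂} [Category.{v₂} B] [Abelian B]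
  [HasDerivedCategory.{w₁} A] [HasDerivedCategory.{w₂} B] {L : A ⥤ B} {R : B ⥤ A} [L.Additive]
  [R.Additive] [PreservesFiniteLimits L] [PreservesFiniteColimits L]

lemma injCounit_naturality (adj : L ⊣ R) {J J' : CochainComplex B ℤ} (φ : J ⟶ J') (n : ℤ)
    (hJ : J.IsStrictlyGE n) (hJ' : J'.IsStrictlyGE n) :
    (mapDPlus L).map (ObjectProperty.homMk (DerivedCategory.Q.map
      ((R.mapHomologicalComplex _).map φ)) :
        plusOf _ n (isStrictlyGE_map (R := R) J n hJ) ⟶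
          plusOf _ n (isStrictlyGE_map (R := R) J' n hJ')) ≫ injCounit adj J' n hJ' =
      injCounit adj J n hJ ≫ (ObjectProperty.homMk (DerivedCategory.Q.map φ)) := by
  apply DerivedCategory.Plus.ι.map_injective
  have h₁ := L.mapDerivedCategoryFactors.hom.naturality ((R.mapHomologicalComplex _).map φ)
  have h₂ := congrArg (fun t => DerivedCategory.Q.map t) ((complexAdj adj).counit.naturality φ)
  change L.mapDerivedCategory.map (DerivedCategory.Q.map _) ≫
    L.mapDerivedCategoryFactors.hom.app _ ≫ DerivedCategory.Q.map ((complexAdj adj).counit.app J') =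
    (L.mapDerivedCategoryFactors.hom.app _ ≫
      DerivedCategory.Q.map ((complexAdj adj).counit.app J)) ≫ DerivedCategory.Q.map φ
  refine (Category.assoc _ _ _).symm.trans ((congrArg (fun t => t ≫ _) h₁).trans ?_)
  refine (Category.assoc _ _ _).trans (Eq.trans ?_ (Category.assoc _ _ _).symm)
  refine congrArg (fun t => L.mapDerivedCategoryFactors.hom.app _ ≫ t) ?_
  rw [← Functor.map_comp]
  exact ((DerivedCategory.Q.map_comp _ _).symm.trans h₂)

variable {G : DerivedCategory.Plus B ⥤ DerivedCategory.Plus A}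

/-- On injective objects, a right adjoint of a derived exact functor is computed by the right
adjoint of the exact functor. -/
lemma exists_rightAdjoint_single_iso (adj' : mapDPlus L ⊣ G) (adj : L ⊣ R) {I I' : B}
    [Injective I] [Injective I'] (g : I ⟶ I') :
    ∃ (θ : G.obj ((sgl B).obj I) ≅ (sgl A).obj (R.obj I))
      (θ' : G.obj ((sgl B).obj I') ≅ (sgl A).obj (R.obj I')),
      G.map ((sgl B).map g) ≫ θ'.hom = θ.hom ≫ (sgl A).map (R.map g) := by
  let J (I : B) : CochainComplex B ℤ := (HomologicalComplex.single B (ComplexShape.up ℤ) 0).obj I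
  have hJ (I : B) : (J I).IsStrictlyGE 0 :=
    inferInstanceAs (CochainComplex.IsStrictlyGE ((CochainComplex.singleFunctor B 0).obj I) 0)
  have hinj (I : B) [Injective I] (m : ℤ) : Injective ((J I).X m) := by
    by_cases hm : m = 0
    · subst hm
      exact Injective.of_iso (HomologicalComplex.singleObjXSelf (ComplexShape.up ℤ) 0 I).symm ‹_›
    · exact Injective.of_iso (HomologicalComplex.isZero_single_obj_X _ _ _ _ hm).isoZero.symm
        inferInstance
  obtain ⟨θ, hθ⟩ := exists_rightAdjoint_iso adj' adj (J I) 0 (hJ I) (hinj I)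
  obtain ⟨θ', hθ'⟩ := exists_rightAdjoint_iso adj' adj (J I') 0 (hJ I') (hinj I')
  let φ : J I ⟶ J I' := (HomologicalComplex.single B (ComplexShape.up ℤ) 0).map g
  let e (I : B) : plusOf _ 0 (isStrictlyGE_map (R := R) (J I) 0 (hJ I)) ≅ (sgl A).obj (R.obj I) :=
    ObjectProperty.isoMk _ (DerivedCategory.Q.mapIso
      ((HomologicalComplex.singleMapHomologicalComplex R (ComplexShape.up ℤ) 0).app I))
  have h₁ : G.map (ObjectProperty.homMk (DerivedCategory.Q.map φ) :
      plusOf (J I) 0 (hJ I) ⟶ plusOf (J I') 0 (hJ I')) ≫ θ'.hom = θ.hom ≫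
        (ObjectProperty.homMk (DerivedCategory.Q.map ((R.mapHomologicalComplex _).map φ))) := by
    apply (bijective_map_comp_injCounit adj (J I') 0 (hJ I') (hinj I') _).1
    dsimp only
    rw [Functor.map_comp, Functor.map_comp, Category.assoc, Category.assoc, hθ',
      injCounit_naturality, reassoc_of% hθ]
    exact adj'.counit.naturality _
  refine ⟨θ ≪≫ e I, θ' ≪≫ e I', ?_⟩
  have h₂ : (ObjectProperty.homMk (DerivedCategory.Q.map ((R.mapHomologicalComplex _).map φ))) ≫
      (e I').hom = (e I).hom ≫ (sgl A).map (R.map g) := by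
    apply DerivedCategory.Plus.ι.map_injective
    exact ((DerivedCategory.Q.map_comp _ _).symm.trans (congrArg (fun t => DerivedCategory.Q.map t)
      ((HomologicalComplex.singleMapHomologicalComplex R (ComplexShape.up ℤ) 0).hom.naturality
        g))).trans (DerivedCategory.Q.map_comp _ _)
  exact (Category.assoc _ _ _).symm.trans ((congrArg (fun t => t ≫ (e I').hom) h₁).trans
    ((Category.assoc _ _ _).trans ((congrArg (fun t => θ.hom ≫ t) h₂).trans
      (Category.assoc _ _ _).symm)))

/-- A right adjoint of a derived exact functor at an object with a short injective resolution
which remains exact after applying the right adjoint of the exact functor. -/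
lemma nonempty_rightAdjoint_single_iso [G.CommShift ℤ] [G.IsTriangulated]
    (adj' : mapDPlus L ⊣ G) (adj : L ⊣ R) {S : ShortComplex B} (hS : S.ShortExact)
    [Injective S.X₂] [Injective S.X₃] (hRS : (S.map R).ShortExact) :
    Nonempty (G.obj ((sgl B).obj S.X₁) ≅ (sgl A).obj (R.obj S.X₁)) := by
  obtain ⟨θ, θ', hθ⟩ := exists_rightAdjoint_single_iso adj' adj S.g
  obtain ⟨h, hT⟩ := exists_distinguished_of_shortExact hS
  obtain ⟨h', hT'⟩ := exists_distinguished_of_shortExact hRS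
  -- The derived image of the resolution triangle is compared with the triangle of the image
  -- sequence. The two injective terms are matched by isomorphisms, so the third comparison is one
  -- too.
  obtain ⟨a, ha₁, ha₂⟩ := complete_distinguished_triangle_morphism₁ _ _
    (G.map_distinguished _ hT) hT' θ.hom θ'.hom hθ
  let φ : G.mapTriangle.obj (Triangle.mk ((sgl B).map S.f) ((sgl B).map S.g) h) ⟶
      Triangle.mk ((sgl A).map (S.map R).f) ((sgl A).map (S.map R).g) h' :=
    ⟨a, θ.hom, θ'.hom, ha₁, hθ, ha₂⟩
  have := isIso₁_of_isIso₂₃ φ (G.map_distinguished _ hT) hT' (inferInstanceAs (IsIso θ.hom))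
    (inferInstanceAs (IsIso θ'.hom))
  exact ⟨@asIso _ _ _ _ a this⟩

end RightAdjoint

/-! ### First cohomology from the resolution by functions -/

section Cohomology

open Pretriangulated

variable (k : Type u) [Field k] (Y : TopCat.{u})

variable {Y} in
lemma onSec_secEquiv_symm (F : Sh k Y) (s : Sec F ⊤) :
    onSec (((constAdj k Y).homEquiv _ _).symm
      (ModuleCat.ofHom (LinearMap.toSpanSingleton k _ s)) :
        constSh k Y (ModuleCat.of k k) ⟶ F) ⊤ (oneSec k Y) = s := by
  have h := (constAdj k Y).homEquiv_unit (f := ((constAdj k Y).homEquiv _ F).symm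
    (ModuleCat.ofHom (LinearMap.toSpanSingleton k _ s)))
  replace h := ((Equiv.apply_symm_apply _ _).symm.trans h).symm
  exact (congrArg (fun t => t.hom (1 : k)) h).trans (one_smul k s)

variable {Y} in
lemma hom_constSh_ext {F : Sh k Y} {φ ψ : constSh k Y (ModuleCat.of k k) ⟶ F}
    (h : onSec φ ⊤ (oneSec k Y) = onSec ψ ⊤ (oneSec k Y)) : φ = ψ := by
  apply ((constAdj k Y).homEquiv _ _).injective
  refine ((constAdj k Y).homEquiv_unit (f := φ)).trans
    (Eq.trans ?_ ((constAdj k Y).homEquiv_unit (f := ψ)).symm)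
  apply ModuleCat.hom_ext
  exact LinearMap.ext_ring h

variable {Y} in
/-- Morphisms from the constant sheaf are global sections. -/
def homConstEquiv (F : Sh k Y) : (constSh k Y (ModuleCat.of k k) ⟶ F) ≃ₗ[k] Sec F ⊤ :=
  { toFun := fun φ => onSec φ ⊤ (oneSec k Y)
    invFun := fun s => ((constAdj k Y).homEquiv _ _).symm
      (ModuleCat.ofHom (LinearMap.toSpanSingleton k _ s))
    map_add' := fun _ _ => rfl
    map_smul' := fun _ _ => rfl
    left_inv := fun _ => hom_constSh_ext k (onSec_secEquiv_symm k F _)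
    right_inv := onSec_secEquiv_symm k F }

lemma onSec_secHom (s : ΓConst k Y) : onSec (secHom k Y s) ⊤ (oneSec k Y) = s :=
  onSec_secEquiv_symm k _ s

/-- The resolution of the constant sheaf by functions, as a distinguished triangle. -/
lemma exists_fnTriangle : ∃ h : (sgl _).obj (quotSh k Y) ⟶ (one k Y)⟦(1 : ℤ)⟧,
    Triangle.mk ((sgl _).map (constToFn k Y)) ((sgl _).map (toQuot k Y)) h ∈
      distinguishedTriangles :=
  exists_distinguished_of_shortExact (fnSeq_shortExact k Y)

/-- The connecting morphism of the resolution of the constant sheaf. -/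
def fnConn : (sgl _).obj (quotSh k Y) ⟶ (one k Y)⟦(1 : ℤ)⟧ := (exists_fnTriangle k Y).choose

lemma fnTriangle_distinguished :
    Triangle.mk ((sgl _).map (constToFn k Y)) ((sgl _).map (toQuot k Y)) (fnConn k Y) ∈
      distinguishedTriangles :=
  (exists_fnTriangle k Y).choose_spec

/-- The class in `H¹` of a section of the sheaf of functions modulo locally constant functions. -/
def classOfSec : Sec (quotSh k Y) ⊤ →ₗ[k] H k (one k Y) 1 where
  toFun s := (sgl _).map ((homConstEquiv k _).symm s) ≫ fnConn k Y
  map_add' s t := by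
    rw [map_add, Functor.map_add]
    exact Preadditive.add_comp _ _ _ _ _ _
  map_smul' c s := by
    rw [map_smul, Functor.map_smul]
    exact Linear.smul_comp _ _ _ _ _ _

/-- The sheaf of functions is injective, so its H¹ vanishes and the connecting map is onto. -/
lemma classOfSec_surjective : Function.Surjective (classOfSec k Y) := by
  intro c
  obtain ⟨g, hg⟩ := Triangle.coyoneda_exact₁ _ (fnTriangle_distinguished k Y) c
    (single_shift_hom_eq_zero _)
  obtain ⟨φ, rfl⟩ := (sgl _).map_surjective g
  refine ⟨homConstEquiv k _ φ, ?_⟩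
  refine Eq.trans ?_ hg.symm
  exact congrArg (fun t => (sgl _).map t ≫ fnConn k Y) ((homConstEquiv k _).symm_apply_apply φ)

variable {Y} in
lemma classOfSec_eq_zero_iff (s : Sec (quotSh k Y) ⊤) :
    classOfSec k Y s = 0 ↔ ∃ f, onSec (toQuot k Y) ⊤ f = s := by
  constructor
  · intro h
    obtain ⟨g, hg⟩ := Triangle.coyoneda_exact₃ _ (fnTriangle_distinguished k Y) _ h
    obtain ⟨φ, rfl⟩ := (sgl _).map_surjective g
    refine ⟨homConstEquiv k _ φ, ?_⟩
    have h2 : (homConstEquiv k _).symm s = φ ≫ toQuot k Y :=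
      (sgl _).map_injective (hg.trans ((sgl _).map_comp _ _).symm)
    exact ((LinearEquiv.symm_apply_eq _).1 h2).symm
  · rintro ⟨f, rfl⟩
    have h : (homConstEquiv k _).symm (onSec (toQuot k Y) ⊤ f) =
        (homConstEquiv k _).symm f ≫ toQuot k Y :=
      (LinearEquiv.symm_apply_eq _).2
        (congrArg (onSec (toQuot k Y) ⊤) ((homConstEquiv k _).apply_symm_apply f)).symm
    change (sgl _).map _ ≫ fnConn k Y = 0
    rw [h, Functor.map_comp, Category.assoc]
    exact (congrArg (fun t => _ ≫ t)
      (comp_distTriang_mor_zero₂₃ _ (fnTriangle_distinguished k Y))).trans comp_zero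

/-- If functions modulo locally constant functions lift to functions, then `H¹` vanishes. -/
lemma subsingleton_H_one_one (h : Function.Surjective (onSec (toQuot k Y) ⊤)) :
    Subsingleton (H k (one k Y) 1) := by
  refine subsingleton_of_forall_eq 0 fun c => ?_
  obtain ⟨s, rfl⟩ := classOfSec_surjective k Y c
  exact (classOfSec_eq_zero_iff k s).2 (h s)

/-- Endomorphisms of `k_Y` are global sections. -/
lemma exists_secHom (f : one k Y ⟶ one k Y) :
    ∃ s, (sgl _).map (secHom k Y s) = f := by
  obtain ⟨φ, rfl⟩ := (sgl _).map_surjective f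
  exact ⟨onSec φ ⊤ (oneSec k Y), congrArg _ (hom_constSh_ext k (onSec_secHom k Y _))⟩

end Cohomology

/-! ### The first cohomology of the circle -/

section Circle

lemma isLocallyConstant_of_le_sup {k : Type u} {Y : TopCat.{u}} {V V₁ V₂ : Opens Y}
    (hV : V ≤ V₁ ⊔ V₂) (f : V → k) (c₁ c₂ : k) (h₁ : ∀ x : V, x.1 ∈ V₁ → f x = c₁)
    (h₂ : ∀ x : V, x.1 ∈ V₂ → f x = c₂) : IsLocallyConstant f := by
  refine isLocallyConstant_of_local k fun x hx => ?_
  rcases hV hx with h | h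
  · exact ⟨V ⊓ V₁, inf_le_left, ⟨hx, h⟩, c₁, fun y hy => h₁ ⟨y, hy.1⟩ hy.2⟩
  · exact ⟨V ⊓ V₂, inf_le_left, ⟨hx, h⟩, c₂, fun y hy => h₂ ⟨y, hy.1⟩ hy.2⟩

variable (k : Type u) [Field k]

lemma smul_onSec_toQuot {Y : TopCat.{u}} {V : Opens Y} (c : k) (f : V → k) :
    c • onSec (toQuot k Y) V f = onSec (toQuot k Y) V (fun x => c * f x) :=
  (map_smul (onSec (toQuot k Y) V) c f).symm

lemma onSec_toQuot_sub {Y : TopCat.{u}} {V : Opens Y} (f g : V → k) :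
    onSec (toQuot k Y) V f - onSec (toQuot k Y) V g = onSec (toQuot k Y) V (fun x => f x - g x) :=
  (map_sub (onSec (toQuot k Y) V) f g).symm

/-- An endomorphism of k_Y is a global section, that is, a locally constant function, and Y is
connected. -/
lemma exists_eq_smul_id {Y : TopCat.{u}} [PreconnectedSpace Y] (y : Y) (f : one k Y ⟶ one k Y) :
    ∃ c : k, f = c • 𝟙 _ := by
  obtain ⟨φ, rfl⟩ := (sgl _).map_surjective f
  let g := onSec (constToFn k Y) ⊤ (onSec φ ⊤ (oneSec k Y))
  have hg : IsLocallyConstant (g : (⊤ : Opens Y) → k) :=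
    (exists_onSec_constToFn_eq_iff k _).1 ⟨_, rfl⟩
  refine ⟨g ⟨y, trivial⟩, ?_⟩
  have h : φ = g ⟨y, trivial⟩ • 𝟙 _ := by
    refine hom_constSh_ext k (onSec_constToFn_injective k ⊤ ?_)
    funext x
    refine (eq_of_isPreconnected k hg isPreconnected_univ (fun _ _ => trivial)
      (Set.mem_univ x.1) (Set.mem_univ y)).trans ?_
    have h1 := congrFun (onSec_constToFn_unitSec k (⊤ : Opens Y) (g ⟨y, trivial⟩)) x
    rw [unitSec, res_self] at h1
    exact h1.symm
  exact (congrArg (fun t => (sgl _).map t) h).trans (((sgl _).map_smul _ _).trans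
    (congrArg (fun t => g ⟨y, trivial⟩ • t) ((sgl _).map_id _)))

open Classical in
/-- The indicator function of an open subset. -/
def indFn {Y : TopCat.{u}} (V₁ V : Opens Y) : V → k := fun x => if x.1 ∈ V₁ then 1 else 0

/-- The first cohomology of the circle is a line. -/
lemma nonempty_H_one_S1_equiv {p q : S1.{u}} (hpq : p ≠ q) :
    Nonempty (H k (one k S1.{u}) 1 ≃ₗ[k] k) := by
  obtain ⟨V₁, V₂, hV, hd, hc₁, hc₂, -⟩ := exists_two_arcs hpq
  have hd' : ∀ x, x ∈ V₁ → x ∉ V₂ := fun x h₁ h₂ => (hd.le_bot ⟨h₁, h₂⟩ : x ∈ (⊥ : Opens S1))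
  have hle₁ : V₁ ≤ compl p ⊓ compl q := hV ▸ le_sup_left
  have hle₂ : V₂ ≤ compl p ⊓ compl q := hV ▸ le_sup_right
  obtain ⟨x₁, hx₁⟩ := hc₁.nonempty
  obtain ⟨x₂, hx₂⟩ := hc₂.nonempty
  have hcov : ∀ x, x ∈ compl p ∨ x ∈ compl q := fun x => by
    by_cases h : x = p
    · exact Or.inr fun h' => hpq (h.symm.trans h')
    · exact Or.inl h
  -- The Mayer–Vietoris generator: 0 off p and the indicator of V₁ off q differ on the overlap by a
  -- locally constant function, so they glue in the quotient sheaf.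
  obtain ⟨s₀, hp₀, hq₀⟩ : ∃ s₀ : Sec (quotSh k S1.{u}) ⊤,
      res _ le_top s₀ = onSec (toQuot k S1.{u}) (compl p) (0 : compl p → k) ∧
      res _ le_top s₀ = onSec (toQuot k S1.{u}) (compl q) (indFn k V₁ (compl q)) := by
    let U : Bool → Opens S1.{u} := fun b => if b then compl p else compl q
    let s : ∀ b, Sec (quotSh k S1.{u}) (U b) := fun b => match b with
      | true => onSec (toQuot k S1.{u}) (compl p) (0 : compl p → k)
      | false => onSec (toQuot k S1.{u}) (compl q) (indFn k V₁ (compl q))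
    have key : res (quotSh k S1.{u}) (inf_le_left : compl p ⊓ compl q ≤ _) (s true) =
        res _ inf_le_right (s false) := by
      refine (res_toQuot k _ _).trans (Eq.trans ?_ (res_toQuot k _ _).symm)
      rw [onSec_toQuot_eq_iff]
      refine isLocallyConstant_of_le_sup hV.ge _ (-1) 0 (fun x hx => ?_) fun x hx => ?_
      · simp [indFn, hx]
      · simpa [indFn] using fun h => hd' _ h hx
    obtain ⟨t, ht⟩ := exists_glue (quotSh k S1.{u}) U ⊤ (fun _ => le_top) (fun x _ => by
      rcases hcov x with h | h
      · exact Opens.mem_iSup.2 ⟨true, h⟩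
      · exact Opens.mem_iSup.2 ⟨false, h⟩) s (by
      rintro (_ | _) (_ | _)
      · rfl
      · have := congrArg (res (quotSh k S1.{u})
          (le_of_eq (inf_comm _ _) : compl q ⊓ compl p ≤ compl p ⊓ compl q)) key
        rw [res_res, res_res] at this
        exact this.symm
      · exact key
      · rfl)
    exact ⟨t, ht true, ht false⟩
  -- If f lifts t • s₀, then f is constant off p while f minus t times the indicator is constant off
  -- q. Comparing x₁ in V₁ with x₂ in V₂ gives t = 0.
  have hinj : ∀ t : k, t • classOfSec k S1.{u} s₀ = 0 → t = 0 := by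
    intro t ht
    rw [← map_smul, classOfSec_eq_zero_iff] at ht
    obtain ⟨f, hf⟩ := ht
    have hfp := congrArg (res (quotSh k S1.{u}) (le_top : compl p ≤ ⊤)) hf
    have hfq := congrArg (res (quotSh k S1.{u}) (le_top : compl q ≤ ⊤)) hf
    rw [map_smul, hp₀] at hfp
    rw [map_smul, hq₀] at hfq
    replace hfp := (onSec_toQuot_eq_iff k _ _).1 (((res_toQuot k (le_top : compl p ≤ ⊤) f).symm.trans
      hfp).trans (smul_onSec_toQuot k t _))
    replace hfq := (onSec_toQuot_eq_iff k _ _).1 (((res_toQuot k (le_top : compl q ≤ ⊤) f).symm.trans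
      hfq).trans (smul_onSec_toQuot k t _))
    have e₁ := eq_of_isPreconnected k hfp (isPreconnected_compl p) (fun _ h => h)
      (hle₁ hx₁).1 (hle₂ hx₂).1
    have e₂ := eq_of_isPreconnected k hfq (isPreconnected_compl q) (fun _ h => h)
      (hle₁ hx₁).2 (hle₂ hx₂).2
    have i₁ : indFn k V₁ (compl q) ⟨x₁, (hle₁ hx₁).2⟩ = 1 := if_pos hx₁
    have i₂ : indFn k V₁ (compl q) ⟨x₂, (hle₂ hx₂).2⟩ = 0 := if_neg fun h => hd' _ h hx₂
    change f ⟨x₁, trivial⟩ - t * 0 = f ⟨x₂, trivial⟩ - t * 0 at e₁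
    change f ⟨x₁, trivial⟩ - t * indFn k V₁ (compl q) ⟨x₁, _⟩ =
      f ⟨x₂, trivial⟩ - t * indFn k V₁ (compl q) ⟨x₂, _⟩ at e₂
    rw [i₁, i₂] at e₂
    linear_combination e₁ - e₂
  have hsurj : ∀ c : H k (one k S1.{u}) 1, ∃ t : k, t • classOfSec k S1.{u} s₀ = c := by
    intro c
    obtain ⟨s, rfl⟩ := classOfSec_surjective k S1.{u} c
    obtain ⟨g, hg⟩ := toQuot_surjective_of_notMem k (V := compl p) (p := p) (fun h => h rfl)
      (res _ le_top s)
    obtain ⟨h, hh⟩ := toQuot_surjective_of_notMem k (V := compl q) (p := q) (fun h => h rfl)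
      (res _ le_top s)
    have hgh : IsLocallyConstant (fun x : (compl p ⊓ compl q : Opens S1.{u}) =>
        h ⟨x.1, x.2.2⟩ - g ⟨x.1, x.2.1⟩) := by
      refine (onSec_toQuot_eq_iff k (V := compl p ⊓ compl q) (fun x => h ⟨x.1, x.2.2⟩)
        (fun x => g ⟨x.1, x.2.1⟩)).1 ?_
      refine (res_toQuot k (inf_le_right : compl p ⊓ compl q ≤ _) h).symm.trans (Eq.trans ?_
        (res_toQuot k (inf_le_left : compl p ⊓ compl q ≤ _) g))
      rw [hg, hh, res_res, res_res]
    let d : ∀ x, x ∈ compl p ⊓ compl q → k := fun x hx => h ⟨x, hx.2⟩ - g ⟨x, hx.1⟩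
    have hd₁ : ∀ x (hx : x ∈ V₁), d x (hle₁ hx) = d x₁ (hle₁ hx₁) := fun x hx =>
      eq_of_isPreconnected k hgh hc₁.isPreconnected (fun _ h => hle₁ h) hx hx₁
    have hd₂ : ∀ x (hx : x ∈ V₂), d x (hle₂ hx) = d x₂ (hle₂ hx₂) := fun x hx =>
      eq_of_isPreconnected k hgh hc₂.isPreconnected (fun _ h => hle₂ h) hx hx₂
    set c₁ := d x₁ (hle₁ hx₁)
    set c₂ := d x₂ (hle₂ hx₂)
    -- The lifts g off p and h off q differ by c₁ on V₁ and c₂ on V₂; only the jump c₁ - c₂ matters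
    -- for the class.
    refine ⟨c₁ - c₂, ?_⟩
    rw [← sub_eq_zero, ← map_smul, ← map_sub, classOfSec_eq_zero_iff]
    classical
    -- The value at p is chosen so that f minus the lift of (c₁ - c₂) • s₀ - s off q equals c₂ there
    -- too.
    let f : (⊤ : Opens S1.{u}) → k := fun x =>
      if hx : x.1 ∈ compl p then - g ⟨x.1, hx⟩ else c₂ - h ⟨p, hpq⟩
    have hfp : res (quotSh k S1.{u}) (le_top : compl p ≤ ⊤) (onSec (toQuot k S1.{u}) ⊤ f) =
        res _ le_top ((c₁ - c₂) • s₀ - s) := by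
      rw [map_sub, map_smul, hp₀, ← hg]
      refine (res_toQuot k (le_top : compl p ≤ ⊤) f).trans (Eq.trans ?_
        ((congrArg (fun t => t - _) (smul_onSec_toQuot k (c₁ - c₂) _)).trans
          (onSec_toQuot_sub k _ _)).symm)
      refine congrArg _ (funext fun x => ?_)
      refine (dif_pos x.2).trans ?_
      change - g x = (c₁ - c₂) * 0 - g x
      ring
    have hfq : res (quotSh k S1.{u}) (le_top : compl q ≤ ⊤) (onSec (toQuot k S1.{u}) ⊤ f) =
        res _ le_top ((c₁ - c₂) • s₀ - s) := by
      rw [map_sub, map_smul, hq₀, ← hh]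
      refine (res_toQuot k (le_top : compl q ≤ ⊤) f).trans (Eq.trans ?_
        ((congrArg (fun t => t - _) (smul_onSec_toQuot k (c₁ - c₂) _)).trans
          (onSec_toQuot_sub k _ _)).symm)
      refine (onSec_toQuot_eq_iff k _ _).2 ?_
      suffices (fun x : compl q => f ⟨x.1, trivial⟩ -
          ((c₁ - c₂) * indFn k V₁ (compl q) x - h x)) = fun _ => c₂ by
        exact (congrArg IsLocallyConstant this).mpr (IsLocallyConstant.const c₂)
      funext x
      by_cases hx : x.1 ∈ compl p
      · have e₁ : f ⟨x.1, trivial⟩ = - g ⟨x.1, hx⟩ := dif_pos hx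
        have hx' : x.1 ∈ V₁ ⊔ V₂ := hV ▸ ⟨hx, x.2⟩
        rcases hx' with hx' | hx'
        · have e₂ : indFn k V₁ (compl q) x = 1 := if_pos hx'
          have e₃ : h x - g ⟨x.1, hx⟩ = c₁ := hd₁ x.1 hx'
          rw [e₁, e₂]
          linear_combination e₃
        · have e₂ : indFn k V₁ (compl q) x = 0 := if_neg fun h => hd' _ h hx'
          have e₃ : h x - g ⟨x.1, hx⟩ = c₂ := hd₂ x.1 hx'
          rw [e₁, e₂]
          linear_combination e₃
      · have e₁ : f ⟨x.1, trivial⟩ = c₂ - h ⟨p, hpq⟩ := dif_neg hx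
        have e₂ : indFn k V₁ (compl q) x = 0 := if_neg fun h => hx (hle₁ h).1
        have e₃ : x = ⟨p, hpq⟩ := Subtype.ext (not_not.1 hx)
        rw [e₁, e₂, e₃]
        ring
    refine ⟨f, sec_ext _ fun x _ => ?_⟩
    rcases hcov x with hx | hx
    · exact ⟨compl p, le_top, hx, hfp⟩
    · exact ⟨compl q, le_top, hx, hfq⟩
  exact ⟨(LinearEquiv.ofBijective (LinearMap.toSpanSingleton k _ (classOfSec k S1.{u} s₀))
    ⟨(injective_iff_map_eq_zero _).2 hinj, hsurj⟩).symm⟩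

end Circle

/-! ### Boundedness and constructibility -/

section Constructible

open Pretriangulated ZeroObject

variable (k : Type u) [Field k] {X Y : TopCat.{u}}

lemma finite_of_iso {M N : ModuleCat.{u} k} (e : M ≅ N) (h : Module.Finite k M) :
    Module.Finite k N :=
  Module.Finite.equiv e.toLinearEquiv

/-- A stalk is finite-dimensional if all sections are locally combinations of given ones. -/
lemma finite_stalk_of_span (F : Sh k Y) (y : Y) {ι : Type} [Fintype ι] (t : ι → Sec F ⊤)
    (h : ∀ V (s : Sec F V), y ∈ V → ∃ W, ∃ hW : W ≤ V, y ∈ W ∧ ∃ c : ι → k,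
      res F hW s = ∑ i, c i • res F le_top (t i)) :
    Module.Finite k ((stalkF k y).obj F) := by
  let g (V : Opens Y) (hV : y ∈ V) : Sec F V →ₗ[k] (stalkF k y).obj F :=
    (F.presheaf.germ V y hV).hom
  have hg : ∀ {V W : Opens Y} (hW : W ≤ V) (hy : y ∈ W) (s : Sec F V),
      g W hy (res F hW s) = g V (hW hy) s := fun hW hy s =>
    F.presheaf.germ_res_apply (homOfLE hW) y hy s
  refine Module.Finite.of_surjective (Fintype.linearCombination k fun i => g ⊤ trivial (t i)) ?_
  intro s
  obtain ⟨V, hV, s, rfl⟩ := F.presheaf.exists_germ_eq s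
  obtain ⟨W, hW, hy, c, hc⟩ := h V s hV
  refine ⟨c, ?_⟩
  rw [Fintype.linearCombination_apply]
  refine Eq.trans ?_ (hg hW hy s)
  rw [hc, map_sum]
  refine Finset.sum_congr rfl fun i _ => ?_
  rw [map_smul, hg]

lemma isConstructible_constSh (Y : TopCat.{u}) :
    IsConstructible k (constSh k Y (ModuleCat.of k k)) := by
  refine ⟨fun y => finite_stalk_of_span k _ y (fun _ : Unit => oneSec k Y) fun V s hy => ?_, ∅,
    isClosed_empty, inferInstance, fun x _ => ⟨Set.univ, isOpen_univ, trivial, ModuleCat.of k k,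
      ⟨pullbackConstIso k _ _⟩⟩⟩
  obtain ⟨W, hW, hy', c, hc⟩ := exists_local_const k Y s hy
  exact ⟨W, hW, hy', fun _ => c, by simpa using hc⟩

lemma isZero_constSh_zero (Y : TopCat.{u}) : IsZero (constSh k Y 0) := by
  have : (constantSheaf (Opens.grothendieckTopology Y) (ModuleCat.{u} k)).IsLeftAdjoint :=
    (constAdj k Y).isLeftAdjoint
  have := Functor.preservesZeroMorphisms_of_isLeftAdjoint
    (constantSheaf (Opens.grothendieckTopology Y) (ModuleCat.{u} k))
  exact (constantSheaf (Opens.grothendieckTopology Y) (ModuleCat.{u} k)).map_isZero (isZero_zero _)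

/-- A sheaf with finite-dimensional stalks vanishing off a closed discrete set is constructible. -/
lemma isConstructible_of_isZero_pullback {F : Sh k Y} {Z : Set Y} (hZ : IsClosed Z)
    [DiscreteTopology Z] (hF : ∀ y, Module.Finite k ((stalkF k y).obj F))
    (h : IsZero ((TopCat.Sheaf.pullback (ModuleCat.{u} k) (incl Zᶜ)).obj F)) :
    IsConstructible k F :=
  ⟨hF, Z, hZ, inferInstance, fun _ hx => ⟨Zᶜ, hZ.isOpen_compl, hx, 0,
    ⟨h.iso (isZero_constSh_zero k _)⟩⟩⟩

lemma isConstructible_of_discreteTopology [DiscreteTopology Y] {F : Sh k Y}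
    (hF : ∀ y, Module.Finite k ((stalkF k y).obj F)) : IsConstructible k F :=
  ⟨hF, Set.univ, isClosed_univ, inferInstance, fun _ hx => (hx trivial).elim⟩

variable {k}

lemma IsConstructible.of_iso {F G : Sh k Y} (hF : IsConstructible k F) (e : F ≅ G) :
    IsConstructible k G := by
  obtain ⟨hf, S, hS, hd, h⟩ := hF
  refine ⟨fun y => finite_of_iso k ((stalkF k y).mapIso e) (hf y), S, hS, hd, fun x hx => ?_⟩
  obtain ⟨V, hV, hxV, M, ⟨i⟩⟩ := h x hx
  exact ⟨V, hV, hxV, M, ⟨(TopCat.Sheaf.pullback (ModuleCat.{u} k) (incl V)).mapIso e.symm ≪≫ i⟩⟩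

lemma finite_stalk_of_isZero {F : Sh k Y} (hF : IsZero F) (y : Y) :
    Module.Finite k ((stalkF k y).obj F) := by
  have := ModuleCat.subsingleton_of_isZero ((stalkF k y).map_isZero hF)
  infer_instance

lemma isConstructible_of_isZero {F : Sh k Y} (hF : IsZero F) : IsConstructible k F :=
  isConstructible_of_isZero_pullback k isClosed_empty (finite_stalk_of_isZero hF)
    (Functor.map_isZero _ hF)

lemma IsDbc.of_iso {K L : D k Y} (hK : IsDbc k K) (e : K ≅ L) : IsDbc k L := by
  obtain ⟨⟨n, hn⟩, h⟩ := hK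
  refine ⟨⟨n, isLE_of_isZero_homology _ _ fun m hm => ?_⟩, fun m =>
    (h m).of_iso ((DerivedCategory.Plus.homologyFunctor (Sh k Y) m).mapIso e)⟩
  exact (DerivedCategory.Plus.isZero_homology_of_isLE K n m hm).of_iso
    ((DerivedCategory.Plus.homologyFunctor (Sh k Y) m).mapIso e.symm)

lemma IsConstructible.isDbc {F : Sh k Y} (hF : IsConstructible k F) :
    IsDbc k ((sgl _).obj F) := by
  refine ⟨⟨0, inferInstance⟩, fun n => ?_⟩
  by_cases hn : n = 0
  · subst hn
    exact hF.of_iso (nonempty_homology_single_iso F).some.symm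
  · exact isConstructible_of_isZero (isZero_homology_single F n hn)

lemma isDbc_one (Y : TopCat.{u}) : IsDbc k (one k Y) := (isConstructible_constSh k Y).isDbc

/-- Finite-dimensionality of stalks in an exact sequence. -/
lemma finite_stalk_of_exact {S : ShortComplex (Sh k Y)} (hS : S.Exact) (y : Y)
    (h₁ : Module.Finite k ((stalkF k y).obj S.X₁)) (h₃ : Module.Finite k ((stalkF k y).obj S.X₃)) :
    Module.Finite k ((stalkF k y).obj S.X₂) := by
  have h := (TopCat.Sheaf.exact_iff_stalkFunctor_map_exact S).1 hS y
  rw [ShortComplex.moduleCat_exact_iff_range_eq_ker] at h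
  let f : (stalkF k y).obj S.X₁ →ₗ[k] (stalkF k y).obj S.X₂ := ((stalkF k y).map S.f).hom
  let g : (stalkF k y).obj S.X₂ →ₗ[k] (stalkF k y).obj S.X₃ := ((stalkF k y).map S.g).hom
  have h' : LinearMap.range f = LinearMap.ker g := h
  have : Module.Finite k (LinearMap.ker g) := h' ▸ inferInstance
  have : Module.Finite k ((stalkF k y).obj S.X₂ ⧸ LinearMap.ker g) :=
    Module.Finite.equiv g.quotKerEquivRange.symm
  exact Module.Finite.of_submodule_quotient (LinearMap.ker g)

/-- Finite-dimensionality and boundedness of the first term of a distinguished triangle. -/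
lemma finite_stalk_and_isZero_of_distinguished {T : Triangle (D k Y)}
    (hT : T ∈ distinguishedTriangles) (h₂ : IsDbc k T.obj₂) (h₃ : IsDbc k T.obj₃) :
    (∃ n : ℤ, T.obj₁.IsLE n) ∧ ∀ (n : ℤ) (y : Y), Module.Finite k
      ((stalkF k y).obj ((DerivedCategory.Plus.homologyFunctor (Sh k Y) n).obj T.obj₁)) := by
  have hex : ∀ n : ℤ, ∃ S : ShortComplex (Sh k Y), S.Exact ∧
      S.X₁ = (DerivedCategory.Plus.homologyFunctor (Sh k Y) (n - 1)).obj T.obj₃ ∧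
      S.X₂ = (DerivedCategory.Plus.homologyFunctor (Sh k Y) n).obj T.obj₁ ∧
      S.X₃ = (DerivedCategory.Plus.homologyFunctor (Sh k Y) n).obj T.obj₂ := fun n =>
    ⟨_, (DerivedCategory.Plus.homologyFunctor (Sh k Y) 0).homologySequence_exact₁ T hT (n - 1) n
      (by lia), rfl, rfl, rfl⟩
  refine ⟨?_, fun n y => ?_⟩
  · obtain ⟨a, ha⟩ := h₂.1
    obtain ⟨b, hb⟩ := h₃.1
    -- The connecting map from the third vertex raises the degree by one.
    refine ⟨max a (b + 1), isLE_of_isZero_homology _ _ fun m hm => ?_⟩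
    obtain ⟨S, hS, e₁, e₂, e₃⟩ := hex m
    rw [← e₂]
    refine hS.isZero_of_both_zeros (IsZero.eq_of_src ?_ _ _) (IsZero.eq_of_tgt ?_ _ _)
    · rw [e₁]
      exact DerivedCategory.Plus.isZero_homology_of_isLE _ b _ (by lia)
    · rw [e₃]
      exact DerivedCategory.Plus.isZero_homology_of_isLE _ a _ (by lia)
  · obtain ⟨S, hS, e₁, e₂, e₃⟩ := hex n
    rw [← e₂]
    refine finite_stalk_of_exact hS y ?_ ?_
    · rw [e₁]
      exact (h₃.2 _).1 y
    · rw [e₃]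
      exact (h₂.2 _).1 y

variable {Z : Set X} (hZ : IsClosed Z) [DiscreteTopology Z]

/-- The localization triangle gives boundedness and finite stalks; the cohomology sheaves vanish off
the discrete closed set Z, so they are constructible. -/
lemma isDbc_supp {A : D k X} (hA : IsDbc k A) (hr : IsDbc k (restr k Z A)) :
    IsDbc k (supp k hZ A) := by
  obtain ⟨h, hT, -⟩ := existsUnique_isLocTriangle k hZ A
  obtain ⟨hb, hf⟩ := finite_stalk_and_isZero_of_distinguished hT hA hr
  refine ⟨hb, fun n => isConstructible_of_isZero_pullback k hZ (hf n) ?_⟩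
  refine IsZero.of_iso ?_ (nonempty_homology_mapDPlus_iso
    (TopCat.Sheaf.pullback (ModuleCat.{u} k) (incl Zᶜ)) (supp k hZ A) n).some.symm
  exact Functor.map_isZero _ (isZero_pull_push k hZ _)

/-- Since i_* is fully faithful, i^! A ≅ i^* i_* i^! A, and i^* is exact and preserves stalks. -/
lemma isDbc_shriek {A : D k X} (hA : IsDbc k (supp k hZ A)) :
    IsDbc k ((shriek k (incl_isClosedEmbedding hZ)).obj A) := by
  have := isIso_counit_pullPush k (incl_isClosedEmbedding hZ).isInducing
    ((shriek k (incl_isClosedEmbedding hZ)).obj A)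
  refine IsDbc.of_iso (K := (pull k (incl Z)).obj (supp k hZ A)) ?_
    (asIso ((pullPushAdj k (incl Z)).counit.app _))
  have e := fun n => nonempty_homology_mapDPlus_iso
    (TopCat.Sheaf.pullback (ModuleCat.{u} k) (incl Z)) (supp k hZ A) n
  obtain ⟨⟨n, hn⟩, h⟩ := hA
  have : DiscreteTopology (TopCat.of Z) := ‹DiscreteTopology Z›
  refine ⟨⟨n, isLE_of_isZero_homology _ _ fun m hm => ?_⟩, fun m => ?_⟩
  · exact IsZero.of_iso (Functor.map_isZero _
      (DerivedCategory.Plus.isZero_homology_of_isLE _ n m hm)) (e m).some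
  · refine IsConstructible.of_iso (isConstructible_of_discreteTopology k fun z => ?_)
      (e m).some.symm
    exact finite_of_iso k ((stalkPullbackIso k (incl Z) z).app _).symm ((h m).1 _)

end Constructible

/-! ### The direct image of the constant sheaf from the two arcs -/

section TwoArcs

open Pretriangulated

variable (k : Type u) [Field k]

/-- The direct image of `k_U` from the complement of a nonempty closed subset of the circle. -/
lemma nonempty_push_one_iso {S : Set S1.{u}} (hS : IsOpen S) {p : S1.{u}} (hp : p ∉ S) :
    Nonempty ((push k (incl S)).obj (one k (TopCat.of S)) ≅
      (sgl _).obj ((TopCat.Sheaf.pushforward (ModuleCat.{u} k) (incl S)).obj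
        (constSh k (TopCat.of S) (ModuleCat.of k k)))) := by
  have hsurj := toQuot_surjective_of_notMem_range k hS hp
  have : Injective (fnSeq k (TopCat.of S)).X₂ := inferInstanceAs (Injective (fnSh k (TopCat.of S)))
  have : Injective (fnSeq k (TopCat.of S)).X₃ :=
    (quotSh_isFlabby fun V => Or.inr (hsurj V)).injective
  let R := TopCat.Sheaf.pushforward (ModuleCat.{u} k) (incl S)
  have : PreservesLimits R := (TopCat.Sheaf.pullbackPushforwardAdjunction
    (ModuleCat.{u} k) (incl S)).rightAdjoint_preservesLimits
  have hex := fnSeq_shortExact k (TopCat.of S)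
  -- Sections of the quotient lift over every open subset of S, so the direct image keeps the
  -- resolution exact.
  have hRS : ((fnSeq k (TopCat.of S)).map R).ShortExact := by
    have := hex.mono_f
    refine ShortComplex.ShortExact.mk' (hex.exact.map_of_mono_of_preservesKernel R this
      inferInstance) (R.map_mono _) (epi_of_local_lift _ fun V s x hx => ⟨V, le_rfl, hx, ?_⟩)
    obtain ⟨t, ht⟩ := hsurj ((Opens.map (incl S)).obj V) s
    exact ⟨t, ht.trans (res_self _ _ _).symm⟩
  exact nonempty_rightAdjoint_single_iso (pullPushAdj k (incl S))
    (TopCat.Sheaf.pullbackPushforwardAdjunction (ModuleCat.{u} k) (incl S)) hex hRS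

/-- A section of `k_Y` given by a locally constant function. -/
lemma exists_indSec {Y : TopCat.{u}} {V₁ V₂ : Opens Y} (hd : Disjoint V₁ V₂) (V : Opens Y)
    (hV : V ≤ V₁ ⊔ V₂) : ∃ s, onSec (constToFn k Y) V s = indFn k V₁ V := by
  refine (exists_onSec_constToFn_eq_iff k _).2 (isLocallyConstant_of_le_sup hV _ 1 0
    (fun x hx => if_pos hx) fun x hx => if_neg fun h => ?_)
  exact (hd.le_bot ⟨h, hx⟩ : x.1 ∈ (⊥ : Opens Y))

lemma exists_const_on {Y : TopCat.{u}} {V : Opens Y} {f : V → k} (hf : IsLocallyConstant f)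
    {T : Set Y} (hT : IsPreconnected T) (hTV : ∀ x ∈ T, x ∈ V) :
    ∃ c, ∀ x : V, x.1 ∈ T → f x = c := by
  rcases T.eq_empty_or_nonempty with rfl | ⟨y, hy⟩
  -- A small arc may miss one of the two halves, so T can be empty.
  · exact ⟨0, fun x hx => hx.elim⟩
  · exact ⟨_, fun x hx => eq_of_isPreconnected k hf hT hTV hx hy⟩

/-- On a small arc around x a section is constant on the trace of each half, hence a combination of
the two indicators. The stalk at p is reached by exchanging p and q. -/
lemma finite_stalk_pushforward_const {p q : S1.{u}} (hpq : p ≠ q) {S : Set S1.{u}}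
    (hS : ∀ x, x ∈ S ↔ x ≠ p ∧ x ≠ q) {x : S1.{u}} (hx : x ≠ p) :
    Module.Finite k ((stalkF k x).obj ((TopCat.Sheaf.pushforward (ModuleCat.{u} k) (incl S)).obj
      (constSh k (TopCat.of S) (ModuleCat.of k k)))) := by
  obtain ⟨V₁, V₂, hV, hd, -, -, hT⟩ := exists_two_arcs hpq
  have hmem : ∀ y, y ∈ S ↔ y ∈ V₁ ∨ y ∈ V₂ := fun y => by
    have : y ∈ V₁ ⊔ V₂ ↔ y ∈ compl p ⊓ compl q := by rw [hV]
    exact (hS y).trans this.symm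
  let W₁ := (Opens.map (incl S)).obj V₁
  let W₂ := (Opens.map (incl S)).obj V₂
  have hd₁ : Disjoint W₁ W₂ := by
    rw [disjoint_iff_inf_le]
    exact fun y hy => (hd.le_bot (⟨hy.1, hy.2⟩ : y.1 ∈ V₁ ⊓ V₂) : y.1 ∈ (⊥ : Opens S1))
  have hsup : (⊤ : Opens (TopCat.of S)) ≤ W₁ ⊔ W₂ := fun y _ => (hmem y.1).1 y.2
  obtain ⟨t₁, ht₁⟩ := exists_indSec k hd₁ ⊤ hsup
  obtain ⟨t₂, ht₂⟩ := exists_indSec k hd₁.symm ⊤ (hsup.trans (sup_comm _ _).le)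
  refine finite_stalk_of_span k _ x (fun b : Bool => if b then t₁ else t₂) fun V s hxV => ?_
  obtain ⟨T, hxT, hTV, hT₁, hT₂⟩ := hT x hx V hxV
  let F := (TopCat.Sheaf.pushforward (ModuleCat.{u} k) (incl S)).obj
      (constSh k (TopCat.of S) (ModuleCat.of k k))
  let T' := (Opens.map (incl S)).obj T
  let s' : Sec (constSh k (TopCat.of S) (ModuleCat.of k k)) T' := res F hTV s
  have hs := (exists_onSec_constToFn_eq_iff k _).1 ⟨s', rfl⟩
  have hpre : ∀ V : Opens S1.{u}, (∀ y ∈ V, y ∈ S) → IsPreconnected ((T : Set S1.{u}) ∩ V) →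
      IsPreconnected (Subtype.val ⁻¹' ((T : Set S1.{u}) ∩ V) : Set (TopCat.of S)) := by
    intro V hV h
    refine Topology.IsInducing.subtypeVal.isPreconnected_image.1 ?_
    have : (Subtype.val '' (Subtype.val ⁻¹' ((T : Set S1.{u}) ∩ V) : Set S) : Set S1.{u}) =
        (T : Set S1.{u}) ∩ V := by
      rw [Subtype.image_preimage_coe]
      exact Set.inter_eq_right.2 fun y hy => hV y hy.2
    exact (congrArg IsPreconnected this).mpr h
  obtain ⟨c₁, hc₁⟩ := exists_const_on k hs (hpre V₁ (fun y hy => (hmem y).2 (Or.inl hy)) hT₁)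
    fun y hy => hy.1
  obtain ⟨c₂, hc₂⟩ := exists_const_on k hs (hpre V₂ (fun y hy => (hmem y).2 (Or.inr hy)) hT₂)
    fun y hy => hy.1
  refine ⟨T, hTV, hxT, fun b => if b then c₁ else c₂, ?_⟩
  rw [Fintype.sum_bool]
  have key : s' = c₁ • res (constSh k (TopCat.of S) (ModuleCat.of k k)) (le_top : T' ≤ ⊤) t₁ +
      c₂ • res (constSh k (TopCat.of S) (ModuleCat.of k k)) (le_top : T' ≤ ⊤) t₂ := by
    apply onSec_constToFn_injective k T'
    rw [map_add, map_smul, map_smul, onSec_res, onSec_res, ht₁, ht₂]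
    funext y
    change onSec (constToFn k _) T' s' y = c₁ * indFn k W₁ ⊤ ⟨y.1, trivial⟩ +
      c₂ * indFn k W₂ ⊤ ⟨y.1, trivial⟩
    rcases (hmem y.1.1).1 y.1.2 with h | h
    · have e₁ : indFn k W₁ ⊤ ⟨y.1, trivial⟩ = 1 := if_pos h
      have e₂ : indFn k W₂ ⊤ ⟨y.1, trivial⟩ = 0 :=
        if_neg fun h' => (hd.le_bot (⟨h, h'⟩ : y.1.1 ∈ V₁ ⊓ V₂) : y.1.1 ∈ (⊥ : Opens S1))
      rw [e₁, e₂, hc₁ y ⟨y.2, h⟩]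
      ring
    · have e₁ : indFn k W₂ ⊤ ⟨y.1, trivial⟩ = 1 := if_pos h
      have e₂ : indFn k W₁ ⊤ ⟨y.1, trivial⟩ = 0 :=
        if_neg fun h' => (hd.le_bot (⟨h', h⟩ : y.1.1 ∈ V₁ ⊓ V₂) : y.1.1 ∈ (⊥ : Opens S1))
      rw [e₁, e₂, hc₂ y ⟨y.2, h⟩]
      ring
  exact key

lemma isDbc_restr_S1 {p q : S1.{u}} (hpq : p ≠ q) :
    IsDbc k (restr k {p, q} (one k S1.{u})) := by
  have hS : ∀ x, x ∈ ({p, q} : Set S1.{u})ᶜ ↔ x ≠ p ∧ x ≠ q := fun x => by simp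
  have hp : p ∉ ({p, q} : Set S1.{u})ᶜ := by simp
  have hZ := isClosed_pair p q
  have : DiscreteTopology ({p, q} : Set S1.{u}) := inferInstance
  refine IsDbc.of_iso ?_ ((nonempty_push_one_iso k hZ.isOpen_compl hp).some.symm ≪≫
    (push k _).mapIso (pullOneIso k (incl ({p, q} : Set S1.{u})ᶜ)).symm)
  apply IsConstructible.isDbc
  refine ⟨fun x => ?_, {p, q}, hZ, this, fun x hx => ⟨_, hZ.isOpen_compl, hx, ModuleCat.of k k,
    ⟨@asIso _ _ _ _ _ (isIso_counit_of_isInducing k Topology.IsInducing.subtypeVal _)⟩⟩⟩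
  by_cases hx : x = p
  · exact finite_stalk_pushforward_const k hpq.symm (fun y => (hS y).trans and_comm)
      fun h => hpq (hx.symm.trans h)
  · exact finite_stalk_pushforward_const k hpq hS hx

end TwoArcs

/-! ### Torsors under a line and the diagonal quotient -/

section LinearAlgebra

variable {k M N : Type*} [Field k] [AddCommGroup M] [Module k M] [AddCommGroup N] [Module k N]

lemma isTorsorUnder_fiber (f : M →ₗ[k] N) (hf : Function.Surjective f) (c : N) :
    IsTorsorUnder k {x | f x = c} (LinearMap.ker f) := by
  refine ⟨hf c, fun g hg s hs => ?_, fun s hs t ht => ⟨t - s, ⟨?_, by abel⟩, ?_⟩⟩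
  · change f (s + g) = c
    rw [map_add, LinearMap.mem_ker.1 hg, add_zero]
    exact hs
  · rw [LinearMap.mem_ker, map_sub, sub_eq_zero]
    exact Eq.trans ht (Eq.symm hs)
  · rintro g ⟨-, rfl⟩
    abel

variable {S : Set M} {G : Submodule k M}

lemma IsTorsorUnder.image (h : IsTorsorUnder k S G) (e : M ≃ₗ[k] N) :
    IsTorsorUnder k (e '' S) (G.map e.toLinearMap) := by
  refine ⟨h.1.image e, ?_, ?_⟩
  · rintro _ ⟨g, hg, rfl⟩ _ ⟨s, hs, rfl⟩
    exact ⟨s + g, h.2.1 g hg s hs, map_add e s g⟩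
  · rintro _ ⟨s, hs, rfl⟩ _ ⟨t, ht, rfl⟩
    obtain ⟨g, ⟨hg, rfl⟩, -⟩ := h.2.2 s hs t ht
    refine ⟨e g, ⟨⟨g, hg, rfl⟩, map_add e s g⟩, ?_⟩
    rintro g' ⟨-, hg'⟩
    rw [map_add] at hg'
    exact (add_left_cancel hg').symm

lemma IsTorsorUnder.not_singleton (h : IsTorsorUnder k S G) (hG : G ≠ ⊥) : ¬ ∃ a, S = {a} := by
  rintro ⟨a, rfl⟩
  obtain ⟨g, hg, hg0⟩ := G.exists_mem_ne_zero_of_ne_bot hG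
  have := h.2.1 g hg a rfl
  exact hg0 (left_eq_add.1 this.symm)

lemma IsTorsorUnder.affine {v : M} (h : IsTorsorUnder k S (Submodule.span k {v})) (hv : v ≠ 0)
    {s : M} (hs : s ∈ S) :
    (∀ t : k, s + t • v ∈ S) ∧ ∀ s' ∈ S, ∃! t : k, s' = s + t • v := by
  refine ⟨fun t => h.2.1 _ (Submodule.smul_mem _ _ (Submodule.mem_span_singleton_self v)) s hs,
    fun s' hs' => ?_⟩
  obtain ⟨g, ⟨hg, rfl⟩, -⟩ := h.2.2 s hs s' hs'
  obtain ⟨t, rfl⟩ := Submodule.mem_span_singleton.1 hg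
  exact ⟨t, rfl, fun t' ht' => smul_left_injective k hv (add_left_cancel ht').symm⟩

lemma nonempty_span_singleton_equiv {v : M} (hv : v ≠ 0) :
    Nonempty (Submodule.span k {v} ≃ₗ[k] k) :=
  ⟨(LinearEquiv.toSpanNonzeroSingleton k M v hv).symm⟩

variable {δ : N →ₗ[k] M} {e₁ e₂ : N}

/-- The sum e₁ + e₂ is the case a = b = 1 of the kernel condition. -/
lemma apply_eq_neg (hker : ∀ a b : k, δ (a • e₁ + b • e₂) = 0 ↔ a = b) : δ e₂ = - δ e₁ := by
  have h := (hker 1 1).2 rfl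
  rw [one_smul, one_smul, map_add] at h
  exact eq_neg_of_add_eq_zero_right h

lemma apply_ne_zero (hker : ∀ a b : k, δ (a • e₁ + b • e₂) = 0 ↔ a = b) : δ e₁ ≠ 0 := by
  intro h
  exact one_ne_zero ((hker 1 0).1 (by simpa using h))

lemma range_eq_span (hspan : ∀ x, ∃ a b : k, a • e₁ + b • e₂ = x)
    (hker : ∀ a b : k, δ (a • e₁ + b • e₂) = 0 ↔ a = b) :
    LinearMap.range δ = Submodule.span k {δ e₁} := by
  apply le_antisymm
  · rintro _ ⟨x, rfl⟩
    obtain ⟨a, b, rfl⟩ := hspan x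
    rw [map_add, map_smul, map_smul, apply_eq_neg hker, Submodule.mem_span_singleton]
    exact ⟨a - b, by module⟩
  · rw [Submodule.span_singleton_le_iff_mem]
    exact ⟨e₁, rfl⟩

lemma exists_quotient_diagonal_equiv (hspan : ∀ x, ∃ a b : k, a • e₁ + b • e₂ = x)
    (hker : ∀ a b : k, δ (a • e₁ + b • e₂) = 0 ↔ a = b) :
    ∃ φ : ((k × k) ⧸ LinearMap.range ((LinearMap.id : k →ₗ[k] k).prod LinearMap.id)) ≃ₗ[k]
      LinearMap.range δ,
      ∀ a b : k, (φ (Submodule.Quotient.mk (a, b)) : M) = δ (a • e₁ + b • e₂) := by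
  let g : k × k →ₗ[k] N :=
    (LinearMap.toSpanSingleton k N e₁).coprod (LinearMap.toSpanSingleton k N e₂)
  have hg : LinearMap.range ((LinearMap.id : k →ₗ[k] k).prod LinearMap.id) =
      LinearMap.ker (δ ∘ₗ g) := by
    ext ⟨a, b⟩
    rw [LinearMap.mem_ker]
    refine Iff.trans ?_ (hker a b).symm
    constructor
    · rintro ⟨c, hc⟩
      exact (congrArg Prod.fst hc).symm.trans (congrArg Prod.snd hc)
    · rintro rfl
      exact ⟨a, rfl⟩
  have hr : LinearMap.range (δ ∘ₗ g) = LinearMap.range δ := by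
    refine LinearMap.range_comp_of_range_eq_top _ (LinearMap.range_eq_top.2 fun x => ?_)
    obtain ⟨a, b, h⟩ := hspan x
    exact ⟨(a, b), h⟩
  exact ⟨(Submodule.quotEquivOfEq _ _ hg).trans
    ((δ ∘ₗ g).quotKerEquivRange.trans (LinearEquiv.ofEq _ _ hr)), fun a b => rfl⟩

end LinearAlgebra

/-! ### Locally constant sections on two components -/

section Indicators

variable {Y : TopCat.{u}} {U₁ U₂ : Opens Y}

lemma IsTwoComponents.symm (h : IsTwoComponents U₁ U₂) : IsTwoComponents U₂ U₁ :=
  ⟨h.connected₂, h.connected₁, h.disjoint.symm, by rw [sup_comm, h.sup_eq_top]⟩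

lemma IsTwoComponents.mem_or_mem (h : IsTwoComponents U₁ U₂) (y : Y) : y ∈ U₁ ∨ y ∈ U₂ :=
  h.sup_eq_top.ge (Opens.mem_top y)

variable (k : Type u) [Field k]

lemma IsTwoComponents.exists_isIndicator (h : IsTwoComponents U₁ U₂) : ∃ s, IsIndicator k U₁ s := by
  obtain ⟨s, hs⟩ := exists_indSec k h.disjoint ⊤ h.sup_eq_top.ge
  refine ⟨s, ?_, fun W hW => ?_⟩
  · apply onSec_constToFn_injective k U₁
    refine (onSec_res (constToFn k Y) le_top s).trans
      (Eq.trans ?_ (onSec_res (constToFn k Y) le_top (oneSec k Y)).symm)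
    rw [hs, onSec_constToFn_oneSec]
    funext x
    exact if_pos x.2
  · apply onSec_constToFn_injective k W
    refine (onSec_res (constToFn k Y) le_top s).trans (Eq.trans ?_ (map_zero _).symm)
    rw [hs]
    funext x
    exact if_neg fun hx => (hW.le_bot ⟨hx, x.2⟩ : x.1 ∈ (⊥ : Opens Y))

lemma IsIndicator.onSec_eq {s : ΓConst k Y} (hs : IsIndicator k U₁ s) (h : IsTwoComponents U₁ U₂) :
    onSec (constToFn k Y) ⊤ s = indFn k U₁ ⊤ := by
  funext x
  rcases h.mem_or_mem x.1 with hx | hx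
  · have h₁ := congrFun ((onSec_res (constToFn k Y) (le_top : U₁ ≤ ⊤) s).symm.trans
      ((congrArg (onSec (constToFn k Y) U₁) hs.1).trans
        (onSec_res (constToFn k Y) (le_top : U₁ ≤ ⊤) (oneSec k Y)))) ⟨x.1, hx⟩
    rw [onSec_constToFn_oneSec] at h₁
    exact h₁.trans (if_pos hx).symm
  · have h₁ := congrFun ((onSec_res (constToFn k Y) (le_top : U₂ ≤ ⊤) s).symm.trans
      ((congrArg (onSec (constToFn k Y) U₂) (hs.2 U₂ h.disjoint)).trans (map_zero _))) ⟨x.1, hx⟩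
    exact h₁.trans (if_neg fun hx' => (h.disjoint.le_bot ⟨hx', hx⟩ : x.1 ∈ (⊥ : Opens Y))).symm

variable {k} {s₁ s₂ : ΓConst k Y}

lemma onSec_indicators (h : IsTwoComponents U₁ U₂) (h₁ : IsIndicator k U₁ s₁)
    (h₂ : IsIndicator k U₂ s₂) (a b : k) (x : (⊤ : Opens Y)) :
    (x.1 ∈ U₁ → onSec (constToFn k Y) ⊤ (a • s₁ + b • s₂) x = a) ∧
      (x.1 ∈ U₂ → onSec (constToFn k Y) ⊤ (a • s₁ + b • s₂) x = b) := by
  have hd : ∀ x, x ∈ U₁ → x ∉ U₂ := fun x h₁ h₂ => (h.disjoint.le_bot ⟨h₁, h₂⟩ : x ∈ (⊥ : Opens Y))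
  have e : onSec (constToFn k Y) ⊤ (a • s₁ + b • s₂) x =
      a * indFn k U₁ ⊤ x + b * indFn k U₂ ⊤ x := by
    rw [map_add, map_smul, map_smul, h₁.onSec_eq k h, h₂.onSec_eq k h.symm]
    rfl
  constructor
  · intro hx
    have e₁ : indFn k U₁ ⊤ x = 1 := if_pos hx
    have e₂ : indFn k U₂ ⊤ x = 0 := if_neg (hd _ hx)
    rw [e, e₁, e₂, mul_one, mul_zero, add_zero]
  · intro hx
    have e₁ : indFn k U₁ ⊤ x = 0 := if_neg fun h => hd _ h hx
    have e₂ : indFn k U₂ ⊤ x = 1 := if_pos hx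
    rw [e, e₁, e₂, mul_one, mul_zero, zero_add]

lemma exists_combination_indicators (h : IsTwoComponents U₁ U₂) (h₁ : IsIndicator k U₁ s₁)
    (h₂ : IsIndicator k U₂ s₂) (s : ΓConst k Y) : ∃ a b : k, a • s₁ + b • s₂ = s := by
  have hs := (exists_onSec_constToFn_eq_iff k _).1 ⟨s, rfl⟩
  obtain ⟨a, ha⟩ := exists_const_on k hs h.connected₁.isPreconnected fun _ _ => trivial
  obtain ⟨b, hb⟩ := exists_const_on k hs h.connected₂.isPreconnected fun _ _ => trivial
  refine ⟨a, b, onSec_constToFn_injective k ⊤ (funext fun x => ?_)⟩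
  rcases h.mem_or_mem x.1 with hx | hx
  · exact ((onSec_indicators h h₁ h₂ a b x).1 hx).trans (ha x hx).symm
  · exact ((onSec_indicators h h₁ h₂ a b x).2 hx).trans (hb x hx).symm

lemma combination_indicators_eq_iff (h : IsTwoComponents U₁ U₂) (h₁ : IsIndicator k U₁ s₁)
    (h₂ : IsIndicator k U₂ s₂) (a b : k) :
    (∃ c : k, a • s₁ + b • s₂ = c • oneSec k Y) ↔ a = b := by
  have hc : ∀ (c : k) x, onSec (constToFn k Y) ⊤ (c • oneSec k Y) x = c := fun c x => by
    rw [map_smul, onSec_constToFn_oneSec]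
    exact mul_one c
  constructor
  · rintro ⟨c, hs⟩
    obtain ⟨x, hx⟩ := h.connected₁.nonempty
    obtain ⟨y, hy⟩ := h.connected₂.nonempty
    have e₁ := (onSec_indicators h h₁ h₂ a b ⟨x, trivial⟩).1 hx
    have e₂ := (onSec_indicators h h₁ h₂ a b ⟨y, trivial⟩).2 hy
    rw [hs, hc] at e₁ e₂
    exact e₁.symm.trans e₂
  · rintro rfl
    refine ⟨a, onSec_constToFn_injective k ⊤ (funext fun x => ?_)⟩
    rw [hc]
    rcases h.mem_or_mem x.1 with hx | hx
    · exact (onSec_indicators h h₁ h₂ a a x).1 hx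
    · exact (onSec_indicators h h₁ h₂ a a x).2 hx

lemma exists_isTwoComponents {p q : S1.{u}} (hpq : p ≠ q) :
    ∃ U₁ U₂ : Opens (TopCat.of (({p, q} : Set S1.{u})ᶜ : Set S1.{u})), IsTwoComponents U₁ U₂ := by
  obtain ⟨V₁, V₂, hV, hd, hc₁, hc₂, -⟩ := exists_two_arcs hpq
  have hmem : ∀ y, y ∈ ({p, q} : Set S1.{u})ᶜ ↔ y ∈ V₁ ∨ y ∈ V₂ := fun y => by
    have : y ∈ V₁ ⊔ V₂ ↔ y ∈ compl p ⊓ compl q := by rw [hV]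
    refine Iff.trans ?_ this.symm
    change ¬ (y = p ∨ y = q) ↔ y ≠ p ∧ y ≠ q
    exact not_or
  have hconn : ∀ V : Opens S1.{u}, (∀ y ∈ V, y ∈ ({p, q} : Set S1.{u})ᶜ) →
      IsConnected (V : Set S1.{u}) →
      IsConnected (Subtype.val ⁻¹' (V : Set S1.{u}) : Set (({p, q} : Set S1.{u})ᶜ : Set _)) := by
    intro V hV h
    obtain ⟨y, hy⟩ := h.nonempty
    refine ⟨⟨⟨y, hV y hy⟩, hy⟩, Topology.IsInducing.subtypeVal.isPreconnected_image.1 ?_⟩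
    rw [Subtype.image_preimage_coe, Set.inter_eq_right.2 hV]
    exact h.isPreconnected
  refine ⟨(Opens.map (incl _)).obj V₁, (Opens.map (incl _)).obj V₂,
    hconn V₁ (fun y hy => (hmem y).2 (Or.inl hy)) hc₁,
    hconn V₂ (fun y hy => (hmem y).2 (Or.inr hy)) hc₂, ?_, ?_⟩
  · rw [disjoint_iff_inf_le]
    exact fun y hy => (hd.le_bot (⟨hy.1, hy.2⟩ : y.1 ∈ V₁ ⊓ V₂) : y.1 ∈ (⊥ : Opens S1))
  · exact eq_top_iff.2 fun y _ => (hmem y.1).1 y.2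

end Indicators

/-! ### The long exact sequence of the localization triangle -/

section Localization

open Pretriangulated

variable (k : Type u) [Field k] {X Y : TopCat.{u}}

/-- The class of a global section of `k_X` depends linearly and bijectively on the section. -/
lemma exists_secClass_equiv (f : X ⟶ Y) :
    ∃ e : ΓConst k X ≃ₗ[k] H k ((pull k f).obj (one k Y)) 0, ∀ s, e s = secClass k f s := by
  let i : one k X ≅ ((pull k f).obj (one k Y))⟦(0 : ℤ)⟧ :=
    (pullOneIso k f).symm ≪≫ (shiftFunctorZero (D k X) ℤ).symm.app _
  let g : ΓConst k X →ₗ[k] H k ((pull k f).obj (one k Y)) 0 :=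
    { toFun := fun s => (sgl _).map ((homConstEquiv k _).symm s) ≫ i.hom
      map_add' := fun s t => by
        rw [map_add, Functor.map_add]
        exact Preadditive.add_comp _ _ _ _ _ _
      map_smul' := fun c s => by
        rw [map_smul, Functor.map_smul]
        exact Linear.smul_comp _ _ _ _ _ _ }
  refine ⟨LinearEquiv.ofBijective g ⟨fun s t h => ?_, fun x => ?_⟩, fun s => rfl⟩
  · exact (homConstEquiv k _).symm.injective ((sgl _).map_injective ((cancel_mono i.hom).1 h))
  · obtain ⟨s, hs⟩ := exists_secHom k X (x ≫ i.inv)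
    exact ⟨s, (congrArg (fun t => t ≫ i.hom) hs).trans ((Category.assoc _ _ _).trans
      ((congrArg (fun t => x ≫ t) i.inv_hom_id).trans (Category.comp_id x)))⟩

variable {Z : Set X}

/-- The identification of `H⁰(U; j^* A)` with morphisms `k_X → j_* j^* A`. -/
def restrEquiv (Z : Set X) (A : D k X) :
    H k ((pull k (incl Zᶜ)).obj A) 0 ≃ (one k X ⟶ restr k Z A) :=
  ((Iso.homCongr (pullOneIso k (incl Zᶜ)).symm ((shiftFunctorZero (D k _) ℤ).app _))).trans
    ((pullPushAdj k (incl Zᶜ)).homEquiv _ _)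

lemma restrEquiv_apply (A : D k X) (b : H k ((pull k (incl Zᶜ)).obj A) 0) :
    restrEquiv k Z A b = (pullPushAdj k (incl Zᶜ)).homEquiv _ _
      ((pullOneIso k (incl Zᶜ)).hom ≫ b ≫ (shiftFunctorZero (D k _) ℤ).hom.app _) := rfl

variable (hZ : IsClosed Z)

/-- In degree zero the shift isomorphisms cancel, so δ is composition with the third arrow of the
triangle. -/
lemma conn_zero_apply {A : D k X} (h : restr k Z A ⟶ (supp k hZ A)⟦(1 : ℤ)⟧)
    (b : H k ((pull k (incl Zᶜ)).obj A) 0) :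
    conn k hZ h 0 1 (add_zero 1) b = restrEquiv k Z A b ≫ h := by
  have h₁ : h⟦(0 : ℤ)⟧' ≫ (shiftFunctorAdd' (D k X) 1 0 1 (add_zero 1)).inv.app _ =
      (shiftFunctorZero (D k X) ℤ).hom.app _ ≫ h := by
    rw [shiftFunctorAdd'_add_zero_inv_app]
    exact (shiftFunctorZero (D k X) ℤ).hom.naturality h
  have h₂ : ((push k (incl Zᶜ)).commShiftIso (0 : ℤ)).hom.app ((pull k (incl Zᶜ)).obj A) ≫
      (shiftFunctorZero (D k X) ℤ).hom.app _ =
        (push k (incl Zᶜ)).map ((shiftFunctorZero (D k _) ℤ).hom.app _) := by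
    rw [Functor.commShiftIso_zero, Functor.CommShift.isoZero_hom_app]
    simp
  have h₃ := (pullPushAdj k (incl Zᶜ)).homEquiv_naturality_right
    ((pullOneIso k (incl Zᶜ)).hom ≫ b) ((shiftFunctorZero (D k _) ℤ).hom.app _)
  change (pullPushAdj k (incl Zᶜ)).homEquiv _ _ ((pullOneIso k (incl Zᶜ)).hom ≫ b) ≫
    ((push k (incl Zᶜ)).commShiftIso 0).hom.app _ ≫ h⟦(0 : ℤ)⟧' ≫
      (shiftFunctorAdd' (D k X) 1 0 1 (add_zero 1)).inv.app _ = _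
  rw [h₁, restrEquiv_apply]
  rw [Category.assoc] at h₃
  rw [h₃, ← h₂]
  simp only [Category.assoc]

lemma range_conn {A : D k X} {h : restr k Z A ⟶ (supp k hZ A)⟦(1 : ℤ)⟧}
    (hT : IsLocTriangle k hZ A h) :
    LinearMap.range (conn k hZ h 0 1 (add_zero 1)) = LinearMap.ker (forg k hZ A 1) := by
  ext x
  rw [LinearMap.mem_ker]
  constructor
  · rintro ⟨b, rfl⟩
    rw [conn_zero_apply]
    refine (Category.assoc _ _ _).trans ((congrArg (fun t => _ ≫ t)
      (comp_distTriang_mor_zero₃₁ _ hT)).trans comp_zero)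
  · intro hx
    obtain ⟨g, hg⟩ := Triangle.coyoneda_exact₁ _ hT x hx
    refine ⟨(restrEquiv k Z A).symm g, ?_⟩
    rw [conn_zero_apply]
    exact (congrArg (fun t => t ≫ h) ((restrEquiv k Z A).apply_symm_apply g)).trans hg.symm

lemma conn_eq_zero_iff {A : D k X} {h : restr k Z A ⟶ (supp k hZ A)⟦(1 : ℤ)⟧}
    (hT : IsLocTriangle k hZ A h) (b : H k ((pull k (incl Zᶜ)).obj A) 0) :
    conn k hZ h 0 1 (add_zero 1) b = 0 ↔
      ∃ g : one k X ⟶ A, restrEquiv k Z A b = g ≫ restrUnit k Z A := by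
  rw [conn_zero_apply]
  constructor
  · intro hb
    exact Triangle.coyoneda_exact₃ _ hT _ hb
  · rintro ⟨g, hg⟩
    rw [hg]
    exact (Category.assoc _ _ _).trans ((congrArg (fun t => _ ≫ t)
      (comp_distTriang_mor_zero₂₃ _ hT)).trans comp_zero)

/-- This identifies the map H⁰(X) → H⁰(U): a scalar endomorphism of k_X restricts to the
corresponding constant section. -/
lemma restrEquiv_smul_secClass_oneSec (c : k) :
    restrEquiv k Z (one k X) (c • secClass k (incl Zᶜ) (oneSec k _)) =
      c • restrUnit k Z (one k X) := by
  have h₁ : secHom k (TopCat.of (Zᶜ : Set X)) (oneSec k _) = 𝟙 _ :=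
    hom_constSh_ext k (onSec_secHom k _ _)
  let p := pullOneIso k (incl (Zᶜ : Set X))
  let z := (shiftFunctorZero (D k (TopCat.of (Zᶜ : Set X))) ℤ).app
    ((pull k (incl Zᶜ)).obj (one k X))
  let i : one k (TopCat.of (Zᶜ : Set X)) ≅ ((pull k (incl Zᶜ)).obj (one k X))⟦(0 : ℤ)⟧ :=
    p.symm ≪≫ z.symm
  have h₂ : secClass k (incl Zᶜ) (oneSec k _) = i.hom := by
    refine (congrArg (fun t => (sgl _).map t ≫ i.hom) h₁).trans ?_
    exact (congrArg (fun t => t ≫ i.hom) ((sgl _).map_id _)).trans (Category.id_comp i.hom)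
  have h₃ : (pullOneIso k (incl Zᶜ)).hom ≫ (c • i.hom) ≫
      (shiftFunctorZero (D k _) ℤ).hom.app ((pull k (incl Zᶜ)).obj (one k X)) = c • 𝟙 _ := by
    have h₄ : (pullOneIso k (incl Zᶜ)).hom ≫ i.hom ≫
        (shiftFunctorZero (D k _) ℤ).hom.app ((pull k (incl Zᶜ)).obj (one k X)) = 𝟙 _ :=
      (congrArg (fun t => p.hom ≫ t) ((Category.assoc p.inv z.inv z.hom).trans
        ((congrArg (fun t => p.inv ≫ t) z.inv_hom_id).trans (Category.comp_id _)))).trans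
          p.hom_inv_id
    rw [Linear.smul_comp, Linear.comp_smul, h₄]
  rw [restrEquiv_apply, h₂, h₃, Adjunction.homEquiv_unit, Functor.map_smul, Linear.comp_smul]
  exact congrArg (fun t => c • t) ((congrArg (fun t => _ ≫ t) ((push k (incl Zᶜ)).map_id _)).trans
    (Category.comp_id _))

/-- The obstruction to lifting a class lies in H¹(U; j^* A). -/
lemma forg_surjective {A : D k X}
    (hsub : Subsingleton (H k ((pull k (incl Zᶜ)).obj A) 1)) :
    Function.Surjective (forg k hZ A 1) := by
  obtain ⟨h, hT, -⟩ := existsUnique_isLocTriangle k hZ A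
  intro c
  have hsub' : Subsingleton (one k X ⟶ (restr k Z A)⟦(1 : ℤ)⟧) :=
    ((Iso.homToEquiv (((push k (incl Zᶜ)).commShiftIso (1 : ℤ)).symm.app _)).trans
      (((pullPushAdj k (incl Zᶜ)).homEquiv _ _).symm.trans
        (Iso.homFromEquiv (pullOneIso k (incl Zᶜ))))).subsingleton
  obtain ⟨g, hg⟩ := Triangle.coyoneda_exact₃ _
    (rot_of_distTriang _ (rot_of_distTriang _ hT)) c (hsub'.elim _ _)
  -- Rotating the triangle changes the sign of the shifted counit.
  refine ⟨-g, ?_⟩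
  exact ((Preadditive.neg_comp _ _).trans (Preadditive.comp_neg _ _).symm).trans hg.symm

lemma subsingleton_H_pull_one (f : X ⟶ Y) (h : Subsingleton (H k (one k X) 1)) :
    Subsingleton (H k ((pull k f).obj (one k Y)) 1) :=
  (Iso.homToEquiv ((shiftFunctor (D k X) (1 : ℤ)).mapIso (pullOneIso k f))).subsingleton

/-- By exactness ker δ is the image of Hom(k_X, k_X). On a connected space these are the scalars,
which restrict to the constant sections, that is, to the combinations with a = b. -/
lemma conn_combination_eq_zero_iff [PreconnectedSpace X] (x : X)
    {h : restr k Z (one k X) ⟶ (supp k hZ (one k X))⟦(1 : ℤ)⟧}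
    (hT : IsLocTriangle k hZ (one k X) h) {U₁ U₂ : Opens (TopCat.of (Zᶜ : Set X))}
    (hU : IsTwoComponents U₁ U₂) {s₁ s₂} (h₁ : IsIndicator k U₁ s₁) (h₂ : IsIndicator k U₂ s₂)
    (a b : k) : conn k hZ h 0 1 (add_zero 1)
      (a • secClass k (incl Zᶜ) s₁ + b • secClass k (incl Zᶜ) s₂) = 0 ↔ a = b := by
  obtain ⟨e, he⟩ := exists_secClass_equiv k (incl (Zᶜ : Set X))
  rw [conn_eq_zero_iff k hZ hT, ← combination_indicators_eq_iff hU h₁ h₂]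
  have hab : a • secClass k (incl Zᶜ) s₁ + b • secClass k (incl Zᶜ) s₂ =
      e (a • s₁ + b • s₂) := by
    rw [map_add, map_smul, map_smul, he, he]
  have hc : ∀ c : k, c • secClass k (incl Zᶜ) (oneSec k _) = e (c • oneSec k _) := fun c => by
    rw [map_smul, he]
  rw [hab]
  constructor
  · rintro ⟨g, hg⟩
    obtain ⟨c, rfl⟩ := exists_eq_smul_id k x g
    refine ⟨c, e.injective ((restrEquiv k Z (one k X)).injective ?_)⟩
    rw [← hc, restrEquiv_smul_secClass_oneSec, hg]
    exact (Linear.smul_comp _ _ _ _ _ _).trans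
      (congrArg (fun t => c • t) (Category.id_comp _))
  · rintro ⟨c, hg⟩
    refine ⟨c • 𝟙 _, ?_⟩
    rw [hg, ← hc, restrEquiv_smul_secClass_oneSec]
    exact ((Linear.smul_comp _ _ _ _ _ _).trans
      (congrArg (fun t => c • t) (Category.id_comp _))).symm

lemma exists_combination_secClass {U₁ U₂ : Opens (TopCat.of (Zᶜ : Set X))}
    (hU : IsTwoComponents U₁ U₂) {s₁ s₂} (h₁ : IsIndicator k U₁ s₁) (h₂ : IsIndicator k U₂ s₂)
    (x : H k ((pull k (incl Zᶜ)).obj (one k X)) 0) :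
    ∃ a b : k, a • secClass k (incl Zᶜ) s₁ + b • secClass k (incl Zᶜ) s₂ = x := by
  obtain ⟨e, he⟩ := exists_secClass_equiv k (incl (Zᶜ : Set X))
  obtain ⟨a, b, hab⟩ := exists_combination_indicators hU h₁ h₂ (e.symm x)
  refine ⟨a, b, ?_⟩
  rw [← he, ← he, ← map_smul, ← map_smul, ← map_add, hab, LinearEquiv.apply_symm_apply]

end Localization

end SheafLoc

end

theorem mainTheorem9 (k : Type u) [Field k] (p q : S1.{u}) (hpq : p ≠ q) :
    let hZ : IsClosed ({p, q} : Set S1.{u}) := isClosed_pair p q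
    let Z : TopCat.{u} := TopCat.of ({p, q} : Set S1.{u})
    let U : TopCat.{u} := TopCat.of (({p, q} : Set S1.{u})ᶜ : Set S1.{u})
    let j : U ⟶ S1.{u} := incl ({p, q} : Set S1.{u})ᶜ
    let A : D k S1.{u} := one k S1.{u}
    -- all the objects below lie in the bounded constructible derived categories
    (IsDbc k A ∧ IsDbc k (one k U) ∧ IsDbc k (one k Z) ∧ IsDbc k ((pull k j).obj A) ∧
      IsDbc k (restr k {p, q} A) ∧ IsDbc k (supp k hZ A) ∧
      IsDbc k ((shriek k (incl_isClosedEmbedding hZ)).obj A)) ∧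
    Nonempty (H k A 1 ≃ₗ[k] k) ∧
    (∃! h, IsLocTriangle k hZ A h) ∧
    (∃ U₁ U₂ : Opens U, IsTwoComponents U₁ U₂) ∧
    ∀ U₁ U₂ : Opens U, IsTwoComponents U₁ U₂ →
      (∃ s₁, IsIndicator k U₁ s₁) ∧ (∃ s₂, IsIndicator k U₂ s₂) ∧
      ∀ s₁ s₂, IsIndicator k U₁ s₁ → IsIndicator k U₂ s₂ →
      ∀ h, IsLocTriangle k hZ A h →
        let δ : H k ((pull k j).obj A) 0 →ₗ[k] HZ k hZ A 1 := conn k hZ h 0 1 (add_zero 1)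
        let e₁ : H k ((pull k j).obj A) 0 := secClass k j s₁
        let e₂ : H k ((pull k j).obj A) 0 := secClass k j s₂
        -- `im δ ≅ (k ⊕ k) / Δ(k) ≅ k`
        (∃ φ : ((k × k) ⧸ LinearMap.range
              ((LinearMap.id : k →ₗ[k] k).prod (LinearMap.id : k →ₗ[k] k))) ≃ₗ[k]
            LinearMap.range δ,
          ∀ a b : k, (φ (Submodule.Quotient.mk (a, b)) : HZ k hZ A 1) = δ (a • e₁ + b • e₂)) ∧
        Nonempty (LinearMap.range δ ≃ₗ[k] k) ∧
        ∀ c : H k A 1, c ≠ 0 →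
          pullH k j A 1 c = 0 ∧
          IsTorsorUnder k (Lift k hZ c) (LinearMap.range δ) ∧
          (∀ c₀ ∈ Lift k hZ c, (∀ t : k, c₀ + t • δ e₁ ∈ Lift k hZ c) ∧
            ∀ c' ∈ Lift k hZ c, ∃! t : k, c' = c₀ + t • δ e₁) ∧
          ((2 : k) ≠ 0 → ∀ c₀ ∈ Lift k hZ c,
            (∀ t : k, c₀ + t • δ (e₁ - e₂) ∈ Lift k hZ c) ∧
            ∀ c' ∈ Lift k hZ c, ∃! t : k, c' = c₀ + t • δ (e₁ - e₂)) ∧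
          (¬ ∃ c₀, Lift k hZ c = {c₀}) ∧
          -- the localization torsor in `Hom(k_Z, i^! k_X[1])` is an affine line
          IsTorsorUnder k (LocTor k hZ c)
            ((LinearMap.range δ).map (adjZ k hZ A 1).toLinearMap) ∧
          Nonempty ((LinearMap.range δ).map (adjZ k hZ A 1).toLinearMap ≃ₗ[k] k) ∧
          ¬ ∃ a, LocTor k hZ c = {a} := by
  intro hZ Z U j A
  have hp : p ∉ ({p, q} : Set S1.{u})ᶜ := by simp
  have hdisc : DiscreteTopology ({p, q} : Set S1.{u}) := inferInstance
  have hr : IsDbc k (restr k {p, q} A) := isDbc_restr_S1 k hpq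
  have hs : IsDbc k (supp k hZ A) := isDbc_supp hZ (isDbc_one _) hr
  -- The set U avoids p and so has a chart to the line. This vanishing gives both j^* c = 0 and the
  -- surjectivity of forg.
  have hsub : Subsingleton (H k ((pull k j).obj A) 1) := subsingleton_H_pull_one k j
    (subsingleton_H_one_one k U (toQuot_surjective_of_notMem_range k hZ.isOpen_compl hp ⊤))
  refine ⟨⟨isDbc_one _, isDbc_one _, isDbc_one _, (isDbc_one _).of_iso (pullOneIso k j).symm, hr, hs,
    isDbc_shriek hZ hs⟩, nonempty_H_one_S1_equiv k hpq, existsUnique_isLocTriangle k hZ A,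
    exists_isTwoComponents hpq, fun U₁ U₂ hU => ⟨hU.exists_isIndicator k,
      hU.symm.exists_isIndicator k, ?_⟩⟩
  intro s₁ s₂ h₁ h₂ h hT δ e₁ e₂
  have hspan : ∀ x, ∃ a b : k, a • e₁ + b • e₂ = x := exists_combination_secClass k hU h₁ h₂
  have hker : ∀ a b : k, δ (a • e₁ + b • e₂) = 0 ↔ a = b :=
    conn_combination_eq_zero_iff k hZ p hT hU h₁ h₂
  have hrange : LinearMap.range δ = Submodule.span k {δ e₁} := range_eq_span hspan hker
  have hne : δ e₁ ≠ 0 := apply_ne_zero hker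
  have hbot : LinearMap.range δ ≠ ⊥ := by rwa [hrange, Ne, Submodule.span_singleton_eq_bot]
  have hline : Nonempty (LinearMap.range δ ≃ₗ[k] k) := hrange ▸ nonempty_span_singleton_equiv hne
  refine ⟨exists_quotient_diagonal_equiv hspan hker, hline, fun c _ => ?_⟩
  have ht : IsTorsorUnder k (Lift k hZ c) (LinearMap.range δ) := by
    have := isTorsorUnder_fiber (forg k hZ A 1) (forg_surjective k hZ hsub) c
    rwa [← range_conn k hZ hT] at this
  have ht' := ht.image (adjZ k hZ A 1)
  refine ⟨hsub.elim _ _, ht, fun c₀ hc₀ => (hrange ▸ ht).affine hne hc₀, fun h2 c₀ hc₀ => ?_,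
    ht.not_singleton hbot, ht', ?_, ht'.not_singleton ?_⟩
  -- Since δ e₂ = -δ e₁, the difference maps to twice the generator, which still spans the line when
  -- 2 is invertible.
  · have hd : δ (e₁ - e₂) = (2 : k) • δ e₁ := by
      rw [map_sub, apply_eq_neg hker, sub_neg_eq_add, two_smul]
    have hrange' : LinearMap.range δ = Submodule.span k {δ (e₁ - e₂)} := by
      rw [hrange, hd, Submodule.span_singleton_smul_eq (IsUnit.mk0 _ h2)]
    exact (hrange' ▸ ht).affine (hd ▸ smul_ne_zero h2 hne) hc₀
  · exact hline.map ((adjZ k hZ A 1).submoduleMap (LinearMap.range δ)).symm.trans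
  · rwa [Ne, Submodule.map_eq_bot_iff]
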